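/- **Setting.** Let $E$ be a finite set and let $|\cdot|$ be a norm on $\mathbb R^d$ (for instance the $\ell_1$-norm). For a sequence $x=(x_t)_{t\in\mathbb Z}$ write $x_t^-=(x_t,x_{t-1},\dots)$, and let $d_{TV}(\nu_1,\nu_2)=\frac12\sum_{w\in E}|\nu_1(w)-\nu_2(w)|$ for probability measures on $E$. Let $(S_t)_{t\in\mathbb Z}$ be a stationary Markov chain in a Polish space $\mathcal S$ with invariant law $\pi$, let $P(s_0,\cdot)$ be a regular version of the law of $(S_t)_{t\ge1}$ given $S_0=s_0$, and let $X_t=g(S_t)$ with $g:\mathcal S\to\mathbb R^d$ measurable. Let $\mathcal D\subset(\mathbb R^d)^{\mathbb Z}$ be measurable with $\mathbb P(X\in\mathcal D)=1$, and let $q(w\mid y,z)$ be defined for $w\in E$, $y\in E^{\mathbb N}$ and $z\in\{x_t^-:x\in\mathcal D,\ t\in\mathbb Z\}$, be positive, satisfy $\sum_w q(w\mid y,z)=1$, and be such that $(w,y,x)\mapsto q(w\mid y,x_t^-)$ is measurable on $E\times E^{\mathbb N}\times\mathcal D$ for every $t$. Let $(Y_t)_{t\in\mathbb Z}$ be an $E$-valued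 process on the same probability space with $$\mathbb P(Y_t=w\mid Y_{t-1}^-,X)=q(w\mid Y_{t-1}^-,X_t^-)\ \text{a.s.},\qquad t\in\mathbb Z,\ w\in E,$$ and put $V_t=(Y_t,X_t)$. **Assumptions.** * (S1) $X$ is stationary and ergodic. * (S2) With $b_m=\sup\{d_{TV}(q(\cdot\mid y,x_t^-),q(\cdot\mid y',x_t^-)):\ x\in\mathcal D,\ t\in\mathbb Z,\ y,y'\in E^{\mathbb N},\ y_i=y'_i\text{ for }0\le i<m\}$, we have $b_0<1$ and $\sum_m b_m<\infty$. * (S3) There are $e_m\ge0$ with $\sum_m e_m<\infty$ and $d_{TV}(q(\cdot\mid y,z),q(\cdot\mid y,z'))\le\sum_{i\ge0}e_i|z_i-z_i'|$ for all $y\in E^{\mathbb N}$ and all $z,z'$ in $\{x_t^-:x\in\mathcal D,\ t\in\mathbb Z\}$. * (S1') for a metric $\gamma$ on $\mathbb R^d$: there is a probability kernel $\widetilde P$ such that $\widetilde P((s,\bar s),\cdot)$ is a coupling of $P(s,\cdot)$ and $P(\bar s,\cdot)$ for all $s,\bar s\in\mathcal S$, and $a_t=\int\!\!\int \widetilde E_{s,\bar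 s}[\gamma(g(S_{1,t}),g(S_{2,t}))]\,d\pi(s)\,d\pi(\bar s)\to0$ as $t\to\infty$, where $(S_{1,t},S_{2,t})_{t\ge1}$ are the coordinates under $\widetilde P((s,\bar s),\cdot)$ and $\widetilde E_{s,\bar s}$ is the corresponding expectation. Let $b_0^*=b_0$ and, for $n\ge1$, let $b_n^*$ be the probability that the Markov chain on $\mathbb N$ started at $0$ with transitions $i\to i+1$ with probability $1-b_i$ and $i\to0$ with probability $b_i$ is at $0$ at time $n$. **Dependence coefficients.** With $\mathcal F_0=\sigma(V_i:i\le0)$, $$\beta_V(n)=\mathbb E\Big[\sup_A\big|\mathbb P((V_n,V_{n+1},\dots)\in A\mid\mathcal F_0)-\mathbb P((V_n,V_{n+1},\dots)\in A)\big|\Big],$$ $$\tau_V(n)=\sup_{\ell\ge1}\frac1\ell\sup_{n\le j_1<\dots<j_\ell}\mathbb E\,\mathcal W_{1,\ell}\big(\mathbb P_{(V_{j_1},\dots,V_{j_\ell})\mid\mathcal F_0},\ \mathbb P_{(V_{j_1},\dots,V_{j_\ell})}\big),$$ where conditional laws are regular conditional distributions and $\mathcal W_{1,\ell}(\mu,\nu)$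 is the supremum of $\int f\,d\mu-\int f\,d\nu$ over $\mu$- and $\nu$-integrable $f:(E\times\mathbb R^d)^\ell\to\mathbb R$ with $|f(w)-f(w')|\le\sum_{i=1}^\ell\bar\gamma(w_i,w'_i)$, $\bar\gamma((y,x),(y',x'))=\mathbf 1_{y\ne y'}+|x-x'|$. **Theorem.** Assume (S1), (S2), (S3). All bounds take values in $[0,\infty]$. 1. Assume (S1') for the discrete metric $\gamma(x,x')=\mathbf 1_{x\ne x'}$, and $X_0\in\mathbb L^p$ for some $p\in[1,\infty]$. Let $\frac1p+\frac1r=1$ and $c_t=\max(1,2\|X_0\|_p)\,a_t^{1/r}$ (with $a^{1/\infty}=1$). Then for all $n\ge1$ $$\beta_V(n)\le\sum_{j\ge n}g_j,\qquad g_j=b^*_{j-1}+c_j+\kappa_j+\sum_{i=0}^{j-2}b_i^*\kappa_{j-i-1},\qquad \kappa_j=\sum_{s=0}^{j-1}e_sc_{j-s}+2\sum_{s\ge j}e_s\,\mathbb E|X_0|.$$ 2. Assume (S1') for the metric $\gamma(x,x')=|x-x'|$ induced by the norm (e.g. the $\ell_1$-metric if $|\cdot|$ is the $\ell_1$-norm).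 Then for all $n\ge1$ $$\tau_V(n)\le\sup_{j\ge n}h_j,\qquad h_j=b^*_{j-1}+a_j+\kappa_j+\sum_{i=0}^{j-2}b_i^*\kappa_{j-i-1},\qquad \kappa_j=\sum_{s=0}^{j-1}e_sa_{j-s}+2\sum_{s\ge j}e_s\,\mathbb E|X_0|.$$ If moreover $\mathbb P(Y_t=w\mid Y_{t-1}^-,S)=q(w\mid Y_{t-1}^-,X_t^-)$ a.s. for all $t$ and $w$, the same bound holds when $\mathcal F_0$ is replaced by $\sigma((Y_i,S_i):i\le0)$ in the definition of $\tau_V(n)$. -/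

import Mathlib

open MeasureTheory ProbabilityTheory Filter Topology
open scoped ENNReal NNReal

noncomputable section

/-- `x_t^- = (x_t, x_{t-1}, x_{t-2}, …)`. -/
def past {α : Type*} (x : ℤ → α) (t : ℤ) : ℕ → α := fun j => x (t - j)

/-- The sequence `(x_t, x_{t+1}, x_{t+2}, …)`. -/
def future {α : Type*} (x : ℤ → α) (t : ℤ) : ℕ → α := fun j => x (t + j)

/-- The path `(Z_t(ω))_{t ∈ ℤ}` of a process. -/
def path {Ω α : Type*} (Z : ℤ → Ω → α) (ω : Ω) : ℤ → α := fun t => Z t ω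

/-- Total variation distance between two probability mass functions on a finite set. -/
def dTV {E : Type*} [Fintype E] (ν₁ ν₂ : E → ℝ) : ℝ := (1 / 2) * ∑ w, |ν₁ w - ν₂ w|

/-- `q w y x` is `q(w | y, x)`.  The kernel is only constrained on the histories `x_t^-` with
`x ∈ D`, `t ∈ ℤ`: there it is measurable, positive, and sums to one. -/
structure IsTransition {E G : Type*} [Fintype E] [MeasurableSpace E] [MeasurableSpace G]
    (q : E → (ℕ → E) → (ℕ → G) → ℝ) (D : Set (ℤ → G)) : Prop where
  measurable : ∀ t : ℤ,
    Measurable (fun p : E × (ℕ → E) × D => q p.1 p.2.1 (past (p.2.2 : ℤ → G) t))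
  pos : ∀ w y, ∀ x ∈ D, ∀ t : ℤ, 0 < q w y (past x t)
  sum_eq_one : ∀ y, ∀ x ∈ D, ∀ t : ℤ, ∑ w, q w y (past x t) = 1

/-- The continuity coefficients `b_m`. -/
def contCoef {E G : Type*} [Fintype E] (q : E → (ℕ → E) → (ℕ → G) → ℝ) (D : Set (ℤ → G))
    (m : ℕ) : ℝ :=
  sSup {r : ℝ | ∃ (y y' : ℕ → E) (x : ℤ → G) (t : ℤ), x ∈ D ∧ (∀ i < m, y i = y' i) ∧
    r = dTV (fun w => q w y (past x t)) (fun w => q w y' (past x t))}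

/-- Transition matrix on `ℕ`: from `i` to `i + 1` with probability `1 - b_i`, to `0` with
probability `b_i`. -/
def resetMatrix (b : ℕ → ℝ) (i j : ℕ) : ℝ :=
  if j = i + 1 then 1 - b i else if j = 0 then b i else 0

/-- `resetLaw b n j` is the probability that the Markov chain started at `0` with transition matrix
`resetMatrix b` is in state `j` at time `n`. -/
def resetLaw (b : ℕ → ℝ) : ℕ → ℕ → ℝ
  | 0, j => if j = 0 then 1 else 0
  | n + 1, j => ∑' i, resetLaw b n i * resetMatrix b i j

/-- `b*_0 = b_0` and `b*_n` is the probability that the chain is at `0` at time `n ≥ 1`. -/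
def bStar (b : ℕ → ℝ) (n : ℕ) : ℝ := if n = 0 then b 0 else resetLaw b n 0

/-- `P(Y_t = w | Y_{t-1}^-, C) = q(w | Y_{t-1}^-, X_t^-)` for all `t`, where `C` is the process
(the covariates, or the underlying chain) on whose whole path one conditions. -/
def IsSolution {Ω E G T : Type*} [MeasurableSpace Ω] [MeasurableSpace E] [MeasurableSpace T]
    (μ : Measure Ω) (q : E → (ℕ → E) → (ℕ → G) → ℝ) (Y : ℤ → Ω → E) (X : ℤ → Ω → G)
    (C : ℤ → Ω → T) : Prop :=
  ∀ (t : ℤ) (w : E),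
    μ[(Y t ⁻¹' {w}).indicator (fun _ => (1 : ℝ)) |
        MeasurableSpace.comap (fun ω => (past (path Y ω) (t - 1), path C ω)) inferInstance]
      =ᵐ[μ] fun ω => q w (past (path Y ω) (t - 1)) (past (path X ω) t)

/-- Strict stationarity. -/
def IsStationaryProcess {Ω α : Type*} [MeasurableSpace Ω] [MeasurableSpace α] (μ : Measure Ω)
    (Z : ℤ → Ω → α) : Prop :=
  ∀ k : ℤ, μ.map (fun ω t => Z (t + k) ω) = μ.map (path Z)

/-- Time-homogeneous Markov chain: for some transition kernel `p`, the conditional law of `S_{t+1}`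
given `(S_t, S_{t-1}, …)` is `p(S_t, ·)`. -/
def IsMarkovChain {Ω α : Type*} [MeasurableSpace Ω] [MeasurableSpace α] (μ : Measure Ω)
    (S : ℤ → Ω → α) : Prop :=
  ∃ p : Kernel α α, IsMarkovKernel p ∧ ∀ t : ℤ,
    μ.map (fun ω => (past (path S ω) t, S (t + 1) ω)) =
      (μ.map (fun ω => past (path S ω) t)) ⊗ₘ
        (p.comap (fun s : ℕ → α => s 0) (measurable_pi_apply 0))

/-- `P(s₀, ·)` is the law of `(S_1, S_2, …)` conditional on `S_0 = s₀`. -/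
def IsPathKernel {Ω α : Type*} [MeasurableSpace Ω] [MeasurableSpace α] (μ : Measure Ω)
    (S : ℤ → Ω → α) (P : Kernel α (ℕ → α)) : Prop :=
  μ.map (fun ω => (S 0 ω, future (path S ω) 1)) = (μ.map (S 0)) ⊗ₘ P

/-- `P'((s₀, s₀'), ·)` is a coupling of `P(s₀, ·)` and `P(s₀', ·)`. -/
def IsCouplingKernel {α : Type*} [MeasurableSpace α] (P : Kernel α (ℕ → α))
    (P' : Kernel (α × α) ((ℕ → α) × (ℕ → α))) : Prop :=
  ∀ s s' : α, (P' (s, s')).map Prod.fst = P s ∧ (P' (s, s')).map Prod.snd = P s'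

/-- `a_t`, `t ≥ 1`: mean `γ`-distance at time `t` of the coupled covariates, both chains being
started independently from `π`.  Coordinate `k` of a sequence is its value at time `k + 1`. -/
def couplingRate {α G : Type*} [MeasurableSpace α] (γ : G → G → ℝ≥0∞) (g : α → G) (π : Measure α)
    (P' : Kernel (α × α) ((ℕ → α) × (ℕ → α))) (t : ℕ) : ℝ≥0∞ :=
  ∫⁻ s, ∫⁻ s', ∫⁻ z, γ (g (z.1 (t - 1))) (g (z.2 (t - 1))) ∂(P' (s, s')) ∂π ∂π

open Classical in
/-- The discrete metric. -/
def discreteMetric {G : Type*} (x x' : G) : ℝ≥0∞ := if x = x' then 0 else 1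

/-- The metric induced by the norm. -/
def normMetric {G : Type*} [NormedAddCommGroup G] (x x' : G) : ℝ≥0∞ := ‖x' - x‖ₑ

/-- `κ_j = ∑_{s < j} e_s a_{j-s} + 2 ∑_{s ≥ j} e_s M`. -/
def kappa (e : ℕ → ℝ≥0) (a : ℕ → ℝ≥0∞) (M : ℝ≥0∞) (j : ℕ) : ℝ≥0∞ :=
  ∑ s ∈ Finset.range j, e s * a (j - s) + 2 * ∑' k : ℕ, e (j + k) * M

/-- `b*_{j-1} + a_j + κ_j + ∑_{i=0}^{j-2} b*_i κ_{j-i-1}`, for `j ≥ 1`. -/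
def rate (b : ℕ → ℝ) (e : ℕ → ℝ≥0) (a : ℕ → ℝ≥0∞) (M : ℝ≥0∞) (j : ℕ) : ℝ≥0∞ :=
  ENNReal.ofReal (bStar b (j - 1)) + a j + kappa e a M j +
    ∑ i ∈ Finset.range (j - 1), ENNReal.ofReal (bStar b i) * kappa e a M (j - i - 1)

/-- `β_V(n) = E sup_A |P((V_n, V_{n+1}, …) ∈ A | F_0) - P((V_n, V_{n+1}, …) ∈ A)|` with
`F_0 = σ(V_i : i ≤ 0)`, through the regular conditional distribution. -/
def betaCoef {Ω α : Type*} [MeasurableSpace Ω] [MeasurableSpace α] [StandardBorelSpace α]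
    [Nonempty α] (μ : Measure Ω) [IsProbabilityMeasure μ] (V : ℤ → Ω → α) (n : ℕ) : ℝ≥0∞ :=
  ∫⁻ ω, ⨆ (A : Set (ℕ → α)) (_ : MeasurableSet A),
    ENNReal.ofReal
      |(condDistrib (fun ω => future (path V ω) n) (fun ω => past (path V ω) 0) μ
          (past (path V ω) 0)).real A
        - (μ.map (fun ω => future (path V ω) n)).real A| ∂μ

open Classical in
/-- The metric `1_{y ≠ y'} + |x' - x|` on `E × G`. -/
def gammaBar {E G : Type*} [NormedAddCommGroup G] (v v' : E × G) : ℝ :=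
  (if v.1 = v'.1 then 0 else 1) + ‖v'.2 - v.2‖

/-- Wasserstein distance of order one on `(E × G)^ℓ` for the metric `∑ γ̄(w_i, w_i')`: supremum of
`∫ f dν₁ - ∫ f dν₂` over the functions with Lipschitz constant at most one.  (Integrability of `f`
is automatic when `ν₁, ν₂` have a finite first moment.) -/
def wasserstein {E G : Type*} [MeasurableSpace E] [MeasurableSpace G] [NormedAddCommGroup G]
    {ℓ : ℕ} (ν₁ ν₂ : Measure (Fin ℓ → E × G)) : ℝ≥0∞ :=
  ⨆ (f : (Fin ℓ → E × G) → ℝ) (_ : ∀ w w', |f w - f w'| ≤ ∑ i, gammaBar (w i) (w' i))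
    (_ : Integrable f ν₁) (_ : Integrable f ν₂), ENNReal.ofReal (∫ v, f v ∂ν₁ - ∫ v, f v ∂ν₂)

/-- `τ(σ(Z), U) = E W₁(P_{U | σ(Z)}, P_U)`. -/
def tauDep {Ω E G T : Type*} [MeasurableSpace Ω] [MeasurableSpace E] [StandardBorelSpace E]
    [Nonempty E] [MeasurableSpace G] [StandardBorelSpace G] [NormedAddCommGroup G]
    [MeasurableSpace T] (μ : Measure Ω) [IsProbabilityMeasure μ] (Z : Ω → T) {ℓ : ℕ}
    (U : Ω → (Fin ℓ → E × G)) : ℝ≥0∞ :=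
  ∫⁻ ω, wasserstein (condDistrib U Z μ (Z ω)) (μ.map U) ∂μ

/-- `τ^{(k)}(n)`: maximum over `1 ≤ ℓ ≤ k` of `1/ℓ` times the supremum of
`τ(σ(Z), (V_{j_1}, …, V_{j_ℓ}))` over `n ≤ j_1 < ⋯ < j_ℓ`. -/
def tauCoefK {Ω E G T : Type*} [MeasurableSpace Ω] [MeasurableSpace E] [StandardBorelSpace E]
    [Nonempty E] [MeasurableSpace G] [StandardBorelSpace G] [NormedAddCommGroup G]
    [MeasurableSpace T] (μ : Measure Ω) [IsProbabilityMeasure μ] (Z : Ω → T)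
    (V : ℤ → Ω → E × G) (k n : ℕ) : ℝ≥0∞ :=
  ⨆ (ℓ : ℕ) (_ : 1 ≤ ℓ ∧ ℓ ≤ k), (ℓ : ℝ≥0∞)⁻¹ *
    ⨆ (j : Fin ℓ → ℤ) (_ : StrictMono j ∧ ∀ i, (n : ℤ) ≤ j i), tauDep μ Z (fun ω i => V (j i) ω)

/-- `τ(n) = sup_{k ≥ 1} τ^{(k)}(n)`, relative to the σ-field `F_0 = σ(Z)`. -/
def tauCoef {Ω E G T : Type*} [MeasurableSpace Ω] [MeasurableSpace E] [StandardBorelSpace E]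
    [Nonempty E] [MeasurableSpace G] [StandardBorelSpace G] [NormedAddCommGroup G]
    [MeasurableSpace T] (μ : Measure Ω) [IsProbabilityMeasure μ] (Z : Ω → T)
    (V : ℤ → Ω → E × G) (n : ℕ) : ℝ≥0∞ :=
  ⨆ (k : ℕ) (_ : 1 ≤ k), tauCoefK μ Z V k n

end

open MeasureTheory ProbabilityTheory Filter Topology
open scoped ENNReal NNReal

noncomputable section

/-! Take two independent pasts of responses and chain and couple their continuations: the chains by
`P'`, the responses symbol by symbol by maximal coupling. If the responses agree over the last m
steps, the next symbols differ with probability at most b_m + ε_t, where ε_t = ∑ e_i |X_{t-i} -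
X'_{t-i}| is the gap between the covariates. A failure due to b_m is a reset to 0 of the chain on ℕ.
So the responses differ after j steps with probability at most `resetProb b j 0` plus, for each k <
j, a failure caused by the covariates at time k + 1 followed by a reset chain started at 0, that is
ε_{k+1} `resetProb b (j - 1 - k) 0`. In the mean ε_k is at most κ_k: at positive times the
covariates are coupled, at the other times only the bound 2 E|X_0| is available. Since `resetProb b
(i + 1) 0` is at most b*_i, the total is `rate`.

The conditional law of the future minus its unconditional law is an average, over an independent
second past, of differences of conditional laws. Hence the cost of the coupling bounds τ (Lipschitz
functions of finitely many V_j) and, for the discrete metric, β (indicators of events in finitely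
many V_j, then approximation by cylinders).

The coupling of the responses is never constructed. It is used in dual form, as a bound on the
operators `iterOp` acting on Lipschitz functions (`abs_sum_mul_sub_sum_mul_le`,
`abs_step_sub_step_le`, `IsResponseKernel.abs_iterOp_sub_iterOp_le`).

Two points need care. Since Y is specified given the whole path of the chain, past responses might
carry information on the future of the chain. They do not: the reset chain is transient
(`tendsto_resetProb`), so the responses forget their remote past and, given the chain, the law of
those up to time 0 is determined by the chain up to time 0 (`IsLaw.map_pastPair_future`). Moreover Y
is specified given X, not given S. The coefficients relative to the past of V depend on the law of
(X, Y) only, so Y may be redrawn, given S, from its conditional law given X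
(`IsSolution.exists_isLaw`). -/

/-- Probability that the chain with transition matrix `resetMatrix b` started at `m` is at `0` at
time `n`, by conditioning on the first step. -/
def resetProb (b : ℕ → ℝ) : ℕ → ℕ → ℝ
  | 0, m => if m = 0 then 1 else 0
  | n + 1, m => b m * resetProb b n 0 + (1 - b m) * resetProb b n (m + 1)

/-! ### The chain on ℕ with resets: monotonicity, and transience by a renewal argument. -/

section ResetChain

variable {b : ℕ → ℝ}

lemma resetProb_nonneg (h0 : ∀ m, 0 ≤ b m) (h1 : ∀ m, b m ≤ 1) (n m : ℕ) :
    0 ≤ resetProb b n m := by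
  induction n generalizing m with
  | zero => simp only [resetProb]; split_ifs <;> norm_num
  | succ n ih =>
    exact add_nonneg (mul_nonneg (h0 m) (ih 0)) (mul_nonneg (sub_nonneg.2 (h1 m)) (ih _))

/-- From a higher state a reset is less likely, because `b` is antitone, and a reset leads to 0, the
state from which the later probability of being at 0 is largest. -/
lemma resetProb_antitone (h1 : ∀ m, b m ≤ 1) (hb : Antitone b) (n : ℕ) :
    Antitone (resetProb b n) := by
  induction n with
  | zero =>
    intro i j hij
    simp only [resetProb]
    split_ifs with h h' <;> first | omega | norm_num
  | succ n ih =>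
    intro i j hij
    have hbij := hb hij
    have e1 : resetProb b n (j + 1) ≤ resetProb b n (i + 1) := ih (by omega)
    have e2 : resetProb b n (i + 1) ≤ resetProb b n 0 := ih (by omega)
    have e3 := mul_nonneg (sub_nonneg.2 hbij) (sub_nonneg.2 e2)
    have e4 := mul_nonneg (sub_nonneg.2 (h1 j)) (sub_nonneg.2 e1)
    simp only [resetProb]
    nlinarith

lemma resetProb_succ_zero_le (h1 : ∀ m, b m ≤ 1) (hb : Antitone b) (n : ℕ) :
    resetProb b (n + 1) 0 ≤ resetProb b n 0 := by
  have e2 : resetProb b n (0 + 1) ≤ resetProb b n 0 := resetProb_antitone h1 hb n (by omega)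
  have e3 := mul_nonneg (sub_nonneg.2 (h1 0)) (sub_nonneg.2 e2)
  simp only [resetProb]
  nlinarith

lemma resetLaw_eq_zero {n j : ℕ} (h : n < j) : resetLaw b n j = 0 := by
  induction n generalizing j with
  | zero => simp [resetLaw, h.ne']
  | succ n ih =>
    refine (tsum_congr fun i => ?_).trans tsum_zero
    by_cases hi : n < i
    · simp [ih hi]
    · have h1 : j ≠ i + 1 := by omega
      have h2 : j ≠ 0 := by omega
      simp [resetMatrix, h1, h2]

lemma resetLaw_succ (n j : ℕ) :
    resetLaw b (n + 1) j = ∑ i ∈ Finset.range (n + 1), resetLaw b n i * resetMatrix b i j := by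
  rw [resetLaw]
  refine tsum_eq_sum fun i hi => ?_
  rw [resetLaw_eq_zero (by simpa using hi), zero_mul]

lemma resetLaw_succ_zero (n : ℕ) :
    resetLaw b (n + 1) 0 = ∑ i ∈ Finset.range (n + 1), resetLaw b n i * b i := by
  rw [resetLaw_succ]
  simp [resetMatrix]

lemma resetLaw_succ_succ (n j : ℕ) :
    resetLaw b (n + 1) (j + 1) = resetLaw b n j * (1 - b j) := by
  rw [resetLaw_succ]
  have : ∀ i, resetLaw b n i * resetMatrix b i (j + 1)
      = if i = j then resetLaw b n j * (1 - b j) else 0 := by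
    intro i
    by_cases h : i = j
    · simp [resetMatrix, h]
    · have : ¬ (j = i) := fun h' => h h'.symm
      simp [resetMatrix, h, this]
  simp only [this, Finset.sum_ite_eq', Finset.mem_range]
  split_ifs with h
  · rfl
  · rw [resetLaw_eq_zero (by omega), zero_mul]

/-- Chapman-Kolmogorov at time `n`. It links the forward recursion of `resetLaw` (on the last step)
to the backward recursion of `resetProb` (on the first step). -/
lemma sum_resetLaw_mul_resetProb (n k : ℕ) :
    ∑ j ∈ Finset.range (n + 1), resetLaw b n j * resetProb b k j = resetProb b (n + k) 0 := by
  induction n generalizing k with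
  | zero => simp [resetLaw]
  | succ n ih =>
    have := ih (k + 1)
    rw [show n + 1 + k = n + (k + 1) by ring, ← this, Finset.sum_range_succ',
      resetLaw_succ_zero, Finset.sum_mul, ← Finset.sum_add_distrib]
    refine Finset.sum_congr rfl fun i _ => ?_
    rw [resetLaw_succ_succ]
    simp only [resetProb]
    ring

lemma resetLaw_zero_eq_resetProb (n : ℕ) : resetLaw b n 0 = resetProb b n 0 := by
  have := sum_resetLaw_mul_resetProb (b := b) n 0
  rw [Finset.sum_range_succ'] at this
  simpa [resetProb] using this

/-- The index is shifted by one: b*_0 = b_0 is the probability at time 1, whereas for n ≥ 1 b*_n is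
the probability at time n, and monotonicity in time absorbs the shift. -/
lemma resetProb_succ_le_bStar (h1 : ∀ m, b m ≤ 1) (hb : Antitone b) (n : ℕ) :
    resetProb b (n + 1) 0 ≤ bStar b n := by
  unfold bStar
  split_ifs with h
  · subst h; simp [resetProb]
  · rw [resetLaw_zero_eq_resetProb]
    exact resetProb_succ_zero_le h1 hb n

/-- The chain is in `j` at time `n + j` exactly when it is at 0 at time `n` and the next `j` steps
are not resets. -/
lemma resetLaw_add (n j : ℕ) :
    resetLaw b (n + j) j = resetProb b n 0 * ∏ i ∈ Finset.range j, (1 - b i) := by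
  induction j with
  | zero => simp [resetLaw_zero_eq_resetProb]
  | succ j ih => rw [← add_assoc, resetLaw_succ_succ, ih, Finset.prod_range_succ]; ring

lemma sum_resetLaw (n : ℕ) : ∑ j ∈ Finset.range (n + 1), resetLaw b n j = 1 := by
  induction n with
  | zero => simp [resetLaw]
  | succ n ih =>
    rw [Finset.sum_range_succ', resetLaw_succ_zero, ← Finset.sum_add_distrib, ← ih]
    refine Finset.sum_congr rfl fun i _ => ?_
    rw [resetLaw_succ_succ]
    ring

lemma one_sub_sum_le_prod_one_sub {ι : Type*} (s : Finset ι) (f : ι → ℝ) (h0 : ∀ i, 0 ≤ f i)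
    (h1 : ∀ i, f i ≤ 1) : 1 - ∑ i ∈ s, f i ≤ ∏ i ∈ s, (1 - f i) := by
  classical
  induction s using Finset.induction_on with
  | empty => simp
  | insert a s ha ih =>
    rw [Finset.sum_insert ha, Finset.prod_insert ha]
    have hp : ∏ i ∈ s, (1 - f i) ≤ 1 :=
      Finset.prod_le_one (fun i _ => sub_nonneg.2 (h1 i)) fun i _ => by linarith [h0 i]
    nlinarith [mul_nonneg (h0 a) (sub_nonneg.2 hp)]

/-- Past some `N` the remaining `b i` sum to at most 1/2, so the tail product is at least 1/2; the
first `N` factors are positive. -/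
lemma exists_pos_le_prod_one_sub (h0 : ∀ m, 0 ≤ b m) (h1 : ∀ m, b m < 1) (hs : Summable b) :
    ∃ c > 0, ∀ n, c ≤ ∏ i ∈ Finset.range n, (1 - b i) := by
  obtain ⟨N, hN⟩ : ∃ N, ∀ n, ∑ i ∈ Finset.range n, b (i + N) ≤ 1 / 2 := by
    have := (tendsto_sum_nat_add b).eventually (gt_mem_nhds (show (0 : ℝ) < 1 / 2 by norm_num))
    obtain ⟨N, hN⟩ := this.exists
    exact ⟨N, fun n => (((summable_nat_add_iff N).2 hs).sum_le_tsum _ fun i _ => h0 _).trans hN.le⟩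
  have hanti : Antitone fun n => ∏ i ∈ Finset.range n, (1 - b i) := by
    refine antitone_nat_of_succ_le fun n => ?_
    rw [Finset.prod_range_succ]
    exact mul_le_of_le_one_right (Finset.prod_nonneg fun i _ => by linarith [h1 i])
      (by linarith [h0 n])
  have hpos : 0 < ∏ i ∈ Finset.range N, (1 - b i) :=
    Finset.prod_pos fun i _ => by linarith [h1 i]
  refine ⟨(∏ i ∈ Finset.range N, (1 - b i)) * (1 / 2), by positivity, fun n => ?_⟩
  calc _ ≤ (∏ i ∈ Finset.range N, (1 - b i)) * ∏ i ∈ Finset.range n, (1 - b (N + i)) := by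
        refine mul_le_mul_of_nonneg_left ?_ hpos.le
        have := one_sub_sum_le_prod_one_sub (Finset.range n) (fun i => b (i + N))
          (fun i => h0 _) fun i => (h1 _).le
        simp only [add_comm _ N] at this hN
        linarith [hN n]
    _ = ∏ i ∈ Finset.range (N + n), (1 - b i) := (Finset.prod_range_add _ _ _).symm
    _ ≤ _ := hanti (by omega)

/-- Decompose the state at time n according to the last visit to 0: by `resetLaw_add` the unit mass
is a sum of `resetProb b i 0` times products bounded below by c. Hence the expected number of visits
to 0 is at most 1/c and the terms tend to 0. -/
lemma tendsto_resetProb (h0 : ∀ m, 0 ≤ b m) (h1 : ∀ m, b m < 1) (hs : Summable b) :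
    Tendsto (fun n => resetProb b n 0) atTop (𝓝 0) := by
  obtain ⟨c, hc, hcp⟩ := exists_pos_le_prod_one_sub h0 h1 hs
  have hnn := fun n => resetProb_nonneg h0 (fun m => (h1 m).le) n 0
  refine (summable_of_sum_range_le (c := c⁻¹) hnn fun n => ?_).tendsto_atTop_zero
  rcases n with _ | n
  · simpa using hc.le
  have : (∑ i ∈ Finset.range (n + 1), resetProb b i 0) * c ≤ 1 := by
    rw [← sum_resetLaw (b := b) n, ← Finset.sum_range_reflect, Finset.sum_mul]
    refine Finset.sum_le_sum fun j hj => ?_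
    have hj' : j ≤ n := by simpa [Nat.lt_succ_iff] using hj
    have := resetLaw_add (b := b) (n - j) j
    rw [Nat.sub_add_cancel hj'] at this
    rw [this, show n + 1 - 1 - j = n - j by omega]
    exact mul_le_mul_of_nonneg_left (hcp j) (hnn _)
  rwa [← div_eq_mul_inv 1 c |>.trans (one_mul _), le_div_iff₀ hc]

end ResetChain

/-! ### Total variation on a finite set and the dual form of maximal coupling. -/

section PMF

variable {E : Type*} [Fintype E]

lemma dTV_nonneg (ν₁ ν₂ : E → ℝ) : 0 ≤ dTV ν₁ ν₂ := by
  unfold dTV; positivity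

lemma dTV_triangle (ν₁ ν₂ ν₃ : E → ℝ) : dTV ν₁ ν₃ ≤ dTV ν₁ ν₂ + dTV ν₂ ν₃ := by
  unfold dTV
  rw [← mul_add, ← Finset.sum_add_distrib]
  exact mul_le_mul_of_nonneg_left (Finset.sum_le_sum fun w _ => abs_sub_le _ _ _) (by norm_num)

lemma dTV_comm (ν₁ ν₂ : E → ℝ) : dTV ν₁ ν₂ = dTV ν₂ ν₁ := by
  unfold dTV; simp_rw [abs_sub_comm]

lemma sum_sub_min_eq_dTV {ν₁ ν₂ : E → ℝ} (h₁ : ∑ w, ν₁ w = 1) (h₂ : ∑ w, ν₂ w = 1) :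
    ∑ w, (ν₁ w - min (ν₁ w) (ν₂ w)) = dTV ν₁ ν₂ := by
  have : ∀ w, ν₁ w - min (ν₁ w) (ν₂ w) = (1 / 2) * |ν₁ w - ν₂ w| + (1 / 2) * (ν₁ w - ν₂ w) := by
    intro w
    rw [min_def]
    split_ifs with h
    · rw [abs_of_nonpos (by linarith)]; ring
    · rw [abs_of_nonneg (by linarith)]; ring
  simp_rw [this]
  rw [Finset.sum_add_distrib, ← Finset.mul_sum, ← Finset.mul_sum, Finset.sum_sub_distrib, h₁, h₂]
  simp [dTV]

lemma dTV_le_one {ν₁ ν₂ : E → ℝ} (p₁ : ∀ w, 0 ≤ ν₁ w) (p₂ : ∀ w, 0 ≤ ν₂ w)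
    (h₁ : ∑ w, ν₁ w = 1) (h₂ : ∑ w, ν₂ w = 1) : dTV ν₁ ν₂ ≤ 1 := by
  rw [← sum_sub_min_eq_dTV h₁ h₂, ← h₁]
  exact Finset.sum_le_sum fun w _ => by linarith [le_min (p₁ w) (p₂ w)]

/-- On the common part min(ν₁, ν₂), of mass 1 - `dTV`, both sides use the same symbol and pay `a`;
the two remainders, each of mass `dTV`, pay the worst case `A`. -/
lemma sum_mul_sub_sum_mul_le [Nonempty E] {ν₁ ν₂ f₁ f₂ : E → ℝ} {a A : ℝ}
    (p₁ : ∀ w, 0 ≤ ν₁ w) (p₂ : ∀ w, 0 ≤ ν₂ w) (h₁ : ∑ w, ν₁ w = 1) (h₂ : ∑ w, ν₂ w = 1)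
    (ha : ∀ w, f₁ w - f₂ w ≤ a) (hA : ∀ w w', f₁ w - f₂ w' ≤ A) :
    ∑ w, ν₁ w * f₁ w - ∑ w, ν₂ w * f₂ w ≤ (1 - dTV ν₁ ν₂) * a + dTV ν₁ ν₂ * A := by
  obtain ⟨w₁, hw₁⟩ := Finite.exists_max f₁
  obtain ⟨w₂, hw₂⟩ := Finite.exists_min f₂
  have d₁ := sum_sub_min_eq_dTV h₁ h₂
  have d₂ := sum_sub_min_eq_dTV h₂ h₁
  rw [dTV_comm] at d₂
  have e₁ : ∑ w, (ν₁ w - min (ν₁ w) (ν₂ w)) * f₁ w ≤ dTV ν₁ ν₂ * f₁ w₁ := by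
    rw [← d₁, Finset.sum_mul]
    exact Finset.sum_le_sum fun w _ =>
      mul_le_mul_of_nonneg_left (hw₁ w) (sub_nonneg.2 (min_le_left _ _))
  have e₂ : dTV ν₁ ν₂ * f₂ w₂ ≤ ∑ w, (ν₂ w - min (ν₂ w) (ν₁ w)) * f₂ w := by
    rw [← d₂, Finset.sum_mul]
    exact Finset.sum_le_sum fun w _ =>
      mul_le_mul_of_nonneg_left (hw₂ w) (sub_nonneg.2 (min_le_left _ _))
  have e₃ : ∑ w, min (ν₁ w) (ν₂ w) * (f₁ w - f₂ w) ≤ (1 - dTV ν₁ ν₂) * a := by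
    have : 1 - dTV ν₁ ν₂ = ∑ w, min (ν₁ w) (ν₂ w) := by
      rw [← d₁, Finset.sum_sub_distrib, h₁]; ring
    rw [this, Finset.sum_mul]
    exact Finset.sum_le_sum fun w _ => mul_le_mul_of_nonneg_left (ha w) (le_min (p₁ w) (p₂ w))
  have e₄ := mul_le_mul_of_nonneg_left (hA w₁ w₂) (dTV_nonneg ν₁ ν₂)
  have e₅ : ∑ w, ν₁ w * f₁ w - ∑ w, ν₂ w * f₂ w
      = ∑ w, min (ν₁ w) (ν₂ w) * (f₁ w - f₂ w)
        + ∑ w, (ν₁ w - min (ν₁ w) (ν₂ w)) * f₁ w - ∑ w, (ν₂ w - min (ν₂ w) (ν₁ w)) * f₂ w := by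
    rw [← Finset.sum_add_distrib, ← Finset.sum_sub_distrib, ← Finset.sum_sub_distrib]
    refine Finset.sum_congr rfl fun w _ => ?_
    rw [min_comm (ν₂ w)]
    ring
  linarith

/-- Maximal coupling in dual form. -/
lemma abs_sum_mul_sub_sum_mul_le [Nonempty E] {ν₁ ν₂ f₁ f₂ : E → ℝ} {a A d : ℝ}
    (p₁ : ∀ w, 0 ≤ ν₁ w) (p₂ : ∀ w, 0 ≤ ν₂ w) (h₁ : ∑ w, ν₁ w = 1) (h₂ : ∑ w, ν₂ w = 1)
    (ha : ∀ w, |f₁ w - f₂ w| ≤ a) (hA : ∀ w w', |f₁ w - f₂ w'| ≤ A) (haA : a ≤ A)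
    (hd : dTV ν₁ ν₂ ≤ d) :
    |∑ w, ν₁ w * f₁ w - ∑ w, ν₂ w * f₂ w| ≤ a + d * (A - a) := by
  -- As `a ≤ A`, the bound increases with the total variation distance.
  have key : (1 - dTV ν₁ ν₂) * a + dTV ν₁ ν₂ * A ≤ a + d * (A - a) := by
    nlinarith [mul_nonneg (sub_nonneg.2 hd) (sub_nonneg.2 haA)]
  refine (abs_le.2 ⟨?_, ?_⟩ : |_| ≤ (1 - dTV ν₁ ν₂) * a + dTV ν₁ ν₂ * A).trans key
  · have := sum_mul_sub_sum_mul_le p₂ p₁ h₂ h₁ (f₁ := f₂) (f₂ := f₁)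
      (fun w => (le_abs_self _).trans (by rw [abs_sub_comm]; exact ha w))
      (fun w w' => (le_abs_self _).trans (by rw [abs_sub_comm]; exact hA w' w))
    rw [dTV_comm] at this
    linarith
  · exact sum_mul_sub_sum_mul_le p₁ p₂ h₁ h₂ (fun w => (le_abs_self _).trans (ha w))
      (fun w w' => (le_abs_self _).trans (hA w w'))

end PMF

/-! ### The continuity coefficients as genuine suprema. -/

section ContCoef

lemma contCoef_nonneg {E G : Type*} [Fintype E] (q : E → (ℕ → E) → (ℕ → G) → ℝ)
    (D : Set (ℤ → G)) (m : ℕ) : 0 ≤ contCoef q D m := by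
  refine Real.sSup_nonneg ?_
  rintro r ⟨y, y', x, t, hx, -, rfl⟩
  exact dTV_nonneg _ _

variable {E G : Type*} [Fintype E] [MeasurableSpace E] [MeasurableSpace G]
  {q : E → (ℕ → E) → (ℕ → G) → ℝ} {D : Set (ℤ → G)}

lemma IsTransition.dTV_le_one (hq : IsTransition q D) {x x' : ℤ → G} (hx : x ∈ D) (hx' : x' ∈ D)
    (y y' : ℕ → E) (t t' : ℤ) :
    dTV (fun w => q w y (past x t)) (fun w => q w y' (past x' t')) ≤ 1 :=
  _root_.dTV_le_one (fun w => (hq.pos w _ _ hx t).le) (fun w => (hq.pos w _ _ hx' t').le)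
    (hq.sum_eq_one _ _ hx t) (hq.sum_eq_one _ _ hx' t')

/-- In ℝ, `sSup` of an unbounded set is 0; boundedness is what makes `contCoef` an upper bound. -/
lemma IsTransition.bddAbove_contCoef (hq : IsTransition q D) (m : ℕ) :
    BddAbove {r : ℝ | ∃ (y y' : ℕ → E) (x : ℤ → G) (t : ℤ), x ∈ D ∧ (∀ i < m, y i = y' i) ∧
      r = dTV (fun w => q w y (past x t)) (fun w => q w y' (past x t))} := by
  refine ⟨1, ?_⟩
  rintro r ⟨y, y', x, t, hx, -, rfl⟩
  exact hq.dTV_le_one hx hx y y' t t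

lemma IsTransition.dTV_le_contCoef (hq : IsTransition q D) {x : ℤ → G} (hx : x ∈ D) (t : ℤ)
    {y y' : ℕ → E} {m : ℕ} (h : ∀ i < m, y i = y' i) :
    dTV (fun w => q w y (past x t)) (fun w => q w y' (past x t)) ≤ contCoef q D m :=
  le_csSup (hq.bddAbove_contCoef m) ⟨y, y', x, t, hx, h, rfl⟩

lemma IsTransition.antitone_contCoef [Nonempty E] (hq : IsTransition q D) (hD : D.Nonempty) :
    Antitone (contCoef q D) := by
  intro m n hmn
  obtain ⟨x, hx⟩ := hD
  obtain ⟨w⟩ := ‹Nonempty E›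
  refine csSup_le_csSup (hq.bddAbove_contCoef m) ⟨_, fun _ => w, fun _ => w, x, 0, hx,
    fun _ _ => rfl, rfl⟩ ?_
  rintro r ⟨y, y', x, t, hx, h, rfl⟩
  exact ⟨y, y', x, t, hx, fun i hi => h i (hi.trans_le hmn), rfl⟩

end ContCoef

/-! ### One step of the response coupling, in dual form. -/

section Contraction

/-- The sequence `(w, y_0, y_1, …)`. -/
def prepend {E : Type*} (w : E) (y : ℕ → E) : ℕ → E
  | 0 => w
  | n + 1 => y n

/-- Bound for the probability that two coupled responses differ `n` steps after time `t`, when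
their last `m` values at time `t` agree; `ε` is the discrepancy due to the covariates. -/
def mismatch (b : ℕ → ℝ) (ε : ℤ → ℝ) (t : ℤ) (n m : ℕ) : ℝ :=
  resetProb b n m + ∑ k ∈ Finset.range n, ε (t + k + 1) * resetProb b (n - 1 - k) 0

open Classical in
/-- Bound for the probability that two coupled responses differ at time `t + n - i`, when their
histories at time `t` are `y, y'` and agree on the last `m` values. -/
def lagCost {E : Type*} (b : ℕ → ℝ) (ε : ℤ → ℝ) (t : ℤ) (n m : ℕ) (y y' : ℕ → E) (i : ℕ) : ℝ :=
  if i < n then mismatch b ε t (n - i) m else if y (i - n) = y' (i - n) then 0 else 1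

variable {E : Type*} {b : ℕ → ℝ} {ε : ℤ → ℝ}

/-- First-step analysis: the reset chain makes one move, and the covariate gap of that first step
starts a reset chain at 0 with `n` steps left. -/
lemma mismatch_succ (t : ℤ) (n m : ℕ) :
    mismatch b ε t (n + 1) m = b m * mismatch b ε (t + 1) n 0
      + (1 - b m) * mismatch b ε (t + 1) n (m + 1) + ε (t + 1) * resetProb b n 0 := by
  unfold mismatch
  rw [Finset.sum_range_succ']
  have : ∀ k ∈ Finset.range n, ε (t + ((k + 1 : ℕ) : ℤ) + 1) * resetProb b (n + 1 - 1 - (k + 1)) 0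
      = ε (t + 1 + k + 1) * resetProb b (n - 1 - k) 0 := by
    intro k _
    rw [show n + 1 - 1 - (k + 1) = n - 1 - k by omega]
    congr 2
    push_cast
    ring
  rw [Finset.sum_congr rfl this]
  simp [resetProb]
  ring

lemma mismatch_mono_zero (h1 : ∀ m, b m ≤ 1) (hb : Antitone b) (t : ℤ) (n m : ℕ) :
    mismatch b ε t n m ≤ mismatch b ε t n 0 := by
  unfold mismatch
  linarith [resetProb_antitone h1 hb n (Nat.zero_le m)]

lemma mismatch_nonneg (h0 : ∀ m, 0 ≤ b m) (h1 : ∀ m, b m ≤ 1) (hε : ∀ t, 0 ≤ ε t) (t : ℤ)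
    (n m : ℕ) : 0 ≤ mismatch b ε t n m :=
  add_nonneg (resetProb_nonneg h0 h1 n m)
    (Finset.sum_nonneg fun _ _ => mul_nonneg (hε _) (resetProb_nonneg h0 h1 _ _))

lemma prepend_agree {m : ℕ} {y y' : ℕ → E} (h : ∀ i < m, y i = y' i) (w : E) :
    ∀ i < m + 1, prepend w y i = prepend w y' i := by
  rintro (_ | i) hi
  · rfl
  · exact h i (by omega)

variable [Fintype E] [Nonempty E]

/-- With d = `b m + ε (t + 1)`, the same symbol is prepended with probability at least 1 - d and the
agreement grows to `m + 1`; otherwise it is only known to be 0. The resulting bound a + d (A - a) is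
exactly of the form that `mismatch_succ` controls. -/
lemma abs_step_sub_step_le (h0 : ∀ m, 0 ≤ b m) (h1 : ∀ m, b m ≤ 1) (hb : Antitone b)
    {t : ℤ} (hε : 0 ≤ ε (t + 1)) {ν ν' : E → (ℕ → E) → ℝ}
    (p : ∀ w y, 0 ≤ ν w y) (p' : ∀ w y, 0 ≤ ν' w y) (hν : ∀ y, ∑ w, ν w y = 1)
    (hν' : ∀ y, ∑ w, ν' w y = 1)
    (hd : ∀ m y y', (∀ i < m, y i = y' i) →
      dTV (fun w => ν w y) (fun w => ν' w y') ≤ b m + ε (t + 1))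
    {F F' : (ℕ → E) → ℝ} {C : ℝ} {I : Finset ℕ} {n : ℕ}
    (hF : ∀ m y y', (∀ i < m, y i = y' i) →
      |F y - F' y'| ≤ C + ∑ i ∈ I, lagCost b ε (t + 1) n m y y' i)
    (m : ℕ) (y y' : ℕ → E) (hy : ∀ i < m, y i = y' i) :
    |∑ w, ν w y * F (prepend w y) - ∑ w, ν' w y' * F' (prepend w y')|
      ≤ C + ∑ i ∈ I, lagCost b ε t (n + 1) m y y' i := by
  classical
  -- The remaining cost at lag `i` once the new symbol is in place and the agreement is `m'`. Lag
  -- `n` is the new symbol itself: there `mismatch` has no step left and equals 1 for `m' = 0` and 0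
  -- for `m' > 0`.
  let B : ℕ → ℕ → ℝ := fun m' i => if i < n + 1 then mismatch b ε (t + 1) (n - i) m'
    else if y (i - (n + 1)) = y' (i - (n + 1)) then 0 else 1
  have hshift : ∀ i, ¬ i < n + 1 → ∀ (w : E) (z : ℕ → E),
      prepend w z (i - n) = z (i - (n + 1)) := by
    intro i hi w z
    obtain ⟨k, rfl⟩ : ∃ k, i = n + (k + 1) := ⟨i - (n + 1), by omega⟩
    simp [prepend, show n + (k + 1) - (n + 1) = k by omega]
  have hB0 : ∀ i w w', lagCost b ε (t + 1) n 0 (prepend w y) (prepend w' y') i ≤ B 0 i := by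
    intro i w w'
    simp only [lagCost, B]
    by_cases h : i < n
    · simp [h, show i < n + 1 by omega]
    by_cases h' : i < n + 1
    · obtain rfl : i = n := by omega
      simp only [lt_irrefl, if_false, h', if_true, Nat.sub_self, mismatch, resetProb]
      split_ifs <;> simp
    · simp only [h, h', if_false, hshift i h', le_refl]
  have hBm : ∀ i w, lagCost b ε (t + 1) n (m + 1) (prepend w y) (prepend w y') i ≤ B (m + 1) i := by
    intro i w
    simp only [lagCost, B]
    by_cases h : i < n
    · simp [h, show i < n + 1 by omega]
    by_cases h' : i < n + 1
    · obtain rfl : i = n := by omega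
      simp [mismatch, resetProb, prepend]
    · simp only [h, h', if_false, hshift i h', le_refl]
  have hBB : ∀ i, B (m + 1) i ≤ B 0 i := by
    intro i
    simp only [B]
    split_ifs
    · exact mismatch_mono_zero h1 hb _ _ _
    all_goals exact le_refl _
  have main := abs_sum_mul_sub_sum_mul_le (fun w => p w y) (fun w => p' w y') (hν y) (hν' y')
    (f₁ := fun w => F (prepend w y)) (f₂ := fun w => F' (prepend w y'))
    (a := C + ∑ i ∈ I, B (m + 1) i) (A := C + ∑ i ∈ I, B 0 i)
    (fun w => (hF (m + 1) _ _ (prepend_agree hy w)).trans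
      (by gcongr with i; exact hBm i w))
    (fun w w' => (hF 0 _ _ (by simp)).trans (by gcongr with i; exact hB0 i w w'))
    (by gcongr with i; exact hBB i) (hd m y y' hy)
  refine main.trans ?_
  rw [add_sub_add_left_eq_sub, ← Finset.sum_sub_distrib, Finset.mul_sum, add_assoc,
    ← Finset.sum_add_distrib]
  gcongr with i
  simp only [B, lagCost]
  split_ifs with h
  · rw [show n + 1 - i = n - i + 1 by omega, mismatch_succ]
    -- The covariate terms cancel in the difference, so that a failure adds at most the homogeneous
    -- term of the reset chain.
    have e1 : mismatch b ε (t + 1) (n - i) 0 - mismatch b ε (t + 1) (n - i) (m + 1)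
        ≤ resetProb b (n - i) 0 := by
      unfold mismatch
      linarith [resetProb_nonneg h0 h1 (n - i) (m + 1)]
    nlinarith [mul_le_mul_of_nonneg_left e1 hε]
  all_goals simp

end Contraction

/-! ### Pasts, futures and gluing on sequence spaces. -/

section PathSpace

variable {α : Type*} [MeasurableSpace α]

lemma measurable_past (t : ℤ) : Measurable (fun x : ℤ → α => past x t) :=
  measurable_pi_lambda _ fun _ => measurable_pi_apply _

lemma measurable_future (t : ℤ) : Measurable (fun x : ℤ → α => future x t) :=
  measurable_pi_lambda _ fun _ => measurable_pi_apply _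

lemma measurable_path {Ω : Type*} [MeasurableSpace Ω] {Z : ℤ → Ω → α} (hZ : ∀ t, Measurable (Z t)) :
    Measurable (path Z) :=
  measurable_pi_lambda _ fun t => hZ t

lemma measurable_prepend (w : α) : Measurable (prepend w : (ℕ → α) → ℕ → α) := by
  refine measurable_pi_lambda _ fun n => ?_
  rcases n with _ | n
  · exact measurable_const
  · exact measurable_pi_apply n

lemma past_eq_prepend {α : Type*} (x : ℤ → α) (t : ℤ) :
    past x t = prepend (x t) (past x (t - 1)) := by
  funext n
  rcases n with _ | n
  · simp [past, prepend]
  · simp only [past, prepend]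
    congr 1
    push_cast
    ring

/-- The two-sided path with past `s` up to time `0` and future `s'` from time `1` on. -/
def glue {α : Type*} (s s' : ℕ → α) : ℤ → α :=
  fun t => if t ≤ 0 then s (-t).toNat else s' (t - 1).toNat

lemma measurable_glue : Measurable (fun p : (ℕ → α) × (ℕ → α) => glue p.1 p.2) := by
  refine measurable_pi_lambda _ fun t => ?_
  by_cases h : t ≤ 0
  · simp only [glue, h, if_true]
    exact (measurable_pi_apply _).comp measurable_fst
  · simp only [glue, h, if_false]
    exact (measurable_pi_apply _).comp measurable_snd

lemma glue_past_future {α : Type*} (x : ℤ → α) : glue (past x 0) (future x 1) = x := by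
  funext t
  by_cases h : t ≤ 0
  · simp only [glue, h, if_true, past]
    congr 1
    omega
  · simp only [glue, h, if_false, future]
    congr 1
    omega

lemma glue_of_nonpos {α : Type*} (s s' : ℕ → α) {t : ℤ} (h : t ≤ 0) :
    glue s s' t = s (-t).toNat := by
  simp [glue, h]

lemma glue_succ {α : Type*} (s s' : ℕ → α) (k : ℕ) : glue s s' ((k : ℤ) + 1) = s' k := by
  have : ¬ ((k : ℤ) + 1 ≤ 0) := by omega
  simp [glue, this]

/-- Finite measures on a sequence space are determined by their values on boxes. -/
lemma ext_of_boxes {μ ν : Measure (ℕ → α)} [IsFiniteMeasure μ]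
    (h : ∀ (k : ℕ) (B : ℕ → Set α), (∀ i, MeasurableSet (B i)) →
      μ {f | ∀ i < k, f i ∈ B i} = ν {f | ∀ i < k, f i ∈ B i}) : μ = ν := by
  refine ext_of_generate_finite {A | ∃ (k : ℕ) (B : ℕ → Set α), (∀ i, MeasurableSet (B i)) ∧
    A = {f | ∀ i < k, f i ∈ B i}} (le_antisymm ?_ ?_) ?_ ?_ ?_
  · refine iSup_le fun i => ?_
    rintro _ ⟨A, hA, rfl⟩
    refine MeasurableSpace.measurableSet_generateFrom
      ⟨i + 1, fun j => if j = i then A else Set.univ, fun j => ?_, ?_⟩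
    · dsimp only
      split_ifs
      exacts [hA, MeasurableSet.univ]
    · ext f
      refine ⟨fun hf j _ => ?_, fun hf => by simpa using hf i (by omega)⟩
      dsimp only
      split_ifs with hj
      · subst hj; exact hf
      · trivial
  · refine MeasurableSpace.generateFrom_le ?_
    rintro _ ⟨k, B, hB, rfl⟩
    simp only [Set.ofPred_forall]
    exact MeasurableSet.iInter fun i => MeasurableSet.iInter fun _ => measurable_pi_apply i (hB i)
  · rintro _ ⟨k, B, hB, rfl⟩ _ ⟨k', B', hB', rfl⟩ -
    refine ⟨max k k', fun i => (if i < k then B i else Set.univ) ∩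
      (if i < k' then B' i else Set.univ), fun i => ?_, ?_⟩
    · refine MeasurableSet.inter ?_ ?_ <;> split_ifs
      exacts [hB i, MeasurableSet.univ, hB' i, MeasurableSet.univ]
    · ext f
      simp only [Set.mem_inter_iff, Set.mem_ofPred_eq]
      constructor
      · rintro ⟨h1, h2⟩ i -
        constructor <;> split_ifs with hi
        exacts [h1 i hi, trivial, h2 i hi, trivial]
      · intro hf
        refine ⟨fun i hi => ?_, fun i hi => ?_⟩
        · simpa [hi] using (hf i (by omega)).1
        · simpa [hi] using (hf i (by omega)).2
  · rintro _ ⟨k, B, hB, rfl⟩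
    exact h k B hB
  · simpa using h 0 (fun _ => Set.univ) fun _ => MeasurableSet.univ

end PathSpace

/-! ### From the one-step Markov property to the law of the whole future given the whole past. -/

section MarkovChain

lemma indicator_preimage_prodMk {Ω β δ : Type*} (f : Ω → β) (h : Ω → δ) (A : Set β) (B : Set δ)
    (ω : Ω) : ((fun ω => (f ω, h ω)) ⁻¹' (A ×ˢ B)).indicator (1 : Ω → ℝ≥0∞) ω =
      A.indicator (fun _ => 1) (f ω) * B.indicator (fun _ => 1) (h ω) := by
  classical
  simp only [Set.indicator_apply, Set.mem_preimage, Set.mem_prod, Pi.one_apply]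
  by_cases h1 : f ω ∈ A <;> by_cases h2 : h ω ∈ B <;> simp [h1, h2]

variable {Ω α : Type*} [MeasurableSpace Ω] [MeasurableSpace α] {μ : Measure Ω}
  [IsProbabilityMeasure μ] {S : ℤ → Ω → α}

lemma lintegral_past_mul_next {p : Kernel α α} [IsMarkovKernel p] (hS : ∀ t, Measurable (S t))
    (t : ℤ)
    (hp : μ.map (fun ω => (past (path S ω) t, S (t + 1) ω)) =
      (μ.map (fun ω => past (path S ω) t)) ⊗ₘ
        (p.comap (fun s : ℕ → α => s 0) (measurable_pi_apply 0)))
    {Φ : (ℕ → α) → ℝ≥0∞} (hΦ : Measurable Φ) {k : α → ℝ≥0∞} (hk : Measurable k) :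
    ∫⁻ ω, Φ (past (path S ω) t) * k (S (t + 1) ω) ∂μ =
      ∫⁻ ω, Φ (past (path S ω) t) * ∫⁻ s, k s ∂(p (S t ω)) ∂μ := by
  have hpast : Measurable fun ω => past (path S ω) t :=
    (measurable_past t).comp (measurable_path hS)
  have h1 : Measurable fun z : (ℕ → α) × α => Φ z.1 * k z.2 :=
    (hΦ.comp measurable_fst).mul (hk.comp measurable_snd)
  have h2 : Measurable fun z : ℕ → α => Φ z * ∫⁻ s, k s ∂(p (z 0)) :=
    hΦ.mul (hk.lintegral_kernel.comp (measurable_pi_apply 0))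
  calc _ = ∫⁻ z, Φ z.1 * k z.2 ∂(μ.map (fun ω => (past (path S ω) t, S (t + 1) ω))) :=
        (lintegral_map h1 (hpast.prodMk (hS _))).symm
    _ = ∫⁻ z, Φ z * ∫⁻ s, k s ∂(p (z 0)) ∂(μ.map (fun ω => past (path S ω) t)) := by
        rw [hp, Measure.lintegral_compProd h1]
        refine lintegral_congr fun z => ?_
        rw [Kernel.comap_apply]
        exact lintegral_const_mul (Φ z) hk
    _ = _ := by
        rw [lintegral_map h2 hpast]
        simp [past, path]

/-- The last factor is integrated out by `p` and absorbed into the preceding one. The point is that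
a single `r` serves every `h`: testing with functions of the state at time 0 identifies `r`, and the
identity then holds for the whole past. -/
lemma exists_lintegral_past_mul_prod {p : Kernel α α} [IsMarkovKernel p]
    (hS : ∀ t, Measurable (S t))
    (hp : ∀ t : ℤ, μ.map (fun ω => (past (path S ω) t, S (t + 1) ω)) =
      (μ.map (fun ω => past (path S ω) t)) ⊗ₘ
        (p.comap (fun s : ℕ → α => s 0) (measurable_pi_apply 0)))
    (n : ℕ) (k : ℕ → α → ℝ≥0∞) (hk : ∀ i, Measurable (k i)) :
    ∃ r : α → ℝ≥0∞, Measurable r ∧ ∀ h : (ℕ → α) → ℝ≥0∞, Measurable h →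
      ∫⁻ ω, h (past (path S ω) 0) * ∏ i ∈ Finset.range n, k i (S (i + 1) ω) ∂μ =
        ∫⁻ ω, h (past (path S ω) 0) * r (S 0 ω) ∂μ := by
  induction n generalizing k with
  | zero => exact ⟨fun _ => 1, measurable_const, fun h _ => by simp⟩
  | succ n ih =>
    have hpk : Measurable fun s => ∫⁻ s', k n s' ∂(p s) := (hk n).lintegral_kernel
    have key : ∀ h : (ℕ → α) → ℝ≥0∞, Measurable h →
        ∫⁻ ω, h (past (path S ω) 0) * ∏ i ∈ Finset.range (n + 1), k i (S (i + 1) ω) ∂μ =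
        ∫⁻ ω, h (past (path S ω) 0) * (∏ i ∈ Finset.range n, k i (S (i + 1) ω)) *
          ∫⁻ s', k n s' ∂(p (S n ω)) ∂μ := by
      intro h hh
      -- Everything is rewritten as a function of the past at time `n`: the past at time 0 is its
      -- shift by `n`, and the state at time `i + 1` is its coordinate `n - (i + 1)`.
      let Φ : (ℕ → α) → ℝ≥0∞ := fun z => h (fun i => z (i + n)) *
        ∏ i ∈ Finset.range n, k i (z (n - (i + 1)))
      have hΦ : Measurable Φ := (hh.comp (measurable_pi_lambda _ fun _ => measurable_pi_apply _)).mul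
        (Finset.measurable_fun_prod _ fun i _ => (hk i).comp (measurable_pi_apply _))
      have hΦe : ∀ ω, Φ (past (path S ω) n) =
          h (past (path S ω) 0) * ∏ i ∈ Finset.range n, k i (S (i + 1) ω) := by
        intro ω
        simp only [Φ, past, path]
        have e₁ : (fun i : ℕ => S ((n : ℤ) - ((i + n : ℕ) : ℤ)) ω) = fun i : ℕ => S (0 - (i : ℤ)) ω := by
          funext i
          congr 1
          push_cast
          ring
        rw [e₁]
        congr 1
        · refine Finset.prod_congr rfl fun i hi => ?_
          have : (n : ℤ) - ((n - (i + 1) : ℕ) : ℤ) = i + 1 := by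
            have := Finset.mem_range.1 hi
            omega
          rw [this]
      have := lintegral_past_mul_next hS n (hp n) hΦ (hk n)
      simp only [hΦe] at this
      rw [← this]
      refine lintegral_congr fun ω => ?_
      rw [Finset.prod_range_succ, mul_assoc]
    rcases n with _ | n
    · refine ⟨_, hpk, fun h hh => ?_⟩
      rw [key h hh]
      simp
    · obtain ⟨r, hr, hr'⟩ := ih (fun i s => if i = n then k i s * ∫⁻ s', k (n + 1) s' ∂(p s)
          else k i s) (fun i => by
            split_ifs
            exacts [(hk i).mul hpk, hk i])
      refine ⟨r, hr, fun h hh => ?_⟩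
      rw [key h hh, ← hr' h hh]
      refine lintegral_congr fun ω => ?_
      rw [mul_assoc, Finset.prod_range_succ, Finset.prod_range_succ _ n]
      congr 1
      have : ∏ i ∈ Finset.range n, (if i = n then k i (S (i + 1) ω) *
          ∫⁻ s', k (n + 1) s' ∂(p (S (i + 1) ω)) else k i (S (i + 1) ω)) =
          ∏ i ∈ Finset.range n, k i (S (i + 1) ω) :=
        Finset.prod_congr rfl fun i hi => if_neg (Finset.mem_range.1 hi).ne
      rw [this]
      simp [mul_assoc]

/-- The future of a Markov chain given its whole past follows the path kernel. -/
lemma IsMarkovChain.map_past_future {P : Kernel α (ℕ → α)} [IsMarkovKernel P]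
    (hS : ∀ t, Measurable (S t)) (hM : IsMarkovChain μ S) (hP : IsPathKernel μ S P) :
    μ.map (fun ω => (past (path S ω) 0, future (path S ω) 1)) =
      (μ.map (fun ω => past (path S ω) 0)) ⊗ₘ
        (P.comap (fun s : ℕ → α => s 0) (measurable_pi_apply 0)) := by
  obtain ⟨p, hpM, hp⟩ := hM
  have hpast : Measurable fun ω => past (path S ω) 0 :=
    (measurable_past 0).comp (measurable_path hS)
  have hfut : Measurable fun ω => future (path S ω) 1 :=
    (measurable_future 1).comp (measurable_path hS)
  have : IsProbabilityMeasure (μ.map (fun ω => past (path S ω) 0)) :=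
    Measure.isProbabilityMeasure_map hpast.aemeasurable
  have : IsProbabilityMeasure (μ.map (fun ω => (past (path S ω) 0, future (path S ω) 1))) :=
    Measure.isProbabilityMeasure_map (hpast.prodMk hfut).aemeasurable
  have : IsProbabilityMeasure (μ.map (S 0)) := Measure.isProbabilityMeasure_map (hS 0).aemeasurable
  refine Measure.ext_prod fun {A B} hA hB => ?_
  have hbox : ∀ (k : ℕ) (B : ℕ → Set α), (∀ i, MeasurableSet (B i)) →
      MeasurableSet {f : ℕ → α | ∀ i < k, f i ∈ B i} := by
    intro k B hB
    simp only [Set.ofPred_forall]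
    exact MeasurableSet.iInter fun i => MeasurableSet.iInter fun _ => measurable_pi_apply i (hB i)
  -- For fixed `A` both sides are finite measures in `B`, so that boxes suffice.
  let m₁ : Measure (ℕ → α) := (μ.restrict ((fun ω => past (path S ω) 0) ⁻¹' A)).map
    (fun ω => future (path S ω) 1)
  let m₂ : Measure (ℕ → α) := ((μ.restrict ((fun ω => past (path S ω) 0) ⁻¹' A)).map (S 0)).bind P
  have h₁ : ∀ B, MeasurableSet B →
      m₁ B = μ.map (fun ω => (past (path S ω) 0, future (path S ω) 1)) (A ×ˢ B) := by
    intro B hB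
    rw [Measure.map_apply hfut hB, Measure.restrict_apply (hfut hB),
      Measure.map_apply (hpast.prodMk hfut) (hA.prod hB), Set.inter_comm]
    rfl
  have h₂' : ∀ B, MeasurableSet B → m₂ B = ∫⁻ ω, A.indicator (fun _ => 1) (past (path S ω) 0) *
      P (S 0 ω) B ∂μ := by
    intro B hB
    have hPB : Measurable fun s => P s B := P.measurable_coe hB
    rw [Measure.bind_apply hB P.aemeasurable, lintegral_map hPB (hS 0),
      ← lintegral_indicator (hpast hA)]
    refine lintegral_congr fun ω => ?_
    by_cases hω : past (path S ω) 0 ∈ A <;> simp [Set.indicator, hω]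
  have h₂ : ∀ B, MeasurableSet B → m₂ B = ((μ.map (fun ω => past (path S ω) 0)) ⊗ₘ
        (P.comap (fun s : ℕ → α => s 0) (measurable_pi_apply 0))) (A ×ˢ B) := by
    intro B hB
    have hPB : Measurable fun s => P s B := P.measurable_coe hB
    rw [h₂' B hB, Measure.compProd_apply_prod hA hB, ← lintegral_indicator hA]
    have : Measurable (A.indicator fun a : ℕ → α =>
        (P.comap (fun s : ℕ → α => s 0) (measurable_pi_apply 0)) a B) :=
      (Kernel.measurable_coe _ hB).indicator hA
    rw [lintegral_map this hpast]
    refine lintegral_congr fun ω => ?_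
    by_cases hω : past (path S ω) 0 ∈ A <;> simp [Set.indicator, hω, Kernel.comap_apply, past, path]
  rw [← h₁ B hB, ← h₂ B hB]
  congr 1
  refine ext_of_boxes fun k B hB => ?_
  obtain ⟨r, hr, hr'⟩ := exists_lintegral_past_mul_prod hS hp k
    (fun i => (B i).indicator fun _ => 1) fun i => measurable_const.indicator (hB i)
  have hprod : ∀ ω, ∏ i ∈ Finset.range k, (B i).indicator (fun _ => (1 : ℝ≥0∞)) (S (i + 1) ω) =
      {f : ℕ → α | ∀ i < k, f i ∈ B i}.indicator (fun _ => 1) (future (path S ω) 1) := by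
    intro ω
    have hiff : ∀ i : ℕ, future (path S ω) 1 i = S (i + 1) ω := fun i => by
      simp [future, path, add_comm]
    by_cases hω : ∀ i < k, S (i + 1) ω ∈ B i
    · rw [Set.indicator_of_mem (by simpa [hiff] using hω)]
      exact Finset.prod_eq_one fun i hi =>
        Set.indicator_of_mem (hω i (Finset.mem_range.1 hi)) _
    · rw [Set.indicator_of_notMem (by simpa [hiff] using hω)]
      push Not at hω
      obtain ⟨i, hi, hi'⟩ := hω
      exact Finset.prod_eq_zero (Finset.mem_range.2 hi) (Set.indicator_of_notMem hi' _)
  simp only [hprod] at hr'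
  -- `P` is known only as a conditional law given the state at time 0; this identifies its box
  -- probabilities with `r`, which is valid given the whole past.
  have hPr : (fun s => P s {f | ∀ i < k, f i ∈ B i}) =ᵐ[μ.map (S 0)] r := by
    have hPB : Measurable fun s => P s {f | ∀ i < k, f i ∈ B i} := P.measurable_coe (hbox k B hB)
    refine ae_eq_of_forall_setLIntegral_eq_of_sigmaFinite hPB hr fun A' hA' _ => ?_
    have e1 := hr' (fun z => A'.indicator (fun _ => 1) (z 0))
      ((measurable_const.indicator hA').comp (measurable_pi_apply 0))
    rw [← Measure.compProd_apply_prod hA' (hbox k B hB), ← hP,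
      Measure.map_apply ((hS 0).prodMk hfut) (hA'.prod (hbox k B hB)),
      ← lintegral_indicator hA', lintegral_map (hr.indicator hA') (hS 0),
      ← lintegral_indicator_one (((hS 0).prodMk hfut) (hA'.prod (hbox k B hB)))]
    convert e1 using 1
    · exact lintegral_congr fun ω => indicator_preimage_prodMk ..
    · refine lintegral_congr fun ω => ?_
      by_cases h1 : S 0 ω ∈ A' <;> simp [Set.indicator, h1, past, path]
  rw [h₂' _ (hbox k B hB)]
  have e2 := hr' (A.indicator fun _ => 1) (measurable_const.indicator hA)
  have e3 : ∫⁻ ω, A.indicator (fun _ => 1) (past (path S ω) 0) *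
      P (S 0 ω) {f | ∀ i < k, f i ∈ B i} ∂μ =
      ∫⁻ ω, A.indicator (fun _ => 1) (past (path S ω) 0) * r (S 0 ω) ∂μ := by
    refine lintegral_congr_ae ?_
    filter_upwards [ae_of_ae_map (hS 0).aemeasurable hPr] with ω hω
    rw [hω]
  rw [e3, ← e2, h₁ _ (hbox k B hB), Measure.map_apply (hpast.prodMk hfut) (hA.prod (hbox k B hB)),
    ← lintegral_indicator_one ((hpast.prodMk hfut) (hA.prod (hbox k B hB)))]
  exact lintegral_congr fun ω => indicator_preimage_prodMk ..

end MarkovChain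

/-! ### The response recursion as kernels and as operators on functions, and its contraction. -/

section ResponseKernel

/-- `Q t w y s` is the probability of the response `w` at time `t` given the past responses `y` and
the path `s` of the chain; on `𝒟` it depends on `s` through the past at time `t` only. -/
structure IsResponseKernel {E T : Type*} [Fintype E] [MeasurableSpace E] [MeasurableSpace T]
    (Q : ℤ → E → (ℕ → E) → (ℤ → T) → ℝ) (𝒟 : Set (ℤ → T)) (b : ℕ → ℝ) : Prop where
  measurable : ∀ t w, Measurable (fun p : (ℕ → E) × (ℤ → T) => Q t w p.1 p.2)
  nonneg : ∀ t w y s, 0 ≤ Q t w y s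
  sum_eq_one : ∀ t y s, ∑ w, Q t w y s = 1
  dTV_le : ∀ t s m y y', (∀ i < m, y i = y' i) →
    dTV (fun w => Q t w y s) (fun w => Q t w y' s) ≤ b m
  congr : ∀ t w y, ∀ s ∈ 𝒟, ∀ s' ∈ 𝒟, (∀ u ≤ t, s u = s' u) → Q t w y s = Q t w y s'

/-- One step of the response recursion, acting on functions of past responses and chain path. -/
def stepOp {E T : Type*} [Fintype E] (Q : ℤ → E → (ℕ → E) → (ℤ → T) → ℝ) (t : ℤ) (F : (ℕ → E) × (ℤ → T) → ℝ) :
    (ℕ → E) × (ℤ → T) → ℝ :=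
  fun p => ∑ w, Q t w p.1 p.2 * F (prepend w p.1, p.2)

/-- The `n` steps of the response recursion at times `t + 1, …, t + n`. -/
def iterOp {E T : Type*} [Fintype E] (Q : ℤ → E → (ℕ → E) → (ℤ → T) → ℝ) :
    ℕ → ℤ → ((ℕ → E) × (ℤ → T) → ℝ) → (ℕ → E) × (ℤ → T) → ℝ
  | 0, _, F => F
  | n + 1, t, F => stepOp Q (t + 1) (iterOp Q n (t + 1) F)

lemma iterOp_mul {E T : Type*} [Fintype E] (Q : ℤ → E → (ℕ → E) → (ℤ → T) → ℝ) (n : ℕ) (t : ℤ)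
    (F : (ℕ → E) × (ℤ → T) → ℝ) (h : (ℤ → T) → ℝ)
    (p : (ℕ → E) × (ℤ → T)) :
    iterOp Q n t (fun p => F p * h p.2) p = iterOp Q n t F p * h p.2 := by
  induction n generalizing t p with
  | zero => rfl
  | succ n ih =>
    simp only [iterOp, stepOp, ih, Finset.sum_mul]
    exact Finset.sum_congr rfl fun w _ => by ring

lemma measurable_prepend_prod {E T : Type*} [MeasurableSpace E] [MeasurableSpace T] (w : E) :
    Measurable (fun p : (ℕ → E) × (ℤ → T) => (prepend w p.1, p.2)) :=
  ((measurable_prepend w).comp measurable_fst).prodMk measurable_snd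

variable {E T : Type*} [Fintype E] [MeasurableSpace E] [MeasurableSpace T]

variable {Q : ℤ → E → (ℕ → E) → (ℤ → T) → ℝ} {𝒟 : Set (ℤ → T)} {b : ℕ → ℝ}

namespace IsResponseKernel

/-- The transition kernel of the response recursion at time `t`. -/
def stepKernel (hQ : IsResponseKernel Q 𝒟 b) (t : ℤ) :
    Kernel ((ℕ → E) × (ℤ → T)) ((ℕ → E) × (ℤ → T)) where
  toFun p := ∑ w, ENNReal.ofReal (Q t w p.1 p.2) • Measure.dirac (prepend w p.1, p.2)
  measurable' := by
    refine Measure.measurable_of_measurable_coe _ fun A hA => ?_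
    simp only [Measure.coe_finsetSum, Finset.sum_apply, Measure.smul_apply, smul_eq_mul,
      Measure.dirac_apply' _ hA]
    refine Finset.measurable_fun_sum _ fun w _ => ?_
    exact (hQ.measurable t w).ennreal_ofReal.mul
      ((measurable_const.indicator hA).comp (measurable_prepend_prod w))

lemma stepKernel_apply (hQ : IsResponseKernel Q 𝒟 b) (t : ℤ) (p : (ℕ → E) × (ℤ → T)) :
    hQ.stepKernel t p =
      ∑ w, ENNReal.ofReal (Q t w p.1 p.2) • Measure.dirac (prepend w p.1, p.2) := rfl

instance (hQ : IsResponseKernel Q 𝒟 b) (t : ℤ) : IsMarkovKernel (hQ.stepKernel t) := by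
  refine ⟨fun p => ⟨?_⟩⟩
  rw [stepKernel_apply]
  simp only [Measure.coe_finsetSum, Finset.sum_apply, Measure.smul_apply, smul_eq_mul,
    measure_univ, mul_one]
  rw [← ENNReal.ofReal_sum_of_nonneg fun w _ => hQ.nonneg t w _ _, hQ.sum_eq_one,
    ENNReal.ofReal_one]

lemma integral_stepKernel (hQ : IsResponseKernel Q 𝒟 b) (t : ℤ) {F : (ℕ → E) × (ℤ → T) → ℝ}
    (hF : Measurable F) (p : (ℕ → E) × (ℤ → T)) :
    ∫ z, F z ∂(hQ.stepKernel t p) = stepOp Q t F p := by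
  rw [stepKernel_apply, integral_finsetSum_measure]
  · refine Finset.sum_congr rfl fun w _ => ?_
    rw [integral_smul_measure, integral_dirac' _ _ hF.stronglyMeasurable,
      ENNReal.toReal_ofReal (hQ.nonneg t w _ _), smul_eq_mul]
  · intro w _
    exact (integrable_dirac' hF.stronglyMeasurable enorm_lt_top).smul_measure ENNReal.ofReal_ne_top

/-- The transition kernel of the response recursion from time `t` to time `t + n`. -/
def iterKernel (hQ : IsResponseKernel Q 𝒟 b) :
    ℕ → ℤ → Kernel ((ℕ → E) × (ℤ → T)) ((ℕ → E) × (ℤ → T))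
  | 0, _ => Kernel.id
  | n + 1, t => iterKernel hQ n (t + 1) ∘ₖ hQ.stepKernel (t + 1)

instance (hQ : IsResponseKernel Q 𝒟 b) (n : ℕ) (t : ℤ) : IsMarkovKernel (hQ.iterKernel n t) := by
  induction n generalizing t with
  | zero => simp only [iterKernel]; infer_instance
  | succ n ih => simp only [iterKernel]; infer_instance

lemma measurable_stepOp (hQ : IsResponseKernel Q 𝒟 b) (t : ℤ) {F : (ℕ → E) × (ℤ → T) → ℝ}
    (hF : Measurable F) : Measurable (stepOp Q t F) :=
  Finset.measurable_fun_sum _ fun w _ =>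
    (hQ.measurable t w).mul (hF.comp (measurable_prepend_prod w))

lemma abs_stepOp_le (hQ : IsResponseKernel Q 𝒟 b) (t : ℤ) {F : (ℕ → E) × (ℤ → T) → ℝ} {K : ℝ}
    (hF : ∀ p, |F p| ≤ K) (p : (ℕ → E) × (ℤ → T)) : |stepOp Q t F p| ≤ K := by
  calc |stepOp Q t F p| ≤ ∑ w, Q t w p.1 p.2 * K := by
        refine (Finset.abs_sum_le_sum_abs _ _).trans (Finset.sum_le_sum fun w _ => ?_)
        rw [abs_mul, abs_of_nonneg (hQ.nonneg t w _ _)]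
        exact mul_le_mul_of_nonneg_left (hF _) (hQ.nonneg t w _ _)
    _ = K := by rw [← Finset.sum_mul, hQ.sum_eq_one, one_mul]

lemma measurable_iterOp (hQ : IsResponseKernel Q 𝒟 b) (n : ℕ) (t : ℤ)
    {F : (ℕ → E) × (ℤ → T) → ℝ} (hF : Measurable F) : Measurable (iterOp Q n t F) := by
  induction n generalizing t with
  | zero => exact hF
  | succ n ih => exact hQ.measurable_stepOp _ (ih _)

lemma abs_iterOp_le (hQ : IsResponseKernel Q 𝒟 b) (n : ℕ) (t : ℤ)
    {F : (ℕ → E) × (ℤ → T) → ℝ} {K : ℝ} (hF : ∀ p, |F p| ≤ K) (p : (ℕ → E) × (ℤ → T)) :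
    |iterOp Q n t F p| ≤ K := by
  induction n generalizing t p with
  | zero => exact hF p
  | succ n ih => exact hQ.abs_stepOp_le _ (ih _) p

lemma integral_iterKernel (hQ : IsResponseKernel Q 𝒟 b) (n : ℕ) (t : ℤ)
    {F : (ℕ → E) × (ℤ → T) → ℝ} {K : ℝ} (hF : Measurable F) (hK : ∀ p, |F p| ≤ K)
    (p : (ℕ → E) × (ℤ → T)) :
    ∫ z, F z ∂(hQ.iterKernel n t p) = iterOp Q n t F p := by
  induction n generalizing t p with
  | zero =>
    rw [iterKernel, Kernel.id_apply, integral_dirac' _ _ hF.stronglyMeasurable]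
    rfl
  | succ n ih =>
    have hint : Integrable F ((hQ.iterKernel n (t + 1) ∘ₖ hQ.stepKernel (t + 1)) p) :=
      Integrable.of_bound hF.aestronglyMeasurable K (ae_of_all _ hK)
    rw [iterKernel, Kernel.integral_comp hint]
    simp only [ih]
    exact hQ.integral_stepKernel _ (hQ.measurable_iterOp _ _ hF) _

/-- The recursion only prepends `n` symbols and never changes the path. The past at time 0 can
therefore be read off the history at a later time. -/
lemma ae_iterKernel (hQ : IsResponseKernel Q 𝒟 b) [MeasurableSingletonClass E]
    [StandardBorelSpace T] (n : ℕ) (t : ℤ) (p : (ℕ → E) × (ℤ → T)) :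
    ∀ᵐ z ∂(hQ.iterKernel n t p), (fun i => z.1 (i + n)) = p.1 ∧ z.2 = p.2 := by
  have hmeas : ∀ (n : ℕ) (p : (ℕ → E) × (ℤ → T)), MeasurableSet
      {z : (ℕ → E) × (ℤ → T) | (fun i => z.1 (i + n)) = p.1 ∧ z.2 = p.2} := by
    intro n p
    have h1 : Measurable fun z : (ℕ → E) × (ℤ → T) => fun i => z.1 (i + n) :=
      measurable_pi_lambda _ fun i => (measurable_pi_apply _).comp measurable_fst
    exact (h1 (measurableSet_singleton p.1)).inter (measurable_snd (measurableSet_singleton p.2))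
  induction n generalizing t p with
  | zero =>
    rw [iterKernel, Kernel.id_apply, ae_dirac_iff (hmeas 0 p)]
    exact ⟨rfl, rfl⟩
  | succ n ih =>
    rw [iterKernel, Kernel.ae_comp_iff (hmeas _ p), stepKernel_apply]
    rw [ae_iff]
    simp only [Measure.coe_finsetSum, Finset.sum_apply, Measure.smul_apply, smul_eq_mul]
    refine Finset.sum_eq_zero fun w _ => ?_
    have : ∀ᵐ z ∂(Measure.dirac (prepend w p.1, p.2)), ∀ᵐ z' ∂(hQ.iterKernel n (t + 1) z),
        (fun i => z'.1 (i + (n + 1))) = p.1 ∧ z'.2 = p.2 := by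
      rw [ae_dirac_eq, Filter.eventually_pure]
      filter_upwards [ih (t + 1) (prepend w p.1, p.2)] with z hz
      refine ⟨?_, hz.2⟩
      funext i
      have := congrFun hz.1 (i + 1)
      rw [show i + 1 + n = i + (n + 1) by ring] at this
      simpa [prepend] using this
    rw [ae_iff.1 this, mul_zero]

/-- Each step looks at the path up to its own time only. With `t + n = 0` this makes the operator,
started from a fixed history, a function of the past of the chain. -/
lemma iterOp_congr (hQ : IsResponseKernel Q 𝒟 b) {F : (ℕ → E) × (ℤ → T) → ℝ} {s s' : ℤ → T}
    (hs : s ∈ 𝒟) (hs' : s' ∈ 𝒟) (hF : ∀ y, F (y, s) = F (y, s')) (n : ℕ) (t : ℤ)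
    (h : ∀ u ≤ t + n, s u = s' u) (y : ℕ → E) :
    iterOp Q n t F (y, s) = iterOp Q n t F (y, s') := by
  induction n generalizing t y with
  | zero => exact hF y
  | succ n ih =>
    simp only [iterOp, stepOp]
    refine Finset.sum_congr rfl fun w _ => ?_
    rw [ih (t + 1) (fun u hu => h u (by push_cast; linarith)),
      hQ.congr (t + 1) w y s hs s' hs' fun u hu => h u (by push_cast; omega)]

variable [Nonempty E]

/-- Iteration of `abs_step_sub_step_le`. By the triangle inequality, changing the history along a
fixed path costs `b m`, then changing the path for a fixed history costs `ε`. The constant `C` is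
room for a cost depending on the two paths only, such as the distance of the covariates. -/
lemma abs_iterOp_sub_iterOp_le (hQ : IsResponseKernel Q 𝒟 b) (h0 : ∀ m, 0 ≤ b m)
    (h1 : ∀ m, b m ≤ 1) (hb : Antitone b) {ε : ℤ → ℝ} (hε : ∀ t, 0 ≤ ε t) {s s' : ℤ → T}
    (hd : ∀ t y, dTV (fun w => Q t w y s) (fun w => Q t w y s') ≤ ε t)
    {F : (ℕ → E) × (ℤ → T) → ℝ} {C : ℝ} {I : Finset ℕ}
    (hF : ∀ y y', |F (y, s) - F (y', s')| ≤ C + ∑ i ∈ I, lagCost b ε 0 0 0 y y' i)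
    (n : ℕ) (t : ℤ) (m : ℕ) (y y' : ℕ → E) (hy : ∀ i < m, y i = y' i) :
    |iterOp Q n t F (y, s) - iterOp Q n t F (y', s')|
      ≤ C + ∑ i ∈ I, lagCost b ε t n m y y' i := by
  induction n generalizing t m y y' with
  | zero => exact hF y y'
  | succ n ih =>
    refine abs_step_sub_step_le h0 h1 hb (hε _) (ν := fun w y => Q (t + 1) w y s)
      (ν' := fun w y => Q (t + 1) w y s') (F := fun y => iterOp Q n (t + 1) F (y, s))
      (F' := fun y => iterOp Q n (t + 1) F (y, s'))
      (fun w y => hQ.nonneg _ w y s) (fun w y => hQ.nonneg _ w y s') (fun y => hQ.sum_eq_one _ y s)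
      (fun y => hQ.sum_eq_one _ y s') (fun m y y' h => ?_) (ih (t + 1)) m y y' hy
    exact (dTV_triangle _ (fun w => Q (t + 1) w y' s) _).trans
      (add_le_add (hQ.dTV_le _ s m y y' h) (hd _ _))

end IsResponseKernel

end ResponseKernel

/-! ### Joint laws of chain and responses; past responses do not anticipate the chain. -/

section ResponseLaw

lemma integral_bind_kernel {α β : Type*} [MeasurableSpace α] [MeasurableSpace β] {μ : Measure α}
    [SFinite μ] {κ : Kernel α β} [IsSFiniteKernel κ] {f : β → ℝ} (hf : Integrable f (μ.bind κ)) :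
    ∫ y, f y ∂(μ.bind κ) = ∫ x, ∫ y, f y ∂(κ x) ∂μ := by
  rw [Measure.comp_eq_comp_const_apply] at hf ⊢
  rw [Kernel.integral_comp hf, Kernel.const_apply]

/-- The responses up to time `t` together with the whole path of the chain. -/
def hist {E T : Type*} (t : ℤ) (ω : (ℤ → T) × (ℤ → E)) : (ℕ → E) × (ℤ → T) := (past ω.2 t, ω.1)

/-- The past of responses and chain at time `0`. -/
def pastPair {E T : Type*} (ω : (ℤ → T) × (ℤ → E)) : (ℕ → E) × (ℕ → T) := (past ω.2 0, past ω.1 0)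

variable {E T : Type*} [MeasurableSpace E] [MeasurableSpace T]

lemma measurable_hist (t : ℤ) : Measurable (hist t : (ℤ → T) × (ℤ → E) → _) :=
  ((measurable_past t).comp measurable_snd).prodMk measurable_fst

lemma measurable_pastPair : Measurable (pastPair : (ℤ → T) × (ℤ → E) → _) :=
  ((measurable_past 0).comp measurable_snd).prodMk ((measurable_past 0).comp measurable_fst)

/-- A function of the path that depends on the past only is, given the past, uncorrelated with the
future. -/
lemma integral_mul_mul_future {ν : Measure (ℤ → T)} [IsProbabilityMeasure ν]
    {κ : Kernel (ℕ → T) (ℕ → T)} [IsMarkovKernel κ]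
    (hν : ν.map (fun s => (past s 0, future s 1)) = (ν.map (fun s => past s 0)) ⊗ₘ κ)
    {𝒟 : Set (ℤ → T)} (h𝒟 : ∀ᵐ s ∂ν, s ∈ 𝒟) (hmeas : MeasurableSet 𝒟)
    {f : (ℤ → T) → ℝ} (hf : Measurable f) (hf1 : ∀ s, |f s| ≤ 1)
    (hloc : ∀ s ∈ 𝒟, ∀ s' ∈ 𝒟, (∀ u ≤ 0, s u = s' u) → f s = f s')
    {h : (ℕ → T) → ℝ} (hh : Measurable h) (hh1 : ∀ z, |h z| ≤ 1)
    {k : (ℕ → T) → ℝ} (hk : Measurable k) (hk1 : ∀ z, |k z| ≤ 1) :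
    ∫ s, f s * (h (past s 0) * k (future s 1)) ∂ν =
      ∫ s, f s * (h (past s 0) * ∫ z, k z ∂(κ (past s 0))) ∂ν := by
  have hpf : Measurable fun s : ℤ → T => (past s 0, future s 1) :=
    (measurable_past 0).prodMk (measurable_future 1)
  have : IsProbabilityMeasure (ν.map fun s => past s 0) :=
    Measure.isProbabilityMeasure_map (measurable_past 0).aemeasurable
  have hfg : Measurable fun p : (ℕ → T) × (ℕ → T) => f (glue p.1 p.2) := hf.comp measurable_glue
  have hκk : Measurable fun z => ∫ z', k z' ∂(κ z) :=
    (hk.stronglyMeasurable.integral_kernel (κ := κ)).measurable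
  have hκk1 : ∀ z, |∫ z', k z' ∂(κ z)| ≤ 1 := fun z => by
    have := norm_integral_le_of_norm_le_const (μ := κ z) (f := k) (C := 1) (ae_of_all _ hk1)
    simpa using this
  have m₁ : Measurable fun p : (ℕ → T) × (ℕ → T) => f (glue p.1 p.2) * (h p.1 * k p.2) :=
    hfg.mul ((hh.comp measurable_fst).mul (hk.comp measurable_snd))
  have m₂ : Measurable fun p : (ℕ → T) × (ℕ → T) =>
      f (glue p.1 p.2) * (h p.1 * ∫ z, k z ∂(κ p.1)) :=
    hfg.mul ((hh.comp measurable_fst).mul (hκk.comp measurable_fst))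
  have bd : ∀ x y z : ℝ, |x| ≤ 1 → |y| ≤ 1 → |z| ≤ 1 → ‖x * (y * z)‖ ≤ 1 := by
    intro x y z hx hy hz
    rw [Real.norm_eq_abs, abs_mul, abs_mul]
    exact mul_le_one₀ hx (by positivity) (mul_le_one₀ hy (by positivity) hz)
  have i₁ := Integrable.of_bound (μ := (ν.map fun s => past s 0) ⊗ₘ κ) m₁.aestronglyMeasurable 1
    (ae_of_all _ fun p => bd _ _ _ (hf1 _) (hh1 _) (hk1 _))
  have i₂ := Integrable.of_bound (μ := (ν.map fun s => past s 0) ⊗ₘ κ) m₂.aestronglyMeasurable 1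
    (ae_of_all _ fun p => bd _ _ _ (hf1 _) (hh1 _) (hκk1 _))
  have e₁ : ∫ s, f s * (h (past s 0) * k (future s 1)) ∂ν =
      ∫ p, f (glue p.1 p.2) * (h p.1 * k p.2) ∂((ν.map fun s => past s 0) ⊗ₘ κ) := by
    rw [← hν, integral_map hpf.aemeasurable m₁.aestronglyMeasurable]
    simp only [glue_past_future]
  have e₂ : ∫ s, f s * (h (past s 0) * ∫ z, k z ∂(κ (past s 0))) ∂ν =
      ∫ p, f (glue p.1 p.2) * (h p.1 * ∫ z, k z ∂(κ p.1)) ∂((ν.map fun s => past s 0) ⊗ₘ κ) := by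
    rw [← hν, integral_map hpf.aemeasurable m₂.aestronglyMeasurable]
    simp only [glue_past_future]
  have hae : ∀ᵐ z ∂(ν.map fun s => past s 0), ∀ᵐ z' ∂(κ z), glue z z' ∈ 𝒟 := by
    have : ∀ᵐ p ∂((ν.map fun s => past s 0) ⊗ₘ κ), glue p.1 p.2 ∈ 𝒟 := by
      rw [← hν, ae_map_iff hpf.aemeasurable (measurable_glue hmeas)]
      simpa only [glue_past_future] using h𝒟
    exact Measure.ae_ae_of_ae_compProd this
  rw [e₁, e₂, Measure.integral_compProd i₁, Measure.integral_compProd i₂]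
  refine integral_congr_ae ?_
  filter_upwards [hae] with z hz
  -- Locality of `f` is available only inside `𝒟`. A reference future whose glued path lies in `𝒟`
  -- is fixed, and `f` then equals almost surely a constant that leaves the integral.
  obtain ⟨z₀, hz₀⟩ := hz.exists
  have hc : ∀ᵐ z' ∂(κ z), f (glue z z') = f (glue z z₀) := by
    filter_upwards [hz] with z' hz'
    exact hloc _ hz' _ hz₀ fun u hu => by rw [glue_of_nonpos _ _ hu, glue_of_nonpos _ _ hu]
  have c₁ : ∫ z', f (glue z z') * (h z * k z') ∂(κ z) =
      ∫ z', f (glue z z₀) * (h z * k z') ∂(κ z) := by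
    refine integral_congr_ae ?_
    filter_upwards [hc] with z' hz'
    rw [hz']
  have c₂ : ∫ z', f (glue z z') * (h z * ∫ x, k x ∂(κ z)) ∂(κ z) =
      ∫ z', f (glue z z₀) * (h z * ∫ x, k x ∂(κ z)) ∂(κ z) := by
    refine integral_congr_ae ?_
    filter_upwards [hc] with z' hz'
    rw [hz']
  change ∫ z', f (glue z z') * (h z * k z') ∂(κ z) =
    ∫ z', f (glue z z') * (h z * ∫ x, k x ∂(κ z)) ∂(κ z)
  rw [c₁, c₂]
  simp [integral_const_mul]

variable [Fintype E] {Q : ℤ → E → (ℕ → E) → (ℤ → T) → ℝ} {𝒟 : Set (ℤ → T)} {b : ℕ → ℝ}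

namespace IsResponseKernel

/-- `m` is the joint law of a chain and of responses following the kernel `Q`. -/
def IsLaw (hQ : IsResponseKernel Q 𝒟 b) (m : Measure ((ℤ → T) × (ℤ → E))) : Prop :=
  ∀ t : ℤ, m.map (hist t) = (m.map (hist (t - 1))).bind (hQ.stepKernel t)

variable {m : Measure ((ℤ → T) × (ℤ → E))}

lemma IsLaw.map_hist_add {hQ : IsResponseKernel Q 𝒟 b} (hm : hQ.IsLaw m) (n : ℕ) (t : ℤ) :
    m.map (hist (t + n)) = (m.map (hist t)).bind (hQ.iterKernel n t) := by
  induction n generalizing t with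
  | zero => simp [iterKernel, Measure.id_comp]
  | succ n ih =>
    have := ih (t + 1)
    rw [hm (t + 1), add_sub_cancel_right, Measure.comp_assoc] at this
    rw [iterKernel, ← this]
    congr 2
    push_cast
    ring

lemma IsLaw.integral_hist_add {hQ : IsResponseKernel Q 𝒟 b} (hm : hQ.IsLaw m)
    [IsProbabilityMeasure m] (n : ℕ) (t : ℤ) {F : (ℕ → E) × (ℤ → T) → ℝ} {K : ℝ}
    (hF : Measurable F) (hK : ∀ p, |F p| ≤ K) :
    ∫ ω, F (hist (t + n) ω) ∂m = ∫ ω, iterOp Q n t F (hist t ω) ∂m := by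
  have : IsProbabilityMeasure (m.map (hist t)) :=
    Measure.isProbabilityMeasure_map (measurable_hist t).aemeasurable
  rw [← integral_map (measurable_hist _).aemeasurable hF.aestronglyMeasurable, hm.map_hist_add,
    integral_bind_kernel (Integrable.of_bound hF.aestronglyMeasurable K (ae_of_all _ hK)),
    integral_map (measurable_hist _).aemeasurable]
  · exact integral_congr_ae (ae_of_all _ fun ω => hQ.integral_iterKernel n t hF hK _)
  · exact (hF.stronglyMeasurable.integral_kernel).aestronglyMeasurable

variable [Nonempty E]

/-- The responses forget their remote past: given the chain, the law of finitely many of them is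
determined by the chain up to the same time. -/
lemma IsLaw.integral_box_mul_eq {hQ : IsResponseKernel Q 𝒟 b} (hm : hQ.IsLaw m)
    [IsProbabilityMeasure m] (h0 : ∀ m, 0 ≤ b m) (h1 : ∀ m, b m < 1) (hb : Antitone b)
    (hs : Summable b) {h₁ h₂ : (ℤ → T) → ℝ} (hh₁ : Measurable h₁) (hh₂ : Measurable h₂)
    (hb₁ : ∀ s, |h₁ s| ≤ 1) (hb₂ : ∀ s, |h₂ s| ≤ 1)
    (hloc : ∀ f : (ℤ → T) → ℝ, Measurable f → (∀ s, |f s| ≤ 1) →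
      (∀ s ∈ 𝒟, ∀ s' ∈ 𝒟, (∀ u ≤ 0, s u = s' u) → f s = f s') →
      ∫ ω, f ω.1 * h₁ ω.1 ∂m = ∫ ω, f ω.1 * h₂ ω.1 ∂m)
    {φ : (ℕ → E) → ℝ} (hφ : Measurable φ) (hφ1 : ∀ y, |φ y| ≤ 1) (k : ℕ)
    (hφk : ∀ y y', |φ y - φ y'| ≤ ∑ i ∈ Finset.range k, lagCost b 0 0 0 0 y y' i) :
    ∫ ω, φ (past ω.2 0) * h₁ ω.1 ∂m = ∫ ω, φ (past ω.2 0) * h₂ ω.1 ∂m := by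
  obtain ⟨w₀⟩ := ‹Nonempty E›
  have : Nonempty E := ⟨w₀⟩
  let y₀ : ℕ → E := fun _ => w₀
  let F : (ℕ → E) × (ℤ → T) → ℝ := fun p => φ p.1
  have hF : Measurable F := hφ.comp measurable_fst
  -- The price, over the `k` coordinates tested, of starting at time `-N` from a wrong history; it
  -- vanishes because the reset chain is transient.
  let δ : ℕ → ℝ := fun N => ∑ i ∈ Finset.range k, resetProb b (N - i) 0
  have hδ : Tendsto δ atTop (𝓝 0) := by
    rw [show (0 : ℝ) = ∑ i ∈ Finset.range k, (0 : ℝ) by simp]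
    exact tendsto_finsetSum _ fun i _ =>
      (tendsto_resetProb h0 h1 hs).comp (tendsto_sub_atTop_nat i)
  have bd : ∀ x y : ℝ, |x| ≤ 1 → |y| ≤ 1 → |x * y| ≤ 1 := by
    intro x y hx hy
    rw [abs_mul]
    exact mul_le_one₀ hx (by positivity) hy
  -- Up to `δ N` the true history at time `-N` may be replaced by `y₀`, which leaves a function of
  -- the chain alone.
  have close : ∀ h : (ℤ → T) → ℝ, Measurable h → (∀ s, |h s| ≤ 1) → ∀ N, k ≤ N →
      |∫ ω, φ (past ω.2 0) * h ω.1 ∂m - ∫ ω, iterOp Q N (-N) F (y₀, ω.1) * h ω.1 ∂m| ≤ δ N := by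
    intro h hh hh1 N hN
    have e := hm.integral_hist_add N (-N) (F := fun p => F p * h p.2) (K := 1)
      (hF.mul (hh.comp measurable_snd)) (fun p => bd _ _ (hφ1 _) (hh1 _))
    simp only [iterOp_mul, neg_add_cancel] at e
    have hT := hQ.measurable_iterOp N (-N) hF
    have hTb := hQ.abs_iterOp_le N (-N) (F := F) (K := 1) fun p => hφ1 p.1
    have m₁ : Measurable fun ω : (ℤ → T) × (ℤ → E) =>
        iterOp Q N (-N) F (hist (-N) ω) * h (hist (-N) ω).2 :=
      (hT.comp (measurable_hist _)).mul (hh.comp measurable_fst)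
    have m₂ : Measurable fun ω : (ℤ → T) × (ℤ → E) => iterOp Q N (-N) F (y₀, ω.1) * h ω.1 :=
      (hT.comp (measurable_const.prodMk measurable_fst)).mul (hh.comp measurable_fst)
    have i₁ := Integrable.of_bound (μ := m) m₁.aestronglyMeasurable 1
      (ae_of_all _ fun ω => bd _ _ (hTb _) (hh1 _))
    have i₂ := Integrable.of_bound (μ := m) m₂.aestronglyMeasurable 1
      (ae_of_all _ fun ω => bd _ _ (hTb _) (hh1 _))
    change |∫ ω, F (hist 0 ω) * h (hist 0 ω).2 ∂m - _| ≤ _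
    rw [e, ← integral_sub i₁ i₂]
    have hpt : ∀ ω : (ℤ → T) × (ℤ → E), ‖iterOp Q N (-N) F (hist (-N) ω) * h (hist (-N) ω).2 -
        iterOp Q N (-N) F (y₀, ω.1) * h ω.1‖ ≤ δ N := by
      intro ω
      have key := hQ.abs_iterOp_sub_iterOp_le h0 (fun m => (h1 m).le) hb (ε := 0)
        (fun _ => le_refl _) (s := ω.1) (s' := ω.1) (fun t y => by simp [dTV]) (F := F) (C := 0)
        (I := Finset.range k) (fun y y' => by simpa using hφk y y') N (-N) 0 (past ω.2 (-N)) y₀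
        (by simp)
      have hl : ∑ i ∈ Finset.range k, lagCost b 0 (-N) N 0 (past ω.2 (-N)) y₀ i = δ N := by
        refine Finset.sum_congr rfl fun i hi => ?_
        have : i < N := (Finset.mem_range.1 hi).trans_le hN
        simp [lagCost, this, mismatch]
      rw [hl, zero_add] at key
      rw [show (hist (-N) ω).2 = ω.1 from rfl, ← sub_mul, norm_mul]
      exact (mul_le_mul key (hh1 _) (abs_nonneg _) ((abs_nonneg _).trans key)).trans_eq (mul_one _)
    have := norm_integral_le_of_norm_le_const (μ := m) (ae_of_all _ hpt)
    simpa using this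
  have key : ∀ᶠ N in atTop, |∫ ω, φ (past ω.2 0) * h₁ ω.1 ∂m - ∫ ω, φ (past ω.2 0) * h₂ ω.1 ∂m|
      ≤ δ N + δ N := by
    filter_upwards [eventually_ge_atTop k] with N hN
    have c₁ := close h₁ hh₁ hb₁ N hN
    have c₂ := close h₂ hh₂ hb₂ N hN
    -- Started from `y₀` at time `-N`, the operator sees the chain up to time 0 only, so the
    -- assumption on `h₁` and `h₂` applies to it.
    rw [hloc (fun s => iterOp Q N (-N) F (y₀, s))
      ((hQ.measurable_iterOp N (-N) hF).comp (measurable_const.prodMk measurable_id))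
      (fun s => hQ.abs_iterOp_le N (-N) (fun p => hφ1 p.1) _)
      (fun s hs s' hs' hss => hQ.iterOp_congr hs hs' (fun y => rfl) N (-N) (by simpa using hss) _)]
      at c₁
    rw [abs_sub_comm] at c₂
    exact (abs_sub_le _ _ _).trans (add_le_add c₁ c₂)
  have hlim : Tendsto (fun N => δ N + δ N) atTop (𝓝 0) := by simpa using hδ.add hδ
  have := ge_of_tendsto hlim key
  exact sub_eq_zero.1 (abs_nonpos_iff.1 this)

variable [MeasurableSingletonClass E]

/-- `h₁` and `h₂` are read as densities, so that equality on boxes extends to all events. The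
indicator of a box in `k` coordinates is Lipschitz for the sum of the `k` discrete distances. -/
lemma IsLaw.map_past_withDensity_eq {hQ : IsResponseKernel Q 𝒟 b} (hm : hQ.IsLaw m)
    [IsProbabilityMeasure m] (h0 : ∀ m, 0 ≤ b m) (h1 : ∀ m, b m < 1) (hb : Antitone b)
    (hs : Summable b) {h₁ h₂ : (ℤ → T) → ℝ} (hh₁ : Measurable h₁) (hh₂ : Measurable h₂)
    (p₁ : ∀ s, 0 ≤ h₁ s) (p₂ : ∀ s, 0 ≤ h₂ s) (hb₁ : ∀ s, h₁ s ≤ 1) (hb₂ : ∀ s, h₂ s ≤ 1)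
    (hloc : ∀ f : (ℤ → T) → ℝ, Measurable f → (∀ s, |f s| ≤ 1) →
      (∀ s ∈ 𝒟, ∀ s' ∈ 𝒟, (∀ u ≤ 0, s u = s' u) → f s = f s') →
      ∫ ω, f ω.1 * h₁ ω.1 ∂m = ∫ ω, f ω.1 * h₂ ω.1 ∂m) :
    (m.withDensity fun ω => ENNReal.ofReal (h₁ ω.1)).map (fun ω => past ω.2 0) =
      (m.withDensity fun ω => ENNReal.ofReal (h₂ ω.1)).map (fun ω => past ω.2 0) := by
  have hy : Measurable fun ω : (ℤ → T) × (ℤ → E) => past ω.2 0 :=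
    (measurable_past 0).comp measurable_snd
  have hint : ∀ {h : (ℤ → T) → ℝ}, Measurable h → (∀ s, 0 ≤ h s) → (∀ s, h s ≤ 1) →
      Integrable (fun ω : (ℤ → T) × (ℤ → E) => h ω.1) m := fun hh p hb =>
    Integrable.of_bound (hh.comp measurable_fst).aestronglyMeasurable 1
      (ae_of_all _ fun ω => by simpa [abs_of_nonneg (p _)] using hb _)
  have hbox : ∀ (k : ℕ) (B : ℕ → Set E), MeasurableSet {f : ℕ → E | ∀ i < k, f i ∈ B i} := by
    intro k B
    simp only [Set.ofPred_forall]
    exact MeasurableSet.iInter fun i => MeasurableSet.iInter fun _ =>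
      measurable_pi_apply i (Set.toFinite (B i)).measurableSet
  have hval : ∀ {h : (ℤ → T) → ℝ}, Measurable h → (∀ s, 0 ≤ h s) → (∀ s, h s ≤ 1) →
      ∀ C : Set (ℕ → E), MeasurableSet C →
      (m.withDensity fun ω => ENNReal.ofReal (h ω.1)).map (fun ω => past ω.2 0) C =
        ENNReal.ofReal (∫ ω, C.indicator (fun _ => (1 : ℝ)) (past ω.2 0) * h ω.1 ∂m) := by
    intro h hh p hb C hC
    rw [Measure.map_apply hy hC, withDensity_apply _ (hy hC),
      ← ofReal_integral_eq_lintegral_ofReal (hint hh p hb).integrableOn (ae_of_all _ fun ω => p _),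
      ← integral_indicator (hy hC)]
    congr 2
    funext ω
    by_cases hω : past ω.2 0 ∈ C <;> simp [Set.indicator, hω]
  have : IsFiniteMeasure (m.withDensity fun ω => ENNReal.ofReal (h₁ ω.1)) :=
    isFiniteMeasure_withDensity_ofReal (hint hh₁ p₁ hb₁).2
  refine ext_of_boxes fun k B _ => ?_
  have hC := hbox k B
  rw [hval hh₁ p₁ hb₁ _ hC, hval hh₂ p₂ hb₂ _ hC]
  congr 1
  have ha : ∀ {h : (ℤ → T) → ℝ}, (∀ s, 0 ≤ h s) → (∀ s, h s ≤ 1) → ∀ s, |h s| ≤ 1 :=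
    fun p hb s => by rw [abs_of_nonneg (p s)]; exact hb s
  classical
  refine hm.integral_box_mul_eq h0 h1 hb hs hh₁ hh₂ (ha p₁ hb₁) (ha p₂ hb₂) hloc
    (measurable_const.indicator hC) (fun y => ?_) k fun y y' => ?_
  · by_cases h : y ∈ {f : ℕ → E | ∀ i < k, f i ∈ B i} <;> simp [h]
  · by_cases hyy : ∀ i < k, y i = y' i
    · have : y ∈ {f : ℕ → E | ∀ i < k, f i ∈ B i} ↔ y' ∈ {f : ℕ → E | ∀ i < k, f i ∈ B i} :=
        forall₂_congr fun i hi => by rw [hyy i hi]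
      rw [Set.indicator_apply, Set.indicator_apply, if_congr this rfl rfl, sub_self, abs_zero]
      exact Finset.sum_nonneg fun i _ => by simp only [lagCost]; split_ifs <;> simp at *
    · push Not at hyy
      obtain ⟨i, hi, hne⟩ := hyy
      have h1 : |Set.indicator {f : ℕ → E | ∀ i < k, f i ∈ B i} (fun _ => (1 : ℝ)) y -
          Set.indicator {f : ℕ → E | ∀ i < k, f i ∈ B i} (fun _ => (1 : ℝ)) y'| ≤ 1 := by
        rw [Set.indicator_apply, Set.indicator_apply]
        split_ifs <;> norm_num
      refine h1.trans ?_
      have h2 : lagCost b 0 0 0 0 y y' i = 1 := by simp [lagCost, hne]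
      rw [← h2]
      exact Finset.single_le_sum (f := fun i => lagCost b 0 0 0 0 y y' i)
        (fun i _ => by simp only [lagCost]; split_ifs <;> simp at *) (Finset.mem_range.2 hi)

/-- Given the past of responses and chain, the future of the chain follows the path kernel. -/
lemma IsLaw.map_pastPair_future {hQ : IsResponseKernel Q 𝒟 b} (hm : hQ.IsLaw m)
    [IsProbabilityMeasure m] (h0 : ∀ m, 0 ≤ b m) (h1 : ∀ m, b m < 1) (hb : Antitone b)
    (hs : Summable b) (h𝒟 : ∀ᵐ ω ∂m, ω.1 ∈ 𝒟) (hmeas : MeasurableSet 𝒟)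
    {P : Kernel T (ℕ → T)} [IsMarkovKernel P]
    (hP : m.map (fun ω => (past ω.1 0, future ω.1 1)) =
      (m.map (fun ω => past ω.1 0)) ⊗ₘ (P.comap (fun s : ℕ → T => s 0) (measurable_pi_apply 0))) :
    m.map (fun ω => (pastPair ω, future ω.1 1)) = (m.map pastPair) ⊗ₘ
      (P.comap (fun p : (ℕ → E) × (ℕ → T) => p.2 0)
        ((measurable_pi_apply 0).comp measurable_snd)) := by
  have hps : Measurable fun ω : (ℤ → T) × (ℤ → E) => past ω.1 0 :=
    (measurable_past 0).comp measurable_fst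
  have hpy : Measurable fun ω : (ℤ → T) × (ℤ → E) => past ω.2 0 :=
    (measurable_past 0).comp measurable_snd
  have hfs : Measurable fun ω : (ℤ → T) × (ℤ → E) => future ω.1 1 :=
    (measurable_future 1).comp measurable_fst
  have hpair := measurable_pastPair (E := E) (T := T)
  have : IsProbabilityMeasure (m.map pastPair) :=
    Measure.isProbabilityMeasure_map hpair.aemeasurable
  have : IsProbabilityMeasure (m.map (fun ω => (pastPair ω, future ω.1 1))) :=
    Measure.isProbabilityMeasure_map (hpair.prodMk hfs).aemeasurable
  have : IsProbabilityMeasure (m.map Prod.fst) :=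
    Measure.isProbabilityMeasure_map measurable_fst.aemeasurable
  refine Measure.ext_prod₃' fun {C A B} hC hA hB => ?_
  -- In `h₂` the indicator of the future event is replaced by its probability under the path kernel.
  -- The two therefore agree against functions of the past of the chain, and hence against the past
  -- responses.
  let h₁ : (ℤ → T) → ℝ := fun s =>
    A.indicator (fun _ => 1) (past s 0) * B.indicator (fun _ => 1) (future s 1)
  let h₂ : (ℤ → T) → ℝ := fun s =>
    A.indicator (fun _ => 1) (past s 0) * (P (past s 0 0)).real B
  have mA : Measurable (A.indicator fun _ => (1 : ℝ)) := measurable_const.indicator hA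
  have mB : Measurable (B.indicator fun _ => (1 : ℝ)) := measurable_const.indicator hB
  have mP : Measurable fun s => (P s).real B := (P.measurable_coe hB).ennreal_toReal
  have hh₁ : Measurable h₁ := (mA.comp (measurable_past 0)).mul (mB.comp (measurable_future 1))
  have hh₂ : Measurable h₂ := (mA.comp (measurable_past 0)).mul
    (mP.comp ((measurable_pi_apply 0).comp (measurable_past 0)))
  have ind0 : ∀ {ι : Type _} (A : Set ι) (z : ι), 0 ≤ A.indicator (fun _ => (1 : ℝ)) z :=
    fun A z => Set.indicator_nonneg (fun _ _ => zero_le_one) z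
  have ind1 : ∀ {ι : Type _} (A : Set ι) (z : ι), A.indicator (fun _ => (1 : ℝ)) z ≤ 1 :=
    fun A z => Set.indicator_le_self' (fun _ _ => zero_le_one) z
  have key := hm.map_past_withDensity_eq h0 h1 hb hs hh₁ hh₂
    (fun s => mul_nonneg (ind0 _ _) (ind0 _ _)) (fun s => mul_nonneg (ind0 _ _) measureReal_nonneg)
    (fun s => mul_le_one₀ (ind1 _ _) (ind0 _ _) (ind1 _ _))
    (fun s => mul_le_one₀ (ind1 _ _) measureReal_nonneg measureReal_le_one) (by
      intro f hf hf1 hloc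
      have e₁ := integral_mul_mul_future (ν := m.map Prod.fst)
        (κ := P.comap (fun s : ℕ → T => s 0) (measurable_pi_apply 0)) (by
          rw [Measure.map_map ((measurable_past 0).prodMk (measurable_future 1)) measurable_fst,
            Measure.map_map (measurable_past 0) measurable_fst]
          exact hP)
        ((ae_map_iff measurable_fst.aemeasurable hmeas).2 h𝒟) hmeas hf hf1 hloc mA
        (fun z => by rw [abs_of_nonneg (ind0 _ _)]; exact ind1 _ _) mB
        (fun z => by rw [abs_of_nonneg (ind0 _ _)]; exact ind1 _ _)
      have e₂ : ∀ s, ∫ z, B.indicator (fun _ => (1 : ℝ)) z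
          ∂((P.comap (fun s : ℕ → T => s 0) (measurable_pi_apply 0)) (past s 0)) =
          (P (past s 0 0)).real B := fun s => by
        rw [Kernel.comap_apply]
        exact integral_indicator_one hB
      simp only [e₂] at e₁
      exact ((integral_map measurable_fst.aemeasurable
        (hf.mul hh₁).aestronglyMeasurable).symm.trans e₁).trans
        (integral_map measurable_fst.aemeasurable (hf.mul hh₂).aestronglyMeasurable))
  have := congrArg (fun ν => ν C) key
  simp only [Measure.map_apply hpy hC, withDensity_apply _ (hpy hC)] at this
  rw [← lintegral_indicator (hpy hC), ← lintegral_indicator (hpy hC)] at this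
  rw [Measure.map_apply (hpair.prodMk hfs) ((hC.prod hA).prod hB),
    ← lintegral_indicator_one ((hpair.prodMk hfs) ((hC.prod hA).prod hB)),
    Measure.compProd_apply_prod (hC.prod hA) hB, ← lintegral_indicator (hC.prod hA),
    lintegral_map ((Kernel.measurable_coe _ hB).indicator (hC.prod hA)) hpair]
  convert this using 1
  · refine lintegral_congr fun ω => ?_
    rw [indicator_preimage_prodMk]
    simp only [pastPair, h₁]
    by_cases c : past ω.2 0 ∈ C <;> by_cases a : past ω.1 0 ∈ A <;>
      by_cases b : future ω.1 1 ∈ B <;> simp [Set.indicator, c, a, b]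
  · refine lintegral_congr fun ω => ?_
    simp only [pastPair, h₂]
    by_cases c : past ω.2 0 ∈ C <;> by_cases a : past ω.1 0 ∈ A <;>
      simp [Set.indicator, c, a, Kernel.comap_apply]

end IsResponseKernel

end ResponseLaw

/-! ### The conditional law of the continuation given both pasts. -/

section FutureKernel

variable {E T : Type*} [MeasurableSpace E] [MeasurableSpace T]

lemma measurable_glue_pair :
    Measurable (fun z : ((ℕ → E) × (ℕ → T)) × (ℕ → T) => (z.1.1, glue z.1.2 z.2)) :=
  (measurable_fst.comp measurable_fst).prodMk
    (measurable_glue.comp ((measurable_snd.comp measurable_fst).prodMk measurable_snd))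

/-- The law of past responses and whole path of the chain, given the past of both at time `0`. -/
def startKernel (E : Type*) [MeasurableSpace E] (P : Kernel T (ℕ → T)) :
    Kernel ((ℕ → E) × (ℕ → T)) ((ℕ → E) × (ℤ → T)) :=
  (Kernel.id ×ₖ P.comap (fun p : (ℕ → E) × (ℕ → T) => p.2 0)
    ((measurable_pi_apply 0).comp measurable_snd)).map fun z => (z.1.1, glue z.1.2 z.2)

instance (P : Kernel T (ℕ → T)) [IsMarkovKernel P] : IsMarkovKernel (startKernel E P) :=
  Kernel.IsMarkovKernel.map _ measurable_glue_pair

lemma startKernel_apply (P : Kernel T (ℕ → T)) [IsMarkovKernel P] (p : (ℕ → E) × (ℕ → T)) :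
    startKernel E P p = (P (p.2 0)).map (fun z => (p.1, glue p.2 z)) := by
  rw [startKernel, Kernel.map_apply _ measurable_glue_pair, Kernel.prod_apply, Kernel.id_apply,
    Kernel.comap_apply, Measure.dirac_prod, Measure.map_map measurable_glue_pair (by fun_prop)]
  rfl

variable [Fintype E] {Q : ℤ → E → (ℕ → E) → (ℤ → T) → ℝ} {𝒟 : Set (ℤ → T)} {b : ℕ → ℝ}

namespace IsResponseKernel

/-- The law of the responses up to time `N` and the path of the chain, given the past of both at
time `0`. -/
def futureKernel (hQ : IsResponseKernel Q 𝒟 b) (P : Kernel T (ℕ → T)) (N : ℕ) :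
    Kernel ((ℕ → E) × (ℕ → T)) ((ℕ → E) × (ℤ → T)) :=
  hQ.iterKernel N 0 ∘ₖ startKernel E P

instance (hQ : IsResponseKernel Q 𝒟 b) (P : Kernel T (ℕ → T)) [IsMarkovKernel P] (N : ℕ) :
    IsMarkovKernel (hQ.futureKernel P N) := by
  unfold futureKernel; infer_instance

lemma integral_futureKernel (hQ : IsResponseKernel Q 𝒟 b) (P : Kernel T (ℕ → T))
    [IsMarkovKernel P] (N : ℕ) {F : (ℕ → E) × (ℤ → T) → ℝ} {K : ℝ} (hF : Measurable F)
    (hK : ∀ p, |F p| ≤ K) (p : (ℕ → E) × (ℕ → T)) :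
    ∫ z, F z ∂(hQ.futureKernel P N p) =
      ∫ z, iterOp Q N 0 F (p.1, glue p.2 z) ∂(P (p.2 0)) := by
  rw [futureKernel, Kernel.integral_comp
    (Integrable.of_bound hF.aestronglyMeasurable K (ae_of_all _ hK))]
  simp only [hQ.integral_iterKernel N 0 hF hK]
  have : Measurable fun z => (p.1, glue p.2 z) := measurable_glue_pair.comp measurable_prodMk_left
  rw [startKernel_apply,
    integral_map this.aemeasurable (hQ.measurable_iterOp N 0 hF).aestronglyMeasurable]

variable [Nonempty E] [MeasurableSingletonClass E] [StandardBorelSpace T]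
  {m : Measure ((ℤ → T) × (ℤ → E))}

/-- First the future of the chain is drawn, by `IsLaw.map_pastPair_future`, then the responses are
run along the glued path. The map `d N` recovers the pasts at time 0 from the history at time `N`,
so that conditioning on them commutes with the recursion. -/
lemma IsLaw.map_pastPair_hist {hQ : IsResponseKernel Q 𝒟 b} (hm : hQ.IsLaw m)
    [IsProbabilityMeasure m] (h0 : ∀ m, 0 ≤ b m) (h1 : ∀ m, b m < 1) (hb : Antitone b)
    (hs : Summable b) (h𝒟 : ∀ᵐ ω ∂m, ω.1 ∈ 𝒟) (hmeas : MeasurableSet 𝒟)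
    {P : Kernel T (ℕ → T)} [IsMarkovKernel P]
    (hP : m.map (fun ω => (past ω.1 0, future ω.1 1)) =
      (m.map (fun ω => past ω.1 0)) ⊗ₘ (P.comap (fun s : ℕ → T => s 0) (measurable_pi_apply 0)))
    (N : ℕ) :
    m.map (fun ω => (pastPair ω, hist N ω)) = (m.map pastPair) ⊗ₘ (hQ.futureKernel P N) := by
  have hpair := measurable_pastPair (E := E) (T := T)
  have hN := measurable_hist (E := E) (T := T) N
  have h_0 := measurable_hist (E := E) (T := T) 0
  have hfs : Measurable fun ω : (ℤ → T) × (ℤ → E) => future ω.1 1 :=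
    (measurable_future 1).comp measurable_fst
  have : IsProbabilityMeasure (m.map pastPair) :=
    Measure.isProbabilityMeasure_map hpair.aemeasurable
  have : IsProbabilityMeasure (m.map (fun ω => (pastPair ω, hist N ω))) :=
    Measure.isProbabilityMeasure_map (hpair.prodMk hN).aemeasurable
  refine Measure.ext_prod fun {A B} hA hB => ?_
  let d : ℕ → (ℕ → E) × (ℤ → T) → (ℕ → E) × (ℕ → T) := fun n z => (fun i => z.1 (i + n), past z.2 0)
  have hd : ∀ n, Measurable (d n) := fun n =>
    (measurable_pi_lambda _ fun i => (measurable_pi_apply _).comp measurable_fst).prodMk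
      ((measurable_past 0).comp measurable_snd)
  have hdp : ∀ (n : ℕ) (ω : (ℤ → T) × (ℤ → E)), d n (hist n ω) = pastPair ω := by
    intro n ω
    refine Prod.ext ?_ rfl
    funext i
    exact congrArg ω.2 (by push_cast; ring)
  have hiB : Measurable fun z => hQ.iterKernel N 0 z B := (hQ.iterKernel N 0).measurable_coe hB
  have e₁ : m.map (fun ω => (pastPair ω, hist N ω)) (A ×ˢ B) =
      ∫⁻ z, A.indicator (fun _ => 1) (d 0 z) * hQ.iterKernel N 0 z B ∂(m.map (hist 0)) := by
    have hset : (fun ω : (ℤ → T) × (ℤ → E) => (pastPair ω, hist N ω)) ⁻¹' (A ×ˢ B) =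
        hist N ⁻¹' (d N ⁻¹' A ∩ B) := by
      ext ω
      simp only [Set.mem_preimage, Set.mem_prod, Set.mem_inter_iff, hdp]
    have hmap := hm.map_hist_add N 0
    rw [zero_add] at hmap
    rw [Measure.map_apply (hpair.prodMk hN) (hA.prod hB), hset,
      ← Measure.map_apply hN ((hd N hA).inter hB), hmap,
      Measure.bind_apply ((hd N hA).inter hB) (hQ.iterKernel N 0).aemeasurable]
    refine lintegral_congr fun z => ?_
    have hz : ∀ᵐ z' ∂(hQ.iterKernel N 0 z), d N z' = d 0 z := by
      filter_upwards [hQ.ae_iterKernel N 0 z] with z' hz'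
      simp only [d, hz'.2, add_zero, Prod.mk.injEq, and_true]
      exact hz'.1
    by_cases hA0 : d 0 z ∈ A
    · rw [Set.indicator_of_mem hA0, one_mul]
      refine measure_congr ?_
      filter_upwards [hz] with z' hz'
      refine propext ⟨fun h => h.2, fun h => ⟨?_, h⟩⟩
      change d N z' ∈ A
      rwa [hz']
    · rw [Set.indicator_of_notMem hA0, zero_mul]
      refine measure_mono_null (fun z' h => ?_) (ae_iff.1 hz)
      intro h'
      exact hA0 (h' ▸ h.1)
  have hΦ : Measurable fun z : ((ℕ → E) × (ℕ → T)) × (ℕ → T) =>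
      A.indicator (fun _ => (1 : ℝ≥0∞)) z.1 * hQ.iterKernel N 0 (z.1.1, glue z.1.2 z.2) B :=
    ((measurable_const.indicator hA).comp measurable_fst).mul (hiB.comp measurable_glue_pair)
  have e₂ : ∫⁻ z, A.indicator (fun _ => 1) (d 0 z) * hQ.iterKernel N 0 z B ∂(m.map (hist 0)) =
      ∫⁻ z, A.indicator (fun _ => 1) z.1 * hQ.iterKernel N 0 (z.1.1, glue z.1.2 z.2) B
        ∂(m.map (fun ω => (pastPair ω, future ω.1 1))) := by
    have hΨ : Measurable fun z => A.indicator (fun _ => (1 : ℝ≥0∞)) (d 0 z) *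
        hQ.iterKernel N 0 z B := ((measurable_const.indicator hA).comp (hd 0)).mul hiB
    rw [lintegral_map hΨ h_0, lintegral_map hΦ (hpair.prodMk hfs)]
    refine lintegral_congr fun ω => ?_
    have := hdp 0 ω
    rw [Nat.cast_zero] at this
    rw [this]
    simp only [pastPair, glue_past_future, hist]
  rw [e₁, e₂, hm.map_pastPair_future h0 h1 hb hs h𝒟 hmeas hP, Measure.lintegral_compProd hΦ,
    Measure.compProd_apply_prod hA hB, ← lintegral_indicator hA]
  refine lintegral_congr fun p => ?_
  have hgp : Measurable fun z => (p.1, glue p.2 z) := measurable_glue_pair.comp measurable_prodMk_left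
  by_cases hp : p ∈ A
  · simp only [Set.indicator_of_mem hp, one_mul]
    rw [futureKernel, Kernel.comp_apply' _ _ _ hB, startKernel_apply, lintegral_map hiB hgp]
    rfl
  · simp [Set.indicator_of_notMem hp]

end IsResponseKernel

end FutureKernel

/-! ### The cost of the coupling along two paths, and its mean over independent pasts. -/

section CouplingCost

variable {T G : Type*} [NormedAddCommGroup G]

/-- Bound for the discrepancy of the response kernels at time `t` along two paths of the chain. -/
def covGap (e : ℕ → ℝ≥0) (g : T → G) (s s' : ℤ → T) (t : ℤ) : ℝ≥0∞ :=
  ∑' i : ℕ, e i * ‖g (s (t - i)) - g (s' (t - i))‖ₑ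

/-- Expected distance at time `j` of coupled responses and covariates along two paths of the
chain. -/
def pairCost (b : ℕ → ℝ) (e : ℕ → ℝ≥0) (g : T → G) (γ : G → G → ℝ) (j : ℕ) (s s' : ℤ → T) : ℝ≥0∞ :=
  ENNReal.ofReal (γ (g (s j)) (g (s' j))) + (ENNReal.ofReal (resetProb b j 0) +
    ∑ k ∈ Finset.range j, covGap e g s s' (k + 1) * ENNReal.ofReal (resetProb b (j - 1 - k) 0))

open Classical in
/-- `F` is a function of the responses and covariates at the times `N - i`, `i ∈ I`, that is
Lipschitz for the sum of the discrete distance of the responses and the distance `γ` of the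
covariates. -/
def IsLagLipschitz {E : Type*} (g : T → G) (γ : G → G → ℝ) (N : ℕ) (I : Finset ℕ)
    (F : (ℕ → E) × (ℤ → T) → ℝ) : Prop :=
  ∀ y y' s s', |F (y, s) - F (y', s')| ≤
    ∑ i ∈ I, ((if y i = y' i then 0 else 1) + γ (g (s (N - i))) (g (s' (N - i))))

variable {E : Type*} [MeasurableSpace E] [Fintype E] [Nonempty E] [MeasurableSpace T]
  {Q : ℤ → E → (ℕ → E) → (ℤ → T) → ℝ} {𝒟 : Set (ℤ → T)} {b : ℕ → ℝ}
  {g : T → G} {γ : G → G → ℝ} {e : ℕ → ℝ≥0}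

/-- The contraction is applied with initial agreement 0, so the bound holds for arbitrary past
responses. As every lag is below `N`, only symbols produced after time 0 are compared. -/
lemma IsResponseKernel.enorm_iterOp_sub_le (hQ : IsResponseKernel Q 𝒟 b) (h0 : ∀ m, 0 ≤ b m)
    (h1 : ∀ m, b m < 1) (hb : Antitone b)
    (hgap : ∀ s ∈ 𝒟, ∀ s' ∈ 𝒟, ∀ t y,
      ENNReal.ofReal (dTV (fun w => Q t w y s) (fun w => Q t w y s')) ≤ covGap e g s s' t)
    (hγ : ∀ x x', 0 ≤ γ x x') {N : ℕ} {I : Finset ℕ} (hI : ∀ i ∈ I, i < N)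
    {F : (ℕ → E) × (ℤ → T) → ℝ} (hF : IsLagLipschitz g γ N I F)
    {s s' : ℤ → T} (hs : s ∈ 𝒟) (hs' : s' ∈ 𝒟) (y y' : ℕ → E) :
    ‖iterOp Q N 0 F (y, s) - iterOp Q N 0 F (y', s')‖ₑ ≤
      ∑ i ∈ I, pairCost b e g γ (N - i) s s' := by
  classical
  have h1' : ∀ m, b m ≤ 1 := fun m => (h1 m).le
  -- `covGap` may be infinite; truncation at 1 loses nothing, since it bounds a total variation
  -- distance, and makes the gap real-valued.
  let ε : ℤ → ℝ := fun t => (min 1 (covGap e g s s' t)).toReal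
  have hfin : ∀ t, min 1 (covGap e g s s' t) ≠ ∞ := fun t =>
    ne_top_of_le_ne_top ENNReal.one_ne_top (min_le_left _ _)
  have hε : ∀ t, ENNReal.ofReal (ε t) ≤ covGap e g s s' t := fun t => by
    simp only [ε]
    rw [ENNReal.ofReal_toReal (hfin t)]
    exact min_le_right _ _
  have hε0 : ∀ t, 0 ≤ ε t := fun t => ENNReal.toReal_nonneg
  have hd : ∀ t y, dTV (fun w => Q t w y s) (fun w => Q t w y s') ≤ ε t := fun t y => by
    refine (ENNReal.ofReal_le_iff_le_toReal (hfin t)).1 (le_min ?_ (hgap s hs s' hs' t y))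
    rw [ENNReal.ofReal_le_one]
    exact dTV_le_one (fun w => hQ.nonneg t w y s) (fun w => hQ.nonneg t w y s')
      (hQ.sum_eq_one t y s) (hQ.sum_eq_one t y s')
  have key := hQ.abs_iterOp_sub_iterOp_le h0 h1' hb hε0 hd
    (C := ∑ i ∈ I, γ (g (s (N - i))) (g (s' (N - i)))) (I := I) (F := F) (fun y y' => by
      refine (hF y y' s s').trans_eq ?_
      rw [Finset.sum_add_distrib, add_comm]
      simp [lagCost]) N 0 0 y y' (by simp)
  rw [← Finset.sum_add_distrib] at key
  rw [Real.enorm_eq_ofReal_abs]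
  refine (ENNReal.ofReal_le_ofReal key).trans ?_
  rw [ENNReal.ofReal_sum_of_nonneg fun i hi => ?_]
  swap
  · simp only [lagCost, hI i hi, if_true]
    exact add_nonneg (hγ _ _) (mismatch_nonneg h0 h1' hε0 _ _ _)
  refine Finset.sum_le_sum fun i hi => ?_
  have hiN := hI i hi
  simp only [lagCost, hiN, if_true, pairCost]
  rw [Nat.cast_sub hiN.le]
  refine ENNReal.ofReal_add_le.trans (add_le_add le_rfl ?_)
  unfold mismatch
  refine ENNReal.ofReal_add_le.trans (add_le_add le_rfl ?_)
  rw [ENNReal.ofReal_sum_of_nonneg fun k _ =>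
    mul_nonneg (hε0 _) (resetProb_nonneg h0 h1' _ _)]
  refine Finset.sum_le_sum fun k _ => ?_
  rw [ENNReal.ofReal_mul (hε0 _), zero_add]
  gcongr
  exact hε _

variable [MeasurableSpace G] [BorelSpace G] [SecondCountableTopology G]

lemma measurable_covGap (hg : Measurable g) (t : ℤ) :
    Measurable fun p : (ℤ → T) × (ℤ → T) => covGap e g p.1 p.2 t := by
  refine Measurable.tsum fun i => ?_
  refine Measurable.const_mul (Measurable.enorm ?_) _
  exact (hg.comp ((measurable_pi_apply _).comp measurable_fst)).sub
    (hg.comp ((measurable_pi_apply _).comp measurable_snd))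

lemma measurable_pairCost (hg : Measurable g) (hγm : Measurable fun x : G × G => γ x.1 x.2)
    (j : ℕ) : Measurable fun p : (ℤ → T) × (ℤ → T) => pairCost b e g γ j p.1 p.2 := by
  refine Measurable.add ?_ (measurable_const.add
    (Finset.measurable_fun_sum _ fun k _ => (measurable_covGap hg _).mul_const _))
  exact (hγm.comp ((hg.comp ((measurable_pi_apply _).comp measurable_fst)).prodMk
    (hg.comp ((measurable_pi_apply _).comp measurable_snd)))).ennreal_ofReal

/-- The two paths obtained by gluing a pair of futures to a pair of pasts. -/
def gluePair {T : Type*} (z : ((ℕ → T) × (ℕ → T)) × ((ℕ → T) × (ℕ → T))) : (ℤ → T) × (ℤ → T) :=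
  (glue z.1.1 z.2.1, glue z.1.2 z.2.2)

lemma measurable_gluePair {T : Type*} [MeasurableSpace T] : Measurable (gluePair (T := T)) :=
  (measurable_glue.comp ((measurable_fst.comp measurable_fst).prodMk
    (measurable_fst.comp measurable_snd))).prodMk
  (measurable_glue.comp ((measurable_snd.comp measurable_fst).prodMk
    (measurable_snd.comp measurable_snd)))

lemma measurable_zero_pair {T : Type*} [MeasurableSpace T] :
    Measurable fun z : (ℕ → T) × (ℕ → T) => (z.1 0, z.2 0) :=
  ((measurable_pi_apply 0).comp measurable_fst).prodMk
    ((measurable_pi_apply 0).comp measurable_snd)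

/-- The law of two paths whose pasts are independent with law `ν`, and whose futures are coupled by
`P'`. -/
def couplingLaw {T : Type*} [MeasurableSpace T] (ν : Measure (ℕ → T))
    (P' : Kernel (T × T) ((ℕ → T) × (ℕ → T))) : Measure ((ℤ → T) × (ℤ → T)) :=
  ((ν.prod ν) ⊗ₘ (P'.comap (fun z : (ℕ → T) × (ℕ → T) => (z.1 0, z.2 0))
    measurable_zero_pair)).map gluePair

lemma lintegral_couplingLaw {T : Type*} [MeasurableSpace T] {ν : Measure (ℕ → T)} [SFinite ν]
    {P' : Kernel (T × T) ((ℕ → T) × (ℕ → T))} [IsMarkovKernel P']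
    {Φ : (ℤ → T) × (ℤ → T) → ℝ≥0∞} (hΦ : Measurable Φ) :
    ∫⁻ p, Φ p ∂(couplingLaw ν P') =
      ∫⁻ z, ∫⁻ z', ∫⁻ x, Φ (glue z x.1, glue z' x.2) ∂(P' (z 0, z' 0)) ∂ν ∂ν := by
  have hm : Measurable fun z => Φ (gluePair z) := hΦ.comp (measurable_gluePair (T := T))
  rw [couplingLaw, lintegral_map hΦ measurable_gluePair, Measure.lintegral_compProd hm,
    lintegral_prod _ (hm.lintegral_kernel_prod_right').aemeasurable]
  rfl

/-- The cost of a pair of pasts, the futures being coupled by `P'`. -/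
def pastCost (b : ℕ → ℝ) (e : ℕ → ℝ≥0) (g : T → G) (γ : G → G → ℝ)
    (P' : Kernel (T × T) ((ℕ → T) × (ℕ → T))) (j : ℕ) (z z' : ℕ → T) : ℝ≥0∞ :=
  ∫⁻ x, pairCost b e g γ j (glue z x.1) (glue z' x.2) ∂(P' (z 0, z' 0))

/-- The cost of a past against an independent one. -/
def meanCost (b : ℕ → ℝ) (e : ℕ → ℝ≥0) (g : T → G) (γ : G → G → ℝ)
    (P' : Kernel (T × T) ((ℕ → T) × (ℕ → T))) (ν : Measure (ℕ → T)) (j : ℕ) (z : ℕ → T) : ℝ≥0∞ :=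
  ∫⁻ z', pastCost b e g γ P' j z z' ∂ν

variable {P' : Kernel (T × T) ((ℕ → T) × (ℕ → T))} [IsMarkovKernel P']

lemma measurable_pastCost (hg : Measurable g) (hγm : Measurable fun x : G × G => γ x.1 x.2)
    (j : ℕ) : Measurable fun z : (ℕ → T) × (ℕ → T) => pastCost b e g γ P' j z.1 z.2 :=
  Measurable.lintegral_kernel_prod_right' (κ := P'.comap
    (fun z : (ℕ → T) × (ℕ → T) => (z.1 0, z.2 0)) measurable_zero_pair)
    ((measurable_pairCost (b := b) (e := e) hg hγm j).comp measurable_gluePair)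

lemma measurable_meanCost {ν : Measure (ℕ → T)} [SFinite ν] (hg : Measurable g)
    (hγm : Measurable fun x : G × G => γ x.1 x.2) (j : ℕ) :
    Measurable (meanCost b e g γ P' ν j) :=
  (measurable_pastCost hg hγm j).lintegral_prod_right'

/-- In the covariate gap at time k + 1, the lags i ≤ k point to positive times, where the coupling
acts, and the other lags to the independent pasts, where only the moment bound is available; this is
`kappa`. Then `resetProb_succ_le_bStar` turns the weights into `bStar`. -/
lemma lintegral_meanCost_le {ν : Measure (ℕ → T)} [IsProbabilityMeasure ν]
    (h1 : ∀ m, b m ≤ 1) (hb : Antitone b) (hg : Measurable g)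
    (hγm : Measurable fun x : G × G => γ x.1 x.2) {c : ℕ → ℝ≥0∞} {M : ℝ≥0∞}
    (hc₁ : ∀ j : ℕ, 1 ≤ j → ∫⁻ p, ENNReal.ofReal (γ (g (p.1 j)) (g (p.2 j)))
      ∂(couplingLaw ν P') ≤ c j)
    (hc₂ : ∀ j : ℕ, 1 ≤ j → ∫⁻ p, ‖g (p.1 j) - g (p.2 j)‖ₑ ∂(couplingLaw ν P') ≤ c j)
    (hM : ∀ t : ℤ, ∫⁻ p, ‖g (p.1 t) - g (p.2 t)‖ₑ ∂(couplingLaw ν P') ≤ 2 * M)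
    {j : ℕ} (hj : 1 ≤ j) :
    ∫⁻ z, meanCost b e g γ P' ν j z ∂ν ≤ rate b e c M j := by
  have hprob : IsProbabilityMeasure (couplingLaw ν P') :=
    Measure.isProbabilityMeasure_map measurable_gluePair.aemeasurable
  have e₀ : ∫⁻ z, meanCost b e g γ P' ν j z ∂ν =
      ∫⁻ p, pairCost b e g γ j p.1 p.2 ∂(couplingLaw ν P') :=
    (lintegral_couplingLaw (measurable_pairCost hg hγm j)).symm
  have hdiff : ∀ t : ℤ, Measurable fun p : (ℤ → T) × (ℤ → T) => ‖g (p.1 t) - g (p.2 t)‖ₑ :=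
    fun t => ((hg.comp ((measurable_pi_apply _).comp measurable_fst)).sub
      (hg.comp ((measurable_pi_apply _).comp measurable_snd))).enorm
  have hκ : ∀ k : ℕ, ∫⁻ p, covGap e g p.1 p.2 (k + 1) ∂(couplingLaw ν P') ≤ kappa e c M (k + 1) := by
    intro k
    unfold covGap kappa
    rw [lintegral_tsum fun i => ((hdiff _).const_mul _).aemeasurable]
    simp only [lintegral_const_mul _ (hdiff _)]
    rw [← Summable.sum_add_tsum_nat_add' (k := k + 1) ENNReal.summable, ← ENNReal.tsum_mul_left]
    refine add_le_add (Finset.sum_le_sum fun i hi => ?_) (ENNReal.tsum_le_tsum fun i => ?_)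
    · have : (k : ℤ) + 1 - i = ((k + 1 - i : ℕ) : ℤ) := by
        have := Finset.mem_range.1 hi
        omega
      rw [this]
      exact mul_le_mul_right (hc₂ _ (by have := Finset.mem_range.1 hi; omega)) _
    · calc _ ≤ (e (i + (k + 1)) : ℝ≥0∞) * (2 * M) := mul_le_mul_right (hM _) _
        _ = _ := by rw [add_comm i]; ring
  rw [e₀]
  unfold pairCost rate
  have mγ : Measurable fun p : (ℤ → T) × (ℤ → T) => ENNReal.ofReal (γ (g (p.1 j)) (g (p.2 j))) :=
    (hγm.comp ((hg.comp ((measurable_pi_apply _).comp measurable_fst)).prodMk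
    (hg.comp ((measurable_pi_apply _).comp measurable_snd)))).ennreal_ofReal
  rw [lintegral_add_left mγ, lintegral_add_left measurable_const, lintegral_const, measure_univ,
    mul_one, lintegral_finsetSum _ fun k _ => (measurable_covGap hg _).mul_const _]
  simp only [lintegral_mul_const _ (measurable_covGap hg _)]
  obtain ⟨n, rfl⟩ : ∃ n, j = n + 1 := ⟨j - 1, by omega⟩
  -- The last term has weight `resetProb b 0 0 = 1`: it is the isolated κ_j of the rate. The others,
  -- in reversed order, form the sum over b*_i.
  rw [Finset.sum_range_succ]
  simp only [Nat.add_sub_cancel, Nat.sub_self, resetProb, if_true, ENNReal.ofReal_one, mul_one]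
  have t₁ := hc₁ (n + 1) (by omega)
  have t₂ : ENNReal.ofReal (resetProb b (n + 1) 0) ≤ ENNReal.ofReal (bStar b n) :=
    ENNReal.ofReal_le_ofReal (resetProb_succ_le_bStar h1 hb n)
  have t₃ : ∑ k ∈ Finset.range n, (∫⁻ p, covGap e g p.1 p.2 (k + 1) ∂(couplingLaw ν P')) *
      ENNReal.ofReal (resetProb b (n - k) 0) ≤
      ∑ i ∈ Finset.range n, ENNReal.ofReal (bStar b i) * kappa e c M (n + 1 - i - 1) := by
    rw [← Finset.sum_range_reflect]
    refine Finset.sum_le_sum fun i hi => ?_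
    have hi' := Finset.mem_range.1 hi
    have h₁ := hκ (n - 1 - i)
    rw [show n - (n - 1 - i) = i + 1 by omega, mul_comm]
    rw [show n + 1 - i - 1 = n - 1 - i + 1 by omega]
    exact mul_le_mul' (ENNReal.ofReal_le_ofReal (resetProb_succ_le_bStar h1 hb i)) h₁
  calc _ ≤ c (n + 1) + (ENNReal.ofReal (bStar b n) +
        (∑ i ∈ Finset.range n, ENNReal.ofReal (bStar b i) * kappa e c M (n + 1 - i - 1) +
          kappa e c M (n + 1))) :=
        add_le_add t₁ (add_le_add t₂ (add_le_add t₃ (hκ n)))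
    _ = _ := by ring

end CouplingCost

/-! ### Conditional against unconditional laws, for the full past and for coarser σ-fields. -/

section ConditionalLaw

variable {E T G : Type*} [MeasurableSpace E] [Fintype E] [Nonempty E] [MeasurableSpace T]
  [NormedAddCommGroup G] [MeasurableSpace G] [BorelSpace G] [SecondCountableTopology G]
  {Q : ℤ → E → (ℕ → E) → (ℤ → T) → ℝ} {𝒟 : Set (ℤ → T)} {b : ℕ → ℝ}
  {g : T → G} {γ : G → G → ℝ} {e : ℕ → ℝ≥0}

namespace IsResponseKernel

/-- Both integrals depend on the futures only through the marginals of `P'`, so they can be taken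
over one coupled pair, where the pathwise bound applies. -/
lemma enorm_integral_futureKernel_sub_le (hQ : IsResponseKernel Q 𝒟 b)
    (h0 : ∀ m, 0 ≤ b m) (h1 : ∀ m, b m < 1) (hb : Antitone b)
    (hgap : ∀ s ∈ 𝒟, ∀ s' ∈ 𝒟, ∀ t y,
      ENNReal.ofReal (dTV (fun w => Q t w y s) (fun w => Q t w y s')) ≤ covGap e g s s' t)
    (hγ : ∀ x x', 0 ≤ γ x x') (hg : Measurable g)
    (hγm : Measurable fun x : G × G => γ x.1 x.2)
    {P : Kernel T (ℕ → T)} [IsMarkovKernel P] {P' : Kernel (T × T) ((ℕ → T) × (ℕ → T))}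
    [IsMarkovKernel P'] (hP' : IsCouplingKernel P P')
    {N : ℕ} {I : Finset ℕ} (hI : ∀ i ∈ I, i < N)
    {F : (ℕ → E) × (ℤ → T) → ℝ} {K : ℝ} (hFm : Measurable F) (hK : ∀ p, |F p| ≤ K)
    (hF : IsLagLipschitz g γ N I F) {p p' : (ℕ → E) × (ℕ → T)}
    (hp : ∀ᵐ z ∂(P (p.2 0)), glue p.2 z ∈ 𝒟) (hp' : ∀ᵐ z ∂(P (p'.2 0)), glue p'.2 z ∈ 𝒟) :
    ‖∫ z, F z ∂(hQ.futureKernel P N p) - ∫ z, F z ∂(hQ.futureKernel P N p')‖ₑ ≤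
      ∑ i ∈ I, pastCost b e g γ P' (N - i) p.2 p'.2 := by
  obtain ⟨hfst, hsnd⟩ := hP' (p.2 0) (p'.2 0)
  have hgl : ∀ p : (ℕ → E) × (ℕ → T), Measurable fun z => (p.1, glue p.2 z) := fun p =>
    measurable_glue_pair.comp measurable_prodMk_left
  have hT := hQ.measurable_iterOp N 0 hFm
  have hTK := hQ.abs_iterOp_le N 0 hK
  have m₁ : ∀ p : (ℕ → E) × (ℕ → T), Measurable fun z => iterOp Q N 0 F (p.1, glue p.2 z) :=
    fun p => hT.comp (hgl p)
  have i₁ : Integrable (fun z : (ℕ → T) × (ℕ → T) => iterOp Q N 0 F (p.1, glue p.2 z.1))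
      (P' (p.2 0, p'.2 0)) :=
    Integrable.of_bound ((m₁ p).comp measurable_fst).aestronglyMeasurable K
      (ae_of_all _ fun z => hTK _)
  have i₂ : Integrable (fun z : (ℕ → T) × (ℕ → T) => iterOp Q N 0 F (p'.1, glue p'.2 z.2))
      (P' (p.2 0, p'.2 0)) :=
    Integrable.of_bound ((m₁ p').comp measurable_snd).aestronglyMeasurable K
      (ae_of_all _ fun z => hTK _)
  rw [hQ.integral_futureKernel P N hFm hK, hQ.integral_futureKernel P N hFm hK, ← hfst, ← hsnd,
    integral_map measurable_fst.aemeasurable (m₁ p).aestronglyMeasurable,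
    integral_map measurable_snd.aemeasurable (m₁ p').aestronglyMeasurable, ← integral_sub i₁ i₂]
  refine (enorm_integral_le_lintegral_enorm _).trans ?_
  unfold pastCost
  have hgp : Measurable fun x : (ℕ → T) × (ℕ → T) => (glue p.2 x.1, glue p'.2 x.2) :=
    measurable_gluePair.comp (measurable_prodMk_left (x := (p.2, p'.2)))
  have hpc : ∀ j, Measurable fun x : (ℕ → T) × (ℕ → T) =>
      pairCost b e g γ j (glue p.2 x.1) (glue p'.2 x.2) := fun j =>
    ((measurable_pairCost (b := b) (e := e) hg hγm j).comp hgp :)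
  rw [← lintegral_finsetSum _ fun i _ => hpc _]
  rw [← hfst] at hp
  rw [← hsnd] at hp'
  refine lintegral_mono_ae ?_
  filter_upwards [ae_of_ae_map measurable_fst.aemeasurable hp,
    ae_of_ae_map measurable_snd.aemeasurable hp'] with z hz hz'
  exact hQ.enorm_iterOp_sub_le h0 h1 hb hgap hγ hI hF hz hz' _ _

variable [MeasurableSingletonClass E] [StandardBorelSpace T] {m : Measure ((ℤ → T) × (ℤ → E))}

/-- The unconditional law is the average of the conditional ones over an independent past. The
exceptional set concerns only whether glued paths lie in `𝒟`; it does not depend on `F`, so suprema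
over test functions can be taken afterwards. -/
lemma IsLaw.ae_enorm_integral_futureKernel_sub_le {hQ : IsResponseKernel Q 𝒟 b} (hm : hQ.IsLaw m)
    [IsProbabilityMeasure m] (h0 : ∀ m, 0 ≤ b m) (h1 : ∀ m, b m < 1) (hb : Antitone b)
    (hs : Summable b) (h𝒟 : ∀ᵐ ω ∂m, ω.1 ∈ 𝒟) (hmeas : MeasurableSet 𝒟)
    {P : Kernel T (ℕ → T)} [IsMarkovKernel P]
    (hP : m.map (fun ω => (past ω.1 0, future ω.1 1)) =
      (m.map (fun ω => past ω.1 0)) ⊗ₘ (P.comap (fun s : ℕ → T => s 0) (measurable_pi_apply 0)))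
    (hgap : ∀ s ∈ 𝒟, ∀ s' ∈ 𝒟, ∀ t y,
      ENNReal.ofReal (dTV (fun w => Q t w y s) (fun w => Q t w y s')) ≤ covGap e g s s' t)
    (hγ : ∀ x x', 0 ≤ γ x x') (hg : Measurable g)
    (hγm : Measurable fun x : G × G => γ x.1 x.2)
    {P' : Kernel (T × T) ((ℕ → T) × (ℕ → T))} [IsMarkovKernel P'] (hP' : IsCouplingKernel P P')
    {N : ℕ} {I : Finset ℕ} (hI : ∀ i ∈ I, i < N) :
    ∀ᵐ p ∂(m.map pastPair), ∀ (F : (ℕ → E) × (ℤ → T) → ℝ) (K : ℝ), Measurable F →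
      (∀ p, |F p| ≤ K) → IsLagLipschitz g γ N I F →
      ‖∫ z, F z ∂(hQ.futureKernel P N p) - ∫ ω, F (hist N ω) ∂m‖ₑ ≤
        ∑ i ∈ I, meanCost b e g γ P' (m.map fun ω => past ω.1 0) (N - i) p.2 := by
  have hpair := measurable_pastPair (E := E) (T := T)
  have hN := measurable_hist (E := E) (T := T) N
  have hps : Measurable fun ω : (ℤ → T) × (ℤ → E) => past ω.1 0 :=
    (measurable_past 0).comp measurable_fst
  have hfs : Measurable fun ω : (ℤ → T) × (ℤ → E) => future ω.1 1 :=
    (measurable_future 1).comp measurable_fst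
  have : IsProbabilityMeasure (m.map pastPair) :=
    Measure.isProbabilityMeasure_map hpair.aemeasurable
  have : IsProbabilityMeasure (m.map fun ω : (ℤ → T) × (ℤ → E) => past ω.1 0) :=
    Measure.isProbabilityMeasure_map hps.aemeasurable
  have hgood : ∀ᵐ p ∂(m.map pastPair), ∀ᵐ z ∂(P (p.2 0)), glue p.2 z ∈ 𝒟 := by
    have hset : Measurable fun z : ((ℕ → E) × (ℕ → T)) × (ℕ → T) => glue z.1.2 z.2 :=
      measurable_glue.comp ((measurable_snd.comp measurable_fst).prodMk measurable_snd)
    have h2 : ∀ᵐ z ∂(m.map fun ω => (pastPair ω, future ω.1 1)), glue z.1.2 z.2 ∈ 𝒟 := by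
      rw [ae_map_iff (hpair.prodMk hfs).aemeasurable (hset hmeas)]
      simpa only [pastPair, glue_past_future] using h𝒟
    rw [hm.map_pastPair_future h0 h1 hb hs h𝒟 hmeas hP] at h2
    have h3 := Measure.ae_ae_of_ae_compProd
      (p := fun z : ((ℕ → E) × (ℕ → T)) × (ℕ → T) => glue z.1.2 z.2 ∈ 𝒟) h2
    simpa only [Kernel.comap_apply] using h3
  have hlaw := hm.map_pastPair_hist h0 h1 hb hs h𝒟 hmeas hP N
  filter_upwards [hgood] with p hp F K hFm hK hF
  have hint : Integrable (fun p => ∫ z, F z ∂(hQ.futureKernel P N p)) (m.map pastPair) := by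
    refine Integrable.of_bound hFm.stronglyMeasurable.integral_kernel.aestronglyMeasurable K
      (ae_of_all _ fun p => ?_)
    have := norm_integral_le_of_norm_le_const (μ := hQ.futureKernel P N p) (f := F) (C := K)
      (ae_of_all _ hK)
    simpa using this
  have e₁ : ∫ ω, F (hist N ω) ∂m = ∫ p', ∫ z, F z ∂(hQ.futureKernel P N p') ∂(m.map pastPair) := by
    have hF2 : Measurable fun z : ((ℕ → E) × (ℕ → T)) × ((ℕ → E) × (ℤ → T)) => F z.2 :=
      hFm.comp measurable_snd
    have i2 : Integrable (fun z : ((ℕ → E) × (ℕ → T)) × ((ℕ → E) × (ℤ → T)) => F z.2)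
        ((m.map pastPair) ⊗ₘ (hQ.futureKernel P N)) :=
      Integrable.of_bound hF2.aestronglyMeasurable K (ae_of_all _ fun z => hK _)
    rw [← Measure.integral_compProd i2, ← hlaw,
      integral_map (hpair.prodMk hN).aemeasurable hF2.aestronglyMeasurable]
  have e₂ : ∫ z, F z ∂(hQ.futureKernel P N p) - ∫ ω, F (hist N ω) ∂m =
      ∫ p', (∫ z, F z ∂(hQ.futureKernel P N p) - ∫ z, F z ∂(hQ.futureKernel P N p'))
        ∂(m.map pastPair) := by
    rw [integral_sub (integrable_const _) hint, e₁]
    simp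
  rw [e₂]
  refine (enorm_integral_le_lintegral_enorm _).trans ?_
  have e₃ : ∑ i ∈ I, meanCost b e g γ P' (m.map fun ω => past ω.1 0) (N - i) p.2 =
      ∫⁻ p', ∑ i ∈ I, pastCost b e g γ P' (N - i) p.2 p'.2 ∂(m.map pastPair) := by
    have hc : ∀ j, Measurable fun z' => pastCost b e g γ P' j p.2 z' := fun j =>
      (measurable_pastCost hg hγm j).comp (measurable_const.prodMk measurable_id)
    have hc' : ∀ j, Measurable fun p' : (ℕ → E) × (ℕ → T) => pastCost b e g γ P' j p.2 p'.2 :=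
      fun j => (hc j).comp measurable_snd
    rw [lintegral_finsetSum _ fun i _ => hc' _]
    refine Finset.sum_congr rfl fun i _ => ?_
    rw [lintegral_map (hc' _) hpair, meanCost, lintegral_map (hc _) hps]
    rfl
  rw [e₃]
  refine lintegral_mono_ae ?_
  filter_upwards [hgood] with p' hp'
  exact hQ.enorm_integral_futureKernel_sub_le h0 h1 hb hgap hγ hg hγm hP' hI hFm hK hF hp hp'

variable [Nonempty T]

/-- The cost given a function of the past. -/
def condCost {𝒯 : Type*} [MeasurableSpace 𝒯] (b : ℕ → ℝ) (e : ℕ → ℝ≥0) (g : T → G)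
    (γ : G → G → ℝ) (P' : Kernel (T × T) ((ℕ → T) × (ℕ → T))) (m : Measure ((ℤ → T) × (ℤ → E)))
    [IsFiniteMeasure m] (ψ : (ℕ → E) × (ℕ → T) → 𝒯) (j : ℕ) (z : 𝒯) : ℝ≥0∞ :=
  ∫⁻ p, meanCost b e g γ P' (m.map fun ω => past ω.1 0) j p.2
    ∂(condDistrib pastPair (fun ω => ψ (pastPair ω)) m z)

lemma measurable_condCost {𝒯 : Type*} [MeasurableSpace 𝒯] [IsFiniteMeasure m] (hg : Measurable g)
    (hγm : Measurable fun x : G × G => γ x.1 x.2)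
    {P' : Kernel (T × T) ((ℕ → T) × (ℕ → T))} [IsMarkovKernel P']
    (ψ : (ℕ → E) × (ℕ → T) → 𝒯) (j : ℕ) : Measurable (condCost b e g γ P' m ψ j) :=
  ((measurable_meanCost hg hγm j).comp measurable_snd).lintegral_kernel

/-- Tower property: averaging removes the conditioning on `ψ`. -/
lemma lintegral_condCost {𝒯 : Type*} [MeasurableSpace 𝒯] [IsFiniteMeasure m] (hg : Measurable g)
    (hγm : Measurable fun x : G × G => γ x.1 x.2)
    {P' : Kernel (T × T) ((ℕ → T) × (ℕ → T))} [IsMarkovKernel P']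
    {ψ : (ℕ → E) × (ℕ → T) → 𝒯} (hψ : Measurable ψ) (j : ℕ) :
    ∫⁻ z, condCost b e g γ P' m ψ j z ∂(m.map fun ω => ψ (pastPair ω)) =
      ∫⁻ z, meanCost b e g γ P' (m.map fun ω => past ω.1 0) j z ∂(m.map fun ω => past ω.1 0) := by
  have hpair := measurable_pastPair (E := E) (T := T)
  have hps : Measurable fun ω : (ℤ → T) × (ℤ → E) => past ω.1 0 :=
    (measurable_past 0).comp measurable_fst
  have hc := measurable_meanCost (b := b) (e := e) (g := g) (γ := γ) (P' := P')
    (ν := m.map fun ω : (ℤ → T) × (ℤ → E) => past ω.1 0) hg hγm j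
  have hc2 : Measurable fun x : 𝒯 × ((ℕ → E) × (ℕ → T)) =>
      meanCost b e g γ P' (m.map fun ω => past ω.1 0) j x.2.2 :=
    hc.comp (measurable_snd.comp measurable_snd)
  have hψp : Measurable fun ω : (ℤ → T) × (ℤ → E) => ψ (pastPair ω) := hψ.comp hpair
  unfold condCost
  rw [← Measure.lintegral_compProd hc2, compProd_map_condDistrib hpair.aemeasurable,
    lintegral_map hc2 (hψp.prodMk hpair), lintegral_map hc hps]
  rfl

/-- Passage to the σ-field generated by a function `ψ` of the pasts, such as the past of (Y, X). The
conditional law given `ψ` is a mixture of the laws `futureKernel`, and the bound is averaged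
accordingly. -/
lemma IsLaw.ae_enorm_integral_sub_le {hQ : IsResponseKernel Q 𝒟 b} (hm : hQ.IsLaw m)
    [IsProbabilityMeasure m] (h0 : ∀ m, 0 ≤ b m) (h1 : ∀ m, b m < 1) (hb : Antitone b)
    (hs : Summable b) (h𝒟 : ∀ᵐ ω ∂m, ω.1 ∈ 𝒟) (hmeas : MeasurableSet 𝒟)
    {P : Kernel T (ℕ → T)} [IsMarkovKernel P]
    (hP : m.map (fun ω => (past ω.1 0, future ω.1 1)) =
      (m.map (fun ω => past ω.1 0)) ⊗ₘ (P.comap (fun s : ℕ → T => s 0) (measurable_pi_apply 0)))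
    (hgap : ∀ s ∈ 𝒟, ∀ s' ∈ 𝒟, ∀ t y,
      ENNReal.ofReal (dTV (fun w => Q t w y s) (fun w => Q t w y s')) ≤ covGap e g s s' t)
    (hγ : ∀ x x', 0 ≤ γ x x') (hg : Measurable g)
    (hγm : Measurable fun x : G × G => γ x.1 x.2)
    {P' : Kernel (T × T) ((ℕ → T) × (ℕ → T))} [IsMarkovKernel P'] (hP' : IsCouplingKernel P P')
    {N : ℕ} {I : Finset ℕ} (hI : ∀ i ∈ I, i < N)
    {𝒯 𝒰 : Type*} [MeasurableSpace 𝒯] [MeasurableSpace 𝒰] [MeasurableSpace.CountablyGenerated 𝒰]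
    {ψ : (ℕ → E) × (ℕ → T) → 𝒯} (hψ : Measurable ψ)
    {χ : (ℕ → E) × (ℤ → T) → 𝒰} (hχ : Measurable χ)
    {κ : Kernel 𝒯 𝒰} [IsMarkovKernel κ]
    (hκ : m.map (fun ω => (ψ (pastPair ω), χ (hist N ω))) =
      (m.map fun ω => ψ (pastPair ω)) ⊗ₘ κ) :
    ∀ᵐ z ∂(m.map fun ω => ψ (pastPair ω)), ∀ (f : 𝒰 → ℝ) (K : ℝ), Measurable f →
      (∀ u, |f u| ≤ K) → IsLagLipschitz g γ N I (fun p : (ℕ → E) × (ℤ → T) => f (χ p)) →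
      ‖∫ u, f u ∂(κ z) - ∫ ω, f (χ (hist N ω)) ∂m‖ₑ ≤
        ∑ i ∈ I, condCost b e g γ P' m ψ (N - i) z := by
  have hpair := measurable_pastPair (E := E) (T := T)
  have hN := measurable_hist (E := E) (T := T) N
  have hψp : Measurable fun ω : (ℤ → T) × (ℤ → E) => ψ (pastPair ω) := hψ.comp hpair
  have hχN : Measurable fun ω : (ℤ → T) × (ℤ → E) => χ (hist N ω) := hχ.comp hN
  have : IsProbabilityMeasure (m.map pastPair) :=
    Measure.isProbabilityMeasure_map hpair.aemeasurable
  have : IsProbabilityMeasure (m.map fun ω => ψ (pastPair ω)) :=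
    Measure.isProbabilityMeasure_map hψp.aemeasurable
  let lam := condDistrib pastPair (fun ω => ψ (pastPair ω)) m
  have hlam : (m.map fun ω => ψ (pastPair ω)) ⊗ₘ lam = m.map fun ω => (ψ (pastPair ω), pastPair ω) :=
    compProd_map_condDistrib hpair.aemeasurable
  let R := (hQ.futureKernel P N).map χ
  have : IsMarkovKernel R := Kernel.IsMarkovKernel.map _ hχ
  have hlaw := hm.map_pastPair_hist h0 h1 hb hs h𝒟 hmeas hP N
  -- Both kernels disintegrate the same joint law, and on a countably generated space such a kernel
  -- is almost everywhere unique.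
  have hκeq : κ =ᵐ[m.map fun ω => ψ (pastPair ω)] (R ∘ₖ lam) := by
    refine Kernel.ae_eq_of_compProd_eq ?_
    rw [← hκ]
    have : IsProbabilityMeasure (m.map fun ω => (ψ (pastPair ω), χ (hist N ω))) :=
      Measure.isProbabilityMeasure_map (hψp.prodMk hχN).aemeasurable
    refine Measure.ext_prod fun {A B} hA hB => ?_
    have hRB : Measurable fun p => hQ.futureKernel P N p (χ ⁻¹' B) :=
      Kernel.measurable_coe _ (hχ hB)
    have hΦ : Measurable fun x : 𝒯 × ((ℕ → E) × (ℕ → T)) =>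
        A.indicator (fun _ => (1 : ℝ≥0∞)) x.1 * hQ.futureKernel P N x.2 (χ ⁻¹' B) :=
      ((measurable_const.indicator hA).comp measurable_fst).mul (hRB.comp measurable_snd)
    have e₁ : ((m.map fun ω => ψ (pastPair ω)) ⊗ₘ (R ∘ₖ lam)) (A ×ˢ B) =
        ∫⁻ x, A.indicator (fun _ => (1 : ℝ≥0∞)) x.1 * hQ.futureKernel P N x.2 (χ ⁻¹' B)
          ∂((m.map fun ω => ψ (pastPair ω)) ⊗ₘ lam) := by
      rw [Measure.compProd_apply_prod hA hB, Measure.lintegral_compProd hΦ, ← lintegral_indicator hA]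
      refine lintegral_congr fun z => ?_
      by_cases hz : z ∈ A
      · simp only [Set.indicator_of_mem hz, one_mul]
        rw [Kernel.comp_apply' _ _ _ hB]
        refine lintegral_congr fun p => ?_
        rw [Kernel.map_apply' _ hχ _ hB]
      · simp [Set.indicator_of_notMem hz]
    have hset : (fun ω : (ℤ → T) × (ℤ → E) => (ψ (pastPair ω), χ (hist N ω))) ⁻¹' (A ×ˢ B) =
        (fun ω => (pastPair ω, hist N ω)) ⁻¹' ((ψ ⁻¹' A) ×ˢ (χ ⁻¹' B)) := rfl
    rw [e₁, hlam, lintegral_map hΦ (hψp.prodMk hpair),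
      Measure.map_apply (hψp.prodMk hχN) (hA.prod hB), hset,
      ← Measure.map_apply (hpair.prodMk hN) ((hψ hA).prod (hχ hB)), hlaw,
      Measure.compProd_apply_prod (hψ hA) (hχ hB), ← lintegral_indicator (hψ hA),
      lintegral_map (hRB.indicator (hψ hA)) hpair]
    refine lintegral_congr fun ω => ?_
    by_cases hω : ψ (pastPair ω) ∈ A
    · rw [Set.indicator_of_mem (show pastPair ω ∈ ψ ⁻¹' A from hω), Set.indicator_of_mem hω, one_mul]
    · rw [Set.indicator_of_notMem (show pastPair ω ∉ ψ ⁻¹' A from hω),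
        Set.indicator_of_notMem hω, zero_mul]
  have hbd := hm.ae_enorm_integral_futureKernel_sub_le h0 h1 hb hs h𝒟 hmeas hP hgap hγ hg hγm hP' hI
  have hbd2 : ∀ᵐ z ∂(m.map fun ω => ψ (pastPair ω)), ∀ᵐ p ∂(lam z),
      ∀ (F : (ℕ → E) × (ℤ → T) → ℝ) (K : ℝ), Measurable F →
      (∀ p, |F p| ≤ K) → IsLagLipschitz g γ N I F →
      ‖∫ z, F z ∂(hQ.futureKernel P N p) - ∫ ω, F (hist N ω) ∂m‖ₑ ≤
        ∑ i ∈ I, meanCost b e g γ P' (m.map fun ω => past ω.1 0) (N - i) p.2 := by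
    refine Measure.ae_ae_of_ae_compProd (p := fun x : 𝒯 × ((ℕ → E) × (ℕ → T)) =>
      ∀ (F : (ℕ → E) × (ℤ → T) → ℝ) (K : ℝ), Measurable F →
      (∀ p, |F p| ≤ K) → IsLagLipschitz g γ N I F →
      ‖∫ z, F z ∂(hQ.futureKernel P N x.2) - ∫ ω, F (hist N ω) ∂m‖ₑ ≤
        ∑ i ∈ I, meanCost b e g γ P' (m.map fun ω => past ω.1 0) (N - i) x.2.2) ?_
    have hbd3 : ∀ᵐ p ∂(((m.map fun ω => ψ (pastPair ω)) ⊗ₘ lam).map Prod.snd),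
        ∀ (F : (ℕ → E) × (ℤ → T) → ℝ) (K : ℝ), Measurable F →
        (∀ p, |F p| ≤ K) → IsLagLipschitz g γ N I F →
        ‖∫ z, F z ∂(hQ.futureKernel P N p) - ∫ ω, F (hist N ω) ∂m‖ₑ ≤
          ∑ i ∈ I, meanCost b e g γ P' (m.map fun ω => past ω.1 0) (N - i) p.2 := by
      rw [hlam, Measure.map_map measurable_snd (hψp.prodMk hpair)]
      exact hbd
    exact ae_of_ae_map measurable_snd.aemeasurable hbd3
  filter_upwards [hκeq, hbd2] with z hz hz2 f K hf hK hF
  have hfK : Integrable f ((R ∘ₖ lam) z) :=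
    Integrable.of_bound hf.aestronglyMeasurable K (ae_of_all _ hK)
  have hFm : Measurable fun p : (ℕ → E) × (ℤ → T) => f (χ p) := hf.comp hχ
  have eR : ∀ p, ∫ u, f u ∂(R p) = ∫ x, f (χ x) ∂(hQ.futureKernel P N p) := fun p => by
    rw [Kernel.map_apply _ hχ, integral_map hχ.aemeasurable hf.aestronglyMeasurable]
  have hint : Integrable (fun p => ∫ x, f (χ x) ∂(hQ.futureKernel P N p)) (lam z) := by
    refine Integrable.of_bound hFm.stronglyMeasurable.integral_kernel.aestronglyMeasurable K
      (ae_of_all _ fun p => ?_)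
    have := norm_integral_le_of_norm_le_const (μ := hQ.futureKernel P N p)
      (f := fun x => f (χ x)) (C := K) (ae_of_all _ fun x => hK (χ x))
    simpa using this
  have e₁ : ∫ u, f u ∂(κ z) - ∫ ω, f (χ (hist N ω)) ∂m =
      ∫ p, (∫ x, f (χ x) ∂(hQ.futureKernel P N p) - ∫ ω, f (χ (hist N ω)) ∂m) ∂(lam z) := by
    rw [hz, Kernel.integral_comp hfK, integral_sub hint (integrable_const _)]
    simp [eR]
  rw [e₁]
  refine (enorm_integral_le_lintegral_enorm _).trans ?_
  unfold condCost
  have : IsProbabilityMeasure (m.map fun ω : (ℤ → T) × (ℤ → E) => past ω.1 0) :=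
    Measure.isProbabilityMeasure_map ((measurable_past 0).comp measurable_fst).aemeasurable
  have hmc : ∀ j, Measurable fun p : (ℕ → E) × (ℕ → T) =>
      meanCost b e g γ P' (m.map fun ω => past ω.1 0) j p.2 := fun j =>
    (measurable_meanCost hg hγm j).comp measurable_snd
  rw [← lintegral_finsetSum _ fun i _ => hmc _]
  refine lintegral_mono_ae ?_
  filter_upwards [hz2] with p hp
  exact hp (fun p => f (χ p)) K hFm (fun p => hK _) hF

end IsResponseKernel

end ConditionalLaw

/-! ### The standing assumptions of the coupling argument, bundled. -/

section CoupledModel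

/-- A response model along a Markov chain with path kernel `P`, and a coupling `P'` of the chain
that brings the covariates within mean distance `c j` of each other at time `j`. -/
structure IsCoupledModel {E T G : Type*} [MeasurableSpace E] [Fintype E] [MeasurableSpace T]
    [NormedAddCommGroup G] [MeasurableSpace G] (Q : ℤ → E → (ℕ → E) → (ℤ → T) → ℝ)
    (𝒟 : Set (ℤ → T)) (b : ℕ → ℝ) (e : ℕ → ℝ≥0) (g : T → G) (γ : G → G → ℝ)
    (P : Kernel T (ℕ → T)) (P' : Kernel (T × T) ((ℕ → T) × (ℕ → T)))
    (m : Measure ((ℤ → T) × (ℤ → E))) (c : ℕ → ℝ≥0∞) (M : ℝ≥0∞) : Prop where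
  kernel : IsResponseKernel Q 𝒟 b
  law : kernel.IsLaw m
  b_nonneg : ∀ i, 0 ≤ b i
  b_lt_one : ∀ i, b i < 1
  b_antitone : Antitone b
  b_summable : Summable b
  ae_mem : ∀ᵐ ω ∂m, ω.1 ∈ 𝒟
  measurableSet : MeasurableSet 𝒟
  path_kernel : m.map (fun ω => (past ω.1 0, future ω.1 1)) =
    (m.map (fun ω => past ω.1 0)) ⊗ₘ (P.comap (fun s : ℕ → T => s 0) (measurable_pi_apply 0))
  gap : ∀ s ∈ 𝒟, ∀ s' ∈ 𝒟, ∀ t y,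
    ENNReal.ofReal (dTV (fun w => Q t w y s) (fun w => Q t w y s')) ≤ covGap e g s s' t
  γ_nonneg : ∀ x x', 0 ≤ γ x x'
  g_measurable : Measurable g
  γ_measurable : Measurable fun x : G × G => γ x.1 x.2
  coupling : IsCouplingKernel P P'
  γ_le : ∀ j : ℕ, 1 ≤ j → ∫⁻ p, ENNReal.ofReal (γ (g (p.1 j)) (g (p.2 j)))
    ∂(couplingLaw (m.map fun ω => past ω.1 0) P') ≤ c j
  norm_le : ∀ j : ℕ, 1 ≤ j → ∫⁻ p, ‖g (p.1 j) - g (p.2 j)‖ₑ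
    ∂(couplingLaw (m.map fun ω => past ω.1 0) P') ≤ c j
  norm_le_moment : ∀ t : ℤ, ∫⁻ p, ‖g (p.1 t) - g (p.2 t)‖ₑ
    ∂(couplingLaw (m.map fun ω => past ω.1 0) P') ≤ 2 * M

namespace IsCoupledModel

variable {E T G : Type*} [MeasurableSpace E] [Fintype E] [Nonempty E] [MeasurableSingletonClass E]
  [MeasurableSpace T] [StandardBorelSpace T] [Nonempty T]
  [NormedAddCommGroup G] [MeasurableSpace G] [BorelSpace G] [SecondCountableTopology G]
  {Q : ℤ → E → (ℕ → E) → (ℤ → T) → ℝ} {𝒟 : Set (ℤ → T)} {b : ℕ → ℝ}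
  {g : T → G} {γ : G → G → ℝ} {e : ℕ → ℝ≥0} {P : Kernel T (ℕ → T)}
  {P' : Kernel (T × T) ((ℕ → T) × (ℕ → T))} [IsMarkovKernel P']
  {m : Measure ((ℤ → T) × (ℤ → E))} [IsProbabilityMeasure m] {c : ℕ → ℝ≥0∞} {M : ℝ≥0∞}

lemma lintegral_condCost_le (h : IsCoupledModel Q 𝒟 b e g γ P P' m c M)
    {𝒯 : Type*} [MeasurableSpace 𝒯] {ψ : (ℕ → E) × (ℕ → T) → 𝒯} (hψ : Measurable ψ) {j : ℕ}
    (hj : 1 ≤ j) :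
    ∫⁻ z, IsResponseKernel.condCost b e g γ P' m ψ j z ∂(m.map fun ω => ψ (pastPair ω)) ≤
      rate b e c M j := by
  have : IsProbabilityMeasure (m.map fun ω : (ℤ → T) × (ℤ → E) => past ω.1 0) :=
    Measure.isProbabilityMeasure_map ((measurable_past 0).comp measurable_fst).aemeasurable
  rw [IsResponseKernel.lintegral_condCost h.g_measurable h.γ_measurable hψ]
  exact lintegral_meanCost_le (fun i => (h.b_lt_one i).le) h.b_antitone h.g_measurable
    h.γ_measurable h.γ_le h.norm_le h.norm_le_moment hj

lemma ae_enorm_integral_sub_le [IsMarkovKernel P] (h : IsCoupledModel Q 𝒟 b e g γ P P' m c M)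
    {N : ℕ} {I : Finset ℕ} (hI : ∀ i ∈ I, i < N)
    {𝒯 𝒰 : Type*} [MeasurableSpace 𝒯] [MeasurableSpace 𝒰] [MeasurableSpace.CountablyGenerated 𝒰]
    {ψ : (ℕ → E) × (ℕ → T) → 𝒯} (hψ : Measurable ψ)
    {χ : (ℕ → E) × (ℤ → T) → 𝒰} (hχ : Measurable χ)
    {κ : Kernel 𝒯 𝒰} [IsMarkovKernel κ]
    (hκ : m.map (fun ω => (ψ (pastPair ω), χ (hist N ω))) =
      (m.map fun ω => ψ (pastPair ω)) ⊗ₘ κ) :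
    ∀ᵐ z ∂(m.map fun ω => ψ (pastPair ω)), ∀ (f : 𝒰 → ℝ) (K : ℝ), Measurable f →
      (∀ u, |f u| ≤ K) → IsLagLipschitz g γ N I (fun p : (ℕ → E) × (ℤ → T) => f (χ p)) →
      ‖∫ u, f u ∂(κ z) - ∫ ω, f (χ (hist N ω)) ∂m‖ₑ ≤
        ∑ i ∈ I, IsResponseKernel.condCost b e g γ P' m ψ (N - i) z :=
  h.law.ae_enorm_integral_sub_le h.b_nonneg h.b_lt_one h.b_antitone h.b_summable h.ae_mem
    h.measurableSet h.path_kernel h.gap h.γ_nonneg h.g_measurable h.γ_measurable h.coupling hI hψ hχ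
    hκ

end IsCoupledModel

end CoupledModel

/-! ### The bound on the τ coefficients. -/

section Tau

variable {E G : Type*} [MeasurableSpace E] [Fintype E] [MeasurableSingletonClass E]
  [NormedAddCommGroup G] [MeasurableSpace G] [BorelSpace G] [SecondCountableTopology G]

/-- The test functions in `wasserstein` are not assumed measurable. For fixed responses they are
Lipschitz, hence continuous, in the covariates, and there are finitely many values of the responses.
-/
lemma measurable_of_gammaBar_lipschitz {ℓ : ℕ} {f : (Fin ℓ → E × G) → ℝ}
    (hf : ∀ w w', |f w - f w'| ≤ ∑ i, gammaBar (w i) (w' i)) : Measurable f := by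
  let F : (Fin ℓ → G) × (Fin ℓ → E) → ℝ := fun p => f fun i => (p.2 i, p.1 i)
  have hF : Measurable F := by
    refine measurable_from_prod_countable_left fun y => ?_
    have : LipschitzWith ℓ fun x : Fin ℓ → G => F (x, y) := by
      refine LipschitzWith.of_dist_le_mul fun x x' => ?_
      rw [Real.dist_eq]
      refine (hf _ _).trans ?_
      calc ∑ i, gammaBar ((y i, x i) : E × G) (y i, x' i) = ∑ i, dist (x i) (x' i) := by
            refine Finset.sum_congr rfl fun i _ => ?_
            simp [gammaBar, dist_eq_norm, norm_sub_rev]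
        _ ≤ ∑ i : Fin ℓ, dist x x' := Finset.sum_le_sum fun i _ => dist_le_pi_dist x x' i
        _ = _ := by simp
    exact this.continuous.measurable
  have hp : Measurable fun v : Fin ℓ → E × G =>
      ((fun i => (v i).2 : Fin ℓ → G), (fun i => (v i).1 : Fin ℓ → E)) :=
    (measurable_pi_lambda _ fun i => measurable_snd.comp (measurable_pi_apply i)).prodMk
      (measurable_pi_lambda _ fun i => measurable_fst.comp (measurable_pi_apply i))
  exact hF.comp hp

lemma abs_clip_sub_clip_le (K x y : ℝ) :
    |max (-K) (min x K) - max (-K) (min y K)| ≤ |x - y| :=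
  (abs_max_sub_max_le_abs _ _ _).trans (abs_min_sub_min_le_max' x y K)
where
  abs_max_sub_max_le_abs (a x y : ℝ) : |max a x - max a y| ≤ |x - y| := by
    rw [max_comm a, max_comm a]
    exact _root_.abs_max_sub_max_le_abs x y a
  abs_min_sub_min_le_max' (x y K : ℝ) : |min x K - min y K| ≤ |x - y| := by
    simpa using _root_.abs_min_sub_min_le_max x K y K

/-- It suffices to bound the Wasserstein distance along bounded functions. -/
lemma wasserstein_le_of_bounded {ℓ : ℕ} {ν₁ ν₂ : Measure (Fin ℓ → E × G)} {B : ℝ≥0∞}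
    (h : ∀ (f : (Fin ℓ → E × G) → ℝ) (K : ℝ), Measurable f → (∀ u, |f u| ≤ K) →
      (∀ w w', |f w - f w'| ≤ ∑ i, gammaBar (w i) (w' i)) →
      ‖∫ u, f u ∂ν₁ - ∫ u, f u ∂ν₂‖ₑ ≤ B) :
    wasserstein ν₁ ν₂ ≤ B := by
  refine iSup_le fun f => iSup_le fun hf => iSup_le fun h₁ => iSup_le fun h₂ => ?_
  have hfm := measurable_of_gammaBar_lipschitz hf
  -- Clipping preserves the Lipschitz constant, and dominated convergence removes it.
  let F : ℕ → (Fin ℓ → E × G) → ℝ := fun K u => max (-(K : ℝ)) (min (f u) K)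
  have hFm : ∀ K, Measurable (F K) := fun K =>
    measurable_const.max (hfm.min measurable_const)
  have hFK : ∀ K u, |F K u| ≤ K := fun K u => by
    have : (0 : ℝ) ≤ K := Nat.cast_nonneg K
    refine abs_le.2 ⟨le_max_left _ _, max_le (by linarith) (min_le_right _ _)⟩
  have hFf : ∀ K u, |F K u| ≤ |f u| := fun K u => by
    have : (0 : ℝ) ≤ K := Nat.cast_nonneg K
    have := abs_clip_sub_clip_le K (f u) 0
    simpa [F, this, min_eq_left, max_eq_right] using this
  have hFlim : ∀ u, Tendsto (fun K => F K u) atTop (𝓝 (f u)) := fun u => by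
    refine tendsto_const_nhds.congr' ?_
    obtain ⟨K₀, hK₀⟩ := exists_nat_ge |f u|
    filter_upwards [eventually_ge_atTop K₀] with K hK
    have hK' : |f u| ≤ K := hK₀.trans (Nat.cast_le.2 hK)
    have := abs_le.1 hK'
    simp only [F]
    rw [min_eq_left this.2, max_eq_right this.1]
  have lim : ∀ {ν : Measure (Fin ℓ → E × G)}, Integrable f ν →
      Tendsto (fun K => ∫ u, F K u ∂ν) atTop (𝓝 (∫ u, f u ∂ν)) := fun {ν} hν =>
    tendsto_integral_of_dominated_convergence (fun u => |f u|)
      (fun K => (hFm K).aestronglyMeasurable) hν.abs (fun K => ae_of_all _ (hFf K))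
      (ae_of_all _ hFlim)
  have hl := ENNReal.tendsto_ofReal ((lim h₁).sub (lim h₂))
  refine le_of_tendsto' hl fun K => ?_
  refine le_trans ?_ (h (F K) K (hFm K) (hFK K) fun w w' =>
    (abs_clip_sub_clip_le _ _ _).trans (hf w w'))
  rw [Real.enorm_eq_ofReal_abs]
  exact ENNReal.ofReal_le_ofReal (le_abs_self _)

variable [Nonempty E] [StandardBorelSpace G]
  {T : Type*} [MeasurableSpace T] [StandardBorelSpace T] [Nonempty T]
  {Q : ℤ → E → (ℕ → E) → (ℤ → T) → ℝ} {𝒟 : Set (ℤ → T)} {b : ℕ → ℝ}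
  {g : T → G} {e : ℕ → ℝ≥0} {P : Kernel T (ℕ → T)} [IsMarkovKernel P]
  {P' : Kernel (T × T) ((ℕ → T) × (ℕ → T))} [IsMarkovKernel P']
  {m : Measure ((ℤ → T) × (ℤ → E))} [IsProbabilityMeasure m] {c : ℕ → ℝ≥0∞} {M : ℝ≥0∞}

/-- Only the joint law of (Z, X, Y) matters, so the conditional law is computed in the model `m`.
With `N` the largest of the times, time j_i is lag N - j_i of the history at `N`; distinct times
give distinct lags, and each contributes its own cost. -/
lemma IsCoupledModel.tauDep_le
    (h : IsCoupledModel Q 𝒟 b e g (fun x x' => ‖x' - x‖) P P' m c M)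
    {Ω 𝒯 : Type*} [MeasurableSpace Ω] [MeasurableSpace 𝒯] {μ : Measure Ω} [IsProbabilityMeasure μ]
    {X : ℤ → Ω → G} (hX : ∀ t, Measurable (X t)) {Y : ℤ → Ω → E} (hY : ∀ t, Measurable (Y t))
    {Z : Ω → 𝒯} (hZ : Measurable Z) {ψ : (ℕ → E) × (ℕ → T) → 𝒯} (hψ : Measurable ψ)
    (hlaw : μ.map (fun ω => (Z ω, path X ω, path Y ω)) =
      m.map (fun ω => (ψ (pastPair ω), (fun t => g (ω.1 t)), ω.2)))
    {ℓ : ℕ} {j : Fin ℓ → ℤ} (hj : StrictMono j) (hj1 : ∀ i, 1 ≤ j i) :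
    tauDep μ Z (fun ω i => (Y (j i) ω, X (j i) ω)) ≤ ∑ i, rate b e c M (j i).toNat := by
  classical
  have hg := h.g_measurable
  let k : Fin ℓ → ℕ := fun i => (j i).toNat
  have hk : ∀ i, (k i : ℤ) = j i := fun i => Int.toNat_of_nonneg (by linarith [hj1 i])
  have hk1 : ∀ i, 1 ≤ k i := fun i => by have := hk i; have := hj1 i; omega
  let N : ℕ := Finset.univ.sup k
  have hkN : ∀ i, k i ≤ N := fun i => Finset.le_sup (Finset.mem_univ i)
  let I : Finset ℕ := Finset.univ.image fun i => N - k i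
  have hinj : Function.Injective fun i => N - k i := by
    intro i i' hii
    have h1 := hkN i
    have h2 := hkN i'
    have h3 : k i = k i' := by simp only at hii; omega
    exact hj.injective (by rw [← hk, ← hk, h3])
  have hI : ∀ i ∈ I, i < N := by
    intro i hi
    obtain ⟨i', -, rfl⟩ := Finset.mem_image.1 hi
    have := hk1 i'
    have := hkN i'
    omega
  have hsum : ∀ {A : Type _} [AddCommMonoid A] (φ : ℕ → A),
      ∑ i ∈ I, φ i = ∑ i, φ (N - k i) := fun φ =>
    Finset.sum_image fun i _ i' _ hii => hinj hii
  let χ : (ℕ → E) × (ℤ → T) → (Fin ℓ → E × G) := fun p i => (p.1 (N - k i), g (p.2 (j i)))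
  have hχ : Measurable χ := measurable_pi_lambda _ fun i =>
    ((measurable_pi_apply _).comp measurable_fst).prodMk
      (hg.comp ((measurable_pi_apply _).comp measurable_snd))
  let U : Ω → (Fin ℓ → E × G) := fun ω i => (Y (j i) ω, X (j i) ω)
  have hU : Measurable U := measurable_pi_lambda _ fun i => (hY _).prodMk (hX _)
  let u : (ℤ → G) × (ℤ → E) → (Fin ℓ → E × G) := fun p i => (p.2 (j i), p.1 (j i))
  have hu : Measurable u := measurable_pi_lambda _ fun i =>
    ((measurable_pi_apply _).comp measurable_snd).prodMk
      ((measurable_pi_apply _).comp measurable_fst)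
  have hgω : Measurable fun ω : (ℤ → T) × (ℤ → E) => (fun t => g (ω.1 t) : ℤ → G) :=
    measurable_pi_lambda _ fun t => hg.comp ((measurable_pi_apply t).comp measurable_fst)
  have hpair := measurable_pastPair (E := E) (T := T)
  have hψp : Measurable fun ω : (ℤ → T) × (ℤ → E) => ψ (pastPair ω) := hψ.comp hpair
  have hXY : Measurable fun ω => (Z ω, path X ω, path Y ω) :=
    hZ.prodMk ((measurable_path hX).prodMk (measurable_path hY))
  have hm3 : Measurable fun ω : (ℤ → T) × (ℤ → E) =>
      (ψ (pastPair ω), (fun t => g (ω.1 t) : ℤ → G), ω.2) :=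
    hψp.prodMk (hgω.prodMk measurable_snd)
  have hχu : ∀ ω : (ℤ → T) × (ℤ → E), χ (hist N ω) = u ((fun t => g (ω.1 t)), ω.2) := by
    intro ω
    funext i
    simp only [χ, u, hist, past]
    have : (N : ℤ) - ((N - k i : ℕ) : ℤ) = j i := by
      rw [Nat.cast_sub (hkN i), hk]; ring
    rw [this]
  have hZU : μ.map (fun ω => (Z ω, U ω)) = m.map (fun ω => (ψ (pastPair ω), χ (hist N ω))) := by
    have hv : Measurable fun x : 𝒯 × (ℤ → G) × (ℤ → E) => (x.1, u x.2) :=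
      measurable_fst.prodMk (hu.comp measurable_snd)
    have := congrArg (fun ν => ν.map fun x : 𝒯 × (ℤ → G) × (ℤ → E) => (x.1, u x.2)) hlaw
    simp only [Measure.map_map hv hXY, Measure.map_map hv hm3] at this
    simp only [hχu]
    exact this
  have hZm : μ.map Z = m.map fun ω => ψ (pastPair ω) := by
    have := congrArg (fun ν => ν.map Prod.fst) hlaw
    simp only [Measure.map_map measurable_fst hXY, Measure.map_map measurable_fst hm3] at this
    exact this
  have hκ : m.map (fun ω => (ψ (pastPair ω), χ (hist N ω))) =
      (m.map fun ω => ψ (pastPair ω)) ⊗ₘ condDistrib U Z μ := by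
    rw [← hZU, ← hZm, compProd_map_condDistrib hU.aemeasurable]
  have hUm : ∀ f : (Fin ℓ → E × G) → ℝ, Measurable f →
      ∫ u, f u ∂(μ.map U) = ∫ ω, f (χ (hist N ω)) ∂m := by
    intro f hf
    have hχN : Measurable fun ω : (ℤ → T) × (ℤ → E) => χ (hist N ω) := hχ.comp (measurable_hist N)
    have e1 : μ.map U = m.map fun ω => χ (hist N ω) := by
      have := congrArg (fun ν => ν.map Prod.snd) hZU
      simp only [Measure.map_map measurable_snd (hZ.prodMk hU),
        Measure.map_map measurable_snd (hψp.prodMk hχN)] at this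
      exact this
    rw [e1, integral_map hχN.aemeasurable hf.aestronglyMeasurable]
  have hae := h.ae_enorm_integral_sub_le hI hψ hχ hκ
  rw [← hZm] at hae
  have hcm : ∀ i, Measurable fun ω =>
      IsResponseKernel.condCost b e g (fun x x' => ‖x' - x‖) P' m ψ i (Z ω) := fun i =>
    (IsResponseKernel.measurable_condCost h.g_measurable h.γ_measurable ψ i).comp hZ
  calc tauDep μ Z U ≤ ∫⁻ ω, ∑ i,
        IsResponseKernel.condCost b e g (fun x x' => ‖x' - x‖) P' m ψ (k i) (Z ω) ∂μ := by
        refine lintegral_mono_ae ?_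
        filter_upwards [ae_of_ae_map hZ.aemeasurable hae] with ω hω
        refine wasserstein_le_of_bounded fun f K hf hK hL => ?_
        rw [hUm f hf]
        refine (hω f K hf hK fun y y' s s' => ?_).trans_eq ?_
        · refine (hL _ _).trans_eq ?_
          rw [hsum]
          refine Finset.sum_congr rfl fun i _ => ?_
          have : (N : ℤ) - ((N - k i : ℕ) : ℤ) = j i := by
            rw [Nat.cast_sub (hkN i), hk]; ring
          simp only [χ, gammaBar, this]
        · rw [hsum]
          refine Finset.sum_congr rfl fun i _ => ?_
          rw [Nat.sub_sub_self (hkN i)]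
    _ = ∑ i, ∫⁻ ω, IsResponseKernel.condCost b e g (fun x x' => ‖x' - x‖) P' m ψ (k i) (Z ω) ∂μ :=
        lintegral_finsetSum _ fun i _ => hcm _
    _ ≤ ∑ i, rate b e c M (k i) := by
        refine Finset.sum_le_sum fun i _ => ?_
        rw [← lintegral_map (IsResponseKernel.measurable_condCost h.g_measurable
          h.γ_measurable ψ _) hZ, hZm]
        exact h.lintegral_condCost_le hψ (hk1 i)

lemma IsCoupledModel.tauCoef_le
    (h : IsCoupledModel Q 𝒟 b e g (fun x x' => ‖x' - x‖) P P' m c M)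
    {Ω 𝒯 : Type*} [MeasurableSpace Ω] [MeasurableSpace 𝒯] {μ : Measure Ω} [IsProbabilityMeasure μ]
    {X : ℤ → Ω → G} (hX : ∀ t, Measurable (X t)) {Y : ℤ → Ω → E} (hY : ∀ t, Measurable (Y t))
    {Z : Ω → 𝒯} (hZ : Measurable Z) {ψ : (ℕ → E) × (ℕ → T) → 𝒯} (hψ : Measurable ψ)
    (hlaw : μ.map (fun ω => (Z ω, path X ω, path Y ω)) =
      m.map (fun ω => (ψ (pastPair ω), (fun t => g (ω.1 t)), ω.2)))
    {n : ℕ} (hn : 1 ≤ n) :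
    tauCoef μ Z (fun t ω => (Y t ω, X t ω)) n ≤ ⨆ (j : ℕ) (_ : n ≤ j), rate b e c M j := by
  refine iSup_le fun k => iSup_le fun _ => iSup_le fun ℓ => iSup_le fun hℓ => ?_
  have hℓ0 : (ℓ : ℝ≥0∞) ≠ 0 := by
    have := hℓ.1
    exact Nat.cast_ne_zero.2 (by omega)
  rw [mul_comm, ← div_eq_mul_inv]
  refine ENNReal.div_le_of_le_mul' (iSup_le fun j => iSup_le fun hj => ?_)
  have hn' : ∀ i, 1 ≤ j i := fun i => le_trans (by exact_mod_cast hn) (hj.2 i)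
  refine (h.tauDep_le hX hY hZ hψ hlaw hj.1 hn').trans ?_
  calc ∑ i, rate b e c M (j i).toNat
      ≤ ∑ _i : Fin ℓ, ⨆ (j : ℕ) (_ : n ≤ j), rate b e c M j := by
        refine Finset.sum_le_sum fun i _ => ?_
        refine le_iSup₂_of_le (j i).toNat ?_ le_rfl
        have := hj.2 i
        omega
    _ = _ := by simp

end Tau

/-! ### The bound on the β coefficients. -/

section Beta

/-- The sequence equal to `v` up to index `M - 1`, and constant from then on. -/
def truncate {α : Type*} (v₀ : α) (M : ℕ) (v : ℕ → α) : ℕ → α := fun k => if k < M then v k else v₀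

lemma measurable_truncate {α : Type*} [MeasurableSpace α] (v₀ : α) (M : ℕ) :
    Measurable (truncate v₀ M) := by
  refine measurable_pi_lambda _ fun k => ?_
  by_cases h : k < M
  · simpa only [truncate, h, if_true] using measurable_pi_apply k
  · simpa only [truncate, h, if_false] using measurable_const

/-- Probability measures on a sequence space that are close on the finite-dimensional events are
close on all events. -/
lemma ofReal_abs_measureReal_sub_le_of_truncate {α : Type*} [MeasurableSpace α] (v₀ : α)
    {ν₁ ν₂ : Measure (ℕ → α)} [IsFiniteMeasure ν₁] [IsFiniteMeasure ν₂] {B : ℝ≥0∞}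
    (h : ∀ (M : ℕ) (A : Set (ℕ → α)), MeasurableSet A →
      ENNReal.ofReal |ν₁.real (truncate v₀ M ⁻¹' A) - ν₂.real (truncate v₀ M ⁻¹' A)| ≤ B)
    {A : Set (ℕ → α)} (hA : MeasurableSet A) :
    ENNReal.ofReal |ν₁.real A - ν₂.real A| ≤ B := by
  refine ENNReal.le_of_forall_pos_le_add fun ε hε _ => ?_
  -- Approximation under `ν₁ + ν₂` is approximation under both. A cylinder depends on finitely many
  -- coordinates, so a long enough truncation leaves it unchanged.
  obtain ⟨t, ht, htA⟩ := exists_measure_symmDiff_lt_of_generateFrom_isSetRing (μ := ν₁ + ν₂)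
    (isSetRing_measurableCylinders (α := fun _ : ℕ => α))
    ⟨{Set.univ}, Set.countable_singleton _,
      Set.singleton_subset_iff.2 (univ_mem_measurableCylinders _), by simp⟩
    generateFrom_measurableCylinders.symm hA (ε := ENNReal.ofNNReal ε) (by simpa using hε)
  have htm : MeasurableSet t := MeasurableSet.of_mem_measurableCylinders ht
  obtain ⟨s, W, -, rfl⟩ := (mem_measurableCylinders _).1 ht
  obtain ⟨M, hM⟩ : ∃ M, ∀ i ∈ s, i < M := ⟨s.sup id + 1, fun i hi =>
    Nat.lt_succ_of_le (Finset.le_sup (f := id) hi)⟩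
  have htr : truncate v₀ M ⁻¹' (cylinder s W) = cylinder s W := by
    ext v
    simp only [Set.mem_preimage, mem_cylinder]
    have : s.restrict (truncate v₀ M v) = s.restrict v := by
      funext i
      simp [truncate, hM i i.2]
    rw [this]
  have h1 := h M _ htm
  rw [htr] at h1
  have hle : ∀ ν : Measure (ℕ → α), [IsFiniteMeasure ν] →
      |ν.real (cylinder s W) - ν.real A| ≤ ν.real (symmDiff (cylinder s W) A) := fun ν _ =>
    abs_measureReal_sub_le_measureReal_symmDiff htm.nullMeasurableSet hA.nullMeasurableSet
  have h2 : |ν₁.real A - ν₂.real A| ≤ |ν₁.real (cylinder s W) - ν₂.real (cylinder s W)| +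
      (ν₁ + ν₂).real (symmDiff (cylinder s W) A) := by
    rw [measureReal_add_apply]
    have a1 := abs_le.1 (hle ν₁)
    have a2 := abs_le.1 (hle ν₂)
    have a3 := abs_le.1 (le_refl |ν₁.real (cylinder s W) - ν₂.real (cylinder s W)|)
    exact abs_le.2 ⟨by linarith, by linarith⟩
  calc ENNReal.ofReal |ν₁.real A - ν₂.real A|
      ≤ ENNReal.ofReal (|ν₁.real (cylinder s W) - ν₂.real (cylinder s W)| +
        (ν₁ + ν₂).real (symmDiff (cylinder s W) A)) := ENNReal.ofReal_le_ofReal h2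
    _ = ENNReal.ofReal |ν₁.real (cylinder s W) - ν₂.real (cylinder s W)| +
        (ν₁ + ν₂) (symmDiff (cylinder s W) A) := by
        rw [ENNReal.ofReal_add (abs_nonneg _) measureReal_nonneg, ofReal_measureReal]
    _ ≤ B + ε := add_le_add h1 htA.le

variable {E T G : Type*} [MeasurableSpace E] [Fintype E] [Nonempty E] [MeasurableSingletonClass E]
  [MeasurableSpace T] [StandardBorelSpace T] [Nonempty T]
  [NormedAddCommGroup G] [MeasurableSpace G] [BorelSpace G] [SecondCountableTopology G]
  [StandardBorelSpace G]
  {Q : ℤ → E → (ℕ → E) → (ℤ → T) → ℝ} {𝒟 : Set (ℤ → T)} {b : ℕ → ℝ}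
  {g : T → G} {e : ℕ → ℝ≥0} {P : Kernel T (ℕ → T)} [IsMarkovKernel P]
  {P' : Kernel (T × T) ((ℕ → T) × (ℕ → T))} [IsMarkovKernel P']
  {m : Measure ((ℤ → T) × (ℤ → E))} [IsProbabilityMeasure m] {c : ℕ → ℝ≥0∞} {M : ℝ≥0∞}

-- Two values of an indicator differ by at most 1, and only if the responses or the covariates
-- differ at one of the `K` times. For the discrete metric indicators are thus Lipschitz, and the
-- Lipschitz bound becomes one in total variation, outside a null set that does not depend on the
-- event.
open Classical in
lemma IsCoupledModel.ae_abs_condDistrib_truncate_sub_le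
    (h : IsCoupledModel Q 𝒟 b e g (fun x x' => if x = x' then 0 else 1) P P' m c M)
    {Ω 𝒯 : Type*} [MeasurableSpace Ω] [MeasurableSpace 𝒯] {μ : Measure Ω} [IsProbabilityMeasure μ]
    {X : ℤ → Ω → G} (hX : ∀ t, Measurable (X t)) {Y : ℤ → Ω → E} (hY : ∀ t, Measurable (Y t))
    {Z : Ω → 𝒯} (hZ : Measurable Z) {ψ : (ℕ → E) × (ℕ → T) → 𝒯} (hψ : Measurable ψ)
    (hlaw : μ.map (fun ω => (Z ω, path X ω, path Y ω)) =
      m.map (fun ω => (ψ (pastPair ω), (fun t => g (ω.1 t)), ω.2)))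
    {n : ℕ} (hn : 1 ≤ n) (v₀ : E × G) (K : ℕ) :
    ∀ᵐ z ∂(μ.map Z), ∀ A : Set (ℕ → E × G), MeasurableSet A →
      ENNReal.ofReal |(condDistrib (fun ω => future (path (fun t ω => (Y t ω, X t ω)) ω) n) Z μ
          z).real (truncate v₀ K ⁻¹' A) -
        (μ.map fun ω => future (path (fun t ω => (Y t ω, X t ω)) ω) n).real
          (truncate v₀ K ⁻¹' A)| ≤
      ∑ k ∈ Finset.range K, IsResponseKernel.condCost b e g (fun x x' => if x = x' then 0 else 1)
        P' m ψ (n + k) z := by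
  have hg := h.g_measurable
  let U : Ω → ℕ → E × G := fun ω => future (path (fun t ω => (Y t ω, X t ω)) ω) n
  have hU : Measurable U := measurable_pi_lambda _ fun k => (hY _).prodMk (hX _)
  have htr := measurable_truncate v₀ K
  -- In the history at time `n + K`, time `n + k` is lag `K - k`; the coordinates `k ≥ K` are erased
  -- by the truncation.
  let χ : (ℕ → E) × (ℤ → T) → (ℕ → E × G) := fun p =>
    truncate v₀ K fun k => (p.1 (K - k), g (p.2 (n + k)))
  have hχ : Measurable χ := htr.comp <| measurable_pi_lambda _ fun i =>
    ((measurable_pi_apply _).comp measurable_fst).prodMk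
      (hg.comp ((measurable_pi_apply _).comp measurable_snd))
  let u : (ℤ → G) × (ℤ → E) → (ℕ → E × G) := fun p k => (p.2 (n + k), p.1 (n + k))
  have hu : Measurable u := measurable_pi_lambda _ fun i =>
    ((measurable_pi_apply _).comp measurable_snd).prodMk
      ((measurable_pi_apply _).comp measurable_fst)
  have hgω : Measurable fun ω : (ℤ → T) × (ℤ → E) => (fun t => g (ω.1 t) : ℤ → G) :=
    measurable_pi_lambda _ fun t => hg.comp ((measurable_pi_apply t).comp measurable_fst)
  have hψp : Measurable fun ω : (ℤ → T) × (ℤ → E) => ψ (pastPair ω) :=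
    hψ.comp measurable_pastPair
  have hXY : Measurable fun ω => (Z ω, path X ω, path Y ω) :=
    hZ.prodMk ((measurable_path hX).prodMk (measurable_path hY))
  have hm3 : Measurable fun ω : (ℤ → T) × (ℤ → E) =>
      (ψ (pastPair ω), (fun t => g (ω.1 t) : ℤ → G), ω.2) :=
    hψp.prodMk (hgω.prodMk measurable_snd)
  have hχu : ∀ ω : (ℤ → T) × (ℤ → E),
      χ (hist ((n + K : ℕ) : ℤ) ω) = truncate v₀ K (u ((fun t => g (ω.1 t)), ω.2)) := by
    intro ω
    funext k
    by_cases hk : k < K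
    · simp only [χ, u, truncate, hk, if_true, hist, past]
      have : ((n + K : ℕ) : ℤ) - ((K - k : ℕ) : ℤ) = n + k := by omega
      rw [this]
    · simp [χ, truncate, hk]
  have hZU : μ.map (fun ω => (Z ω, truncate v₀ K (U ω))) =
      m.map (fun ω => (ψ (pastPair ω), χ (hist ((n + K : ℕ) : ℤ) ω))) := by
    have hv : Measurable fun x : 𝒯 × (ℤ → G) × (ℤ → E) => (x.1, truncate v₀ K (u x.2)) :=
      measurable_fst.prodMk (htr.comp (hu.comp measurable_snd))
    have := congrArg (fun ν => ν.map fun x : 𝒯 × (ℤ → G) × (ℤ → E) =>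
      (x.1, truncate v₀ K (u x.2))) hlaw
    simp only [Measure.map_map hv hXY, Measure.map_map hv hm3] at this
    simp only [hχu]
    exact this
  have hZm : μ.map Z = m.map fun ω => ψ (pastPair ω) := by
    have := congrArg (fun ν => ν.map Prod.fst) hlaw
    simp only [Measure.map_map measurable_fst hXY, Measure.map_map measurable_fst hm3] at this
    exact this
  have : IsProbabilityMeasure (μ.map Z) := Measure.isProbabilityMeasure_map hZ.aemeasurable
  have : IsMarkovKernel ((condDistrib U Z μ).map (truncate v₀ K)) :=
    Kernel.IsMarkovKernel.map _ htr
  have hκ : m.map (fun ω => (ψ (pastPair ω), χ (hist ((n + K : ℕ) : ℤ) ω))) =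
      (m.map fun ω => ψ (pastPair ω)) ⊗ₘ ((condDistrib U Z μ).map (truncate v₀ K)) := by
    rw [← hZU, ← hZm, Measure.compProd_map htr, compProd_map_condDistrib hU.aemeasurable,
      Measure.map_map (measurable_id.prodMap htr) (hZ.prodMk hU)]
    rfl
  let I : Finset ℕ := (Finset.range K).image fun k => K - k
  have hI : ∀ i ∈ I, i < n + K := by
    intro i hi
    obtain ⟨k, -, rfl⟩ := Finset.mem_image.1 hi
    omega
  have hinj : Set.InjOn (fun k => K - k) (Finset.range K : Set ℕ) := by
    intro k hk k' hk' hkk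
    simp only [Finset.coe_range, Set.mem_Iio] at hk hk' hkk
    omega
  have hae := h.ae_enorm_integral_sub_le hI hψ hχ hκ
  rw [← hZm] at hae
  filter_upwards [hae] with z hz A hA
  have hf : Measurable (A.indicator fun _ => (1 : ℝ)) := measurable_const.indicator hA
  have hL : IsLagLipschitz g (fun x x' => if x = x' then 0 else 1) (n + K : ℕ) I
      (fun p : (ℕ → E) × (ℤ → T) => A.indicator (fun _ => (1 : ℝ)) (χ p)) := by
    intro y y' s s'
    beta_reduce
    have hnn : ∀ i ∈ I, (0 : ℝ) ≤ (if y i = y' i then 0 else 1) +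
        (if g (s (((n + K : ℕ) : ℤ) - i)) = g (s' (((n + K : ℕ) : ℤ) - i)) then 0 else 1) :=
      fun i _ => by split_ifs <;> norm_num
    by_cases hχe : χ (y, s) = χ (y', s')
    · rw [hχe, sub_self, abs_zero]
      exact Finset.sum_nonneg hnn
    · obtain ⟨k, hk, hk'⟩ : ∃ k < K, ¬ (y (K - k) = y' (K - k) ∧
          g (s (n + k)) = g (s' (n + k))) := by
        by_contra! hcon
        refine hχe (funext fun k => ?_)
        by_cases hk : k < K
        · simp only [χ, truncate, hk, if_true]
          exact Prod.ext (hcon k hk).1 (hcon k hk).2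
        · simp [χ, truncate, hk]
      have hKk : ((n + K : ℕ) : ℤ) - ((K - k : ℕ) : ℤ) = n + k := by omega
      refine le_trans ?_ (Finset.single_le_sum hnn
        (Finset.mem_image_of_mem (fun k => K - k) (Finset.mem_range.2 hk)))
      have h1 : |A.indicator (fun _ => (1 : ℝ)) (χ (y, s)) -
          A.indicator (fun _ => (1 : ℝ)) (χ (y', s'))| ≤ 1 := by
        simp only [Set.indicator_apply]
        split_ifs <;> norm_num
      refine h1.trans ?_
      simp only [hKk]
      by_cases hy : y (K - k) = y' (K - k)
      · have : ¬ g (s (n + k)) = g (s' (n + k)) := fun hgs => hk' ⟨hy, hgs⟩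
        simp [this, hy]
      · simp only [hy, if_false]
        split_ifs <;> norm_num
  have hb := hz _ 1 hf (fun v => by simp only [Set.indicator_apply]; split_ifs <;> norm_num) hL
  have hχN : Measurable fun ω : (ℤ → T) × (ℤ → E) => χ (hist ((n + K : ℕ) : ℤ) ω) :=
    hχ.comp (measurable_hist _)
  have e1 : (μ.map U).map (truncate v₀ K) = m.map fun ω => χ (hist ((n + K : ℕ) : ℤ) ω) := by
    have := congrArg (fun ν => ν.map Prod.snd) hZU
    have hUt : Measurable fun ω => truncate v₀ K (U ω) := htr.comp hU
    simp only [Measure.map_map measurable_snd (hZ.prodMk hUt),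
      Measure.map_map measurable_snd (hψp.prodMk hχN)] at this
    rw [Measure.map_map htr hU]
    exact this
  rw [← integral_map hχN.aemeasurable hf.aestronglyMeasurable, ← e1, Kernel.map_apply _ htr,
    integral_indicator_const _ hA, integral_indicator_const _ hA, map_measureReal_apply htr hA,
    map_measureReal_apply htr hA, smul_eq_mul, smul_eq_mul, mul_one, mul_one,
    Real.enorm_eq_ofReal_abs, Finset.sum_image hinj] at hb
  refine hb.trans_eq (Finset.sum_congr rfl fun k hk => ?_)
  have := Finset.mem_range.1 hk
  congr 1
  omega

open Classical in
lemma IsCoupledModel.betaCoef_le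
    (h : IsCoupledModel Q 𝒟 b e g (fun x x' => if x = x' then 0 else 1) P P' m c M)
    {Ω : Type*} [MeasurableSpace Ω] {μ : Measure Ω} [IsProbabilityMeasure μ]
    {X : ℤ → Ω → G} (hX : ∀ t, Measurable (X t)) {Y : ℤ → Ω → E} (hY : ∀ t, Measurable (Y t))
    {ψ : (ℕ → E) × (ℕ → T) → (ℕ → E × G)} (hψ : Measurable ψ)
    (hlaw : μ.map (fun ω => (past (path (fun t ω => (Y t ω, X t ω)) ω) 0, path X ω, path Y ω)) =
      m.map (fun ω => (ψ (pastPair ω), (fun t => g (ω.1 t)), ω.2)))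
    {n : ℕ} (hn : 1 ≤ n) :
    betaCoef μ (fun t ω => (Y t ω, X t ω)) n ≤ ∑' k, rate b e c M (n + k) := by
  let Z : Ω → ℕ → E × G := fun ω => past (path (fun t ω => (Y t ω, X t ω)) ω) 0
  have hZ : Measurable Z := measurable_pi_lambda _ fun k => (hY _).prodMk (hX _)
  have hgω : Measurable fun ω : (ℤ → T) × (ℤ → E) => (fun t => g (ω.1 t) : ℤ → G) :=
    measurable_pi_lambda _ fun t => h.g_measurable.comp ((measurable_pi_apply t).comp measurable_fst)
  have hψp : Measurable fun ω : (ℤ → T) × (ℤ → E) => ψ (pastPair ω) :=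
    hψ.comp measurable_pastPair
  have hXY : Measurable fun ω => (Z ω, path X ω, path Y ω) :=
    hZ.prodMk ((measurable_path hX).prodMk (measurable_path hY))
  have hm3 : Measurable fun ω : (ℤ → T) × (ℤ → E) =>
      (ψ (pastPair ω), (fun t => g (ω.1 t) : ℤ → G), ω.2) :=
    hψp.prodMk (hgω.prodMk measurable_snd)
  have hZm : μ.map Z = m.map fun ω => ψ (pastPair ω) := by
    have hlaw' : μ.map (fun ω => (Z ω, path X ω, path Y ω)) = _ := hlaw
    have := congrArg (fun ν => ν.map Prod.fst) hlaw'
    simp only [Measure.map_map measurable_fst hXY, Measure.map_map measurable_fst hm3] at this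
    exact this
  have hcm : ∀ j, Measurable (IsResponseKernel.condCost b e g
      (fun x x' => if x = x' then 0 else 1) P' m ψ j) := fun j =>
    IsResponseKernel.measurable_condCost h.g_measurable h.γ_measurable ψ j
  have v₀ : E × G := Classical.arbitrary _
  -- One null set for all `K` and all events: the supremum over events stands inside the
  -- expectation.
  have hae := ae_of_ae_map hZ.aemeasurable (ae_all_iff.2 fun K =>
    h.ae_abs_condDistrib_truncate_sub_le hX hY hZ hψ hlaw hn v₀ K)
  have : IsProbabilityMeasure
      (μ.map fun ω => future (path (fun t ω => (Y t ω, X t ω)) ω) (n : ℤ)) :=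
    Measure.isProbabilityMeasure_map
      (measurable_pi_lambda _ fun k => (hY _).prodMk (hX _)).aemeasurable
  calc betaCoef μ (fun t ω => (Y t ω, X t ω)) n
      ≤ ∫⁻ ω, ∑' k, IsResponseKernel.condCost b e g (fun x x' => if x = x' then 0 else 1)
          P' m ψ (n + k) (Z ω) ∂μ := by
        refine lintegral_mono_ae ?_
        filter_upwards [hae] with ω hω
        refine iSup₂_le fun A hA => ?_
        exact ofReal_abs_measureReal_sub_le_of_truncate v₀
          (fun K A hA => (hω K A hA).trans (ENNReal.sum_le_tsum _)) hA
    _ = ∑' k, ∫⁻ ω, IsResponseKernel.condCost b e g (fun x x' => if x = x' then 0 else 1)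
          P' m ψ (n + k) (Z ω) ∂μ :=
        lintegral_tsum fun k => ((hcm _).comp hZ).aemeasurable
    _ ≤ ∑' k, rate b e c M (n + k) := by
        refine ENNReal.tsum_le_tsum fun k => ?_
        rw [← lintegral_map (hcm _) hZ, hZm]
        exact h.lintegral_condCost_le hψ (by omega)

end Beta

/-! ### The response probabilities as a kernel defined on every path. -/

section Transition

open Classical in
/-- The response probabilities as a function of the whole path of the chain, extended by the uniform
law to the paths whose covariates lie outside `D`. -/
def extendTransition {E T G : Type*} [Fintype E] (q : E → (ℕ → E) → (ℕ → G) → ℝ) (D : Set (ℤ → G))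
    (g : T → G) (t : ℤ) (w : E) (y : ℕ → E) (s : ℤ → T) : ℝ :=
  if (fun u => g (s u)) ∈ D then q w y (past (fun u => g (s u)) t) else (Fintype.card E : ℝ)⁻¹

variable {E T G : Type*} [Fintype E] {q : E → (ℕ → E) → (ℕ → G) → ℝ} {D : Set (ℤ → G)} {g : T → G}

lemma extendTransition_of_mem {s : ℤ → T} (hs : (fun u => g (s u)) ∈ D) (t : ℤ) (w : E)
    (y : ℕ → E) : extendTransition q D g t w y s = q w y (past (fun u => g (s u)) t) := if_pos hs

lemma extendTransition_of_notMem {s : ℤ → T} (hs : (fun u => g (s u)) ∉ D) (t : ℤ) (w : E)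
    (y : ℕ → E) : extendTransition q D g t w y s = (Fintype.card E : ℝ)⁻¹ := if_neg hs

/-- Off `D` the uniform law ignores the history, so its total variation distances vanish and the
bound by `contCoef` holds on all paths. Dependence on the past alone survives only for paths with
covariates in `D`. -/
lemma IsTransition.isResponseKernel [Nonempty E] [MeasurableSpace E] [MeasurableSpace T]
    [MeasurableSpace G] (hq : IsTransition q D) (hD : MeasurableSet D) (hg : Measurable g) :
    IsResponseKernel (extendTransition q D g) {s | (fun u => g (s u)) ∈ D} (contCoef q D) where
  measurable t w := by
    classical
    have hgs : Measurable fun p : (ℕ → E) × (ℤ → T) => (fun u => g (p.2 u) : ℤ → G) :=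
      measurable_pi_lambda _ fun u => hg.comp ((measurable_pi_apply u).comp measurable_snd)
    have hA : MeasurableSet {p : (ℕ → E) × (ℤ → T) | (fun u => g (p.2 u)) ∈ D} := hgs hD
    have h1 : Measurable fun p : {p : (ℕ → E) × (ℤ → T) | (fun u => g (p.2 u)) ∈ D} =>
        ((w, p.1.1, ⟨fun u => g (p.1.2 u), p.2⟩) : E × (ℕ → E) × D) :=
      measurable_const.prodMk ((measurable_fst.comp measurable_subtype_coe).prodMk
        ((hgs.comp measurable_subtype_coe).subtype_mk))
    have h2 := Measurable.dite ((hq.measurable t).comp h1) (measurable_const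
      (a := (Fintype.card E : ℝ)⁻¹)) hA
    convert h2 using 1
    funext p
    by_cases hp : (fun u => g (p.2 u)) ∈ D
    · simp [extendTransition, hp]
    · simp [extendTransition, hp]
  nonneg t w y s := by
    by_cases hs : (fun u => g (s u)) ∈ D
    · rw [extendTransition_of_mem hs]
      exact (hq.pos w y _ hs t).le
    · rw [extendTransition_of_notMem hs]
      positivity
  sum_eq_one t y s := by
    by_cases hs : (fun u => g (s u)) ∈ D
    · simp only [extendTransition_of_mem hs]
      exact hq.sum_eq_one y _ hs t
    · simp [extendTransition_of_notMem hs]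
  dTV_le t s m y y' h := by
    by_cases hs : (fun u => g (s u)) ∈ D
    · simp only [extendTransition_of_mem hs]
      exact hq.dTV_le_contCoef hs t h
    · simp only [extendTransition_of_notMem hs]
      simpa [dTV] using contCoef_nonneg q D m
  congr t w y s hs s' hs' h := by
    rw [extendTransition_of_mem (show (fun u => g (s u)) ∈ D from hs),
      extendTransition_of_mem (show (fun u => g (s' u)) ∈ D from hs')]
    congr 1
    funext i
    simp only [past]
    rw [h _ (by omega)]

end Transition

/-! ### From conditional probabilities to the kernel recursion for the joint law. -/

section Solution

variable {E T : Type*} [Fintype E] [MeasurableSpace E] [MeasurableSpace T]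
  {Q : ℤ → E → (ℕ → E) → (ℤ → T) → ℝ} {𝒟 : Set (ℤ → T)} {b : ℕ → ℝ}

lemma IsResponseKernel.stepKernel_prod (hQ : IsResponseKernel Q 𝒟 b) (t : ℤ)
    (p : (ℕ → E) × (ℤ → T)) {A : Set (ℕ → E)} (hA : MeasurableSet A) {B : Set (ℤ → T)}
    (hB : MeasurableSet B) :
    hQ.stepKernel t p (A ×ˢ B) = B.indicator (fun _ => ∑ w, ENNReal.ofReal (Q t w p.1 p.2) *
      A.indicator (fun _ => 1) (prepend w p.1)) p.2 := by
  classical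
  rw [stepKernel_apply]
  simp only [Measure.coe_finsetSum, Finset.sum_apply, Measure.smul_apply, smul_eq_mul,
    Measure.dirac_apply' _ (hA.prod hB)]
  by_cases hp : p.2 ∈ B
  · rw [Set.indicator_of_mem hp]
    refine Finset.sum_congr rfl fun w _ => ?_
    simp [Set.indicator_apply, hp]
  · simp [Set.indicator_apply, hp]

lemma IsResponseKernel.isLaw_iff (hQ : IsResponseKernel Q 𝒟 b)
    {m : Measure ((ℤ → T) × (ℤ → E))} [IsFiniteMeasure m] :
    hQ.IsLaw m ↔ ∀ (t : ℤ) (A : Set (ℕ → E)) (B : Set (ℤ → T)), MeasurableSet A → MeasurableSet B →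
      m (hist t ⁻¹' (A ×ˢ B)) = ∫⁻ ω in Prod.fst ⁻¹' B,
        ∑ w, ENNReal.ofReal (Q t w (past ω.2 (t - 1)) ω.1) *
          A.indicator (fun _ => 1) (prepend w (past ω.2 (t - 1))) ∂m := by
  have key : ∀ (t : ℤ) (A : Set (ℕ → E)) (B : Set (ℤ → T)), MeasurableSet A → MeasurableSet B →
      ((m.map (hist (t - 1))).bind (hQ.stepKernel t)) (A ×ˢ B) = ∫⁻ ω in Prod.fst ⁻¹' B,
        ∑ w, ENNReal.ofReal (Q t w (past ω.2 (t - 1)) ω.1) *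
          A.indicator (fun _ => 1) (prepend w (past ω.2 (t - 1))) ∂m := by
    intro t A B hA hB
    rw [Measure.bind_apply (hA.prod hB) (Kernel.aemeasurable _),
      lintegral_map (Kernel.measurable_coe _ (hA.prod hB)) (measurable_hist _),
      ← lintegral_indicator (measurable_fst hB)]
    refine lintegral_congr fun ω => ?_
    rw [hQ.stepKernel_prod t _ hA hB]
    by_cases hω : ω.1 ∈ B
    · rw [Set.indicator_of_mem (show (hist (t - 1) ω).2 ∈ B from hω),
        Set.indicator_of_mem (show ω ∈ Prod.fst ⁻¹' B from hω)]
      rfl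
    · rw [Set.indicator_of_notMem (show (hist (t - 1) ω).2 ∉ B from hω),
        Set.indicator_of_notMem (show ω ∉ Prod.fst ⁻¹' B from hω)]
  constructor
  · intro h t A B hA hB
    rw [← key t A B hA hB, ← h t, Measure.map_apply (measurable_hist t) (hA.prod hB)]
  · intro h t
    refine Measure.ext_prod fun {A B} hA hB => ?_
    rw [key t A B hA hB, ← h t A B hA hB, Measure.map_apply (measurable_hist t) (hA.prod hB)]

/-- Responses specified conditionally on a function `θ` of the chain can be realized so that they
are specified conditionally on the chain itself. -/
lemma IsResponseKernel.IsLaw.lift {T' : Type*} [MeasurableSpace T'] {hQ : IsResponseKernel Q 𝒟 b}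
    {θ : (ℤ → T') → (ℤ → T)} (hθ : Measurable θ) {𝒟' : Set (ℤ → T')} {b' : ℕ → ℝ}
    (hQ' : IsResponseKernel (fun t w y s => Q t w y (θ s)) 𝒟' b')
    {lam : Measure (ℤ → T')} [IsFiniteMeasure lam] {κ : Kernel (ℤ → T) (ℤ → E)} [IsMarkovKernel κ]
    (h : hQ.IsLaw ((lam.map θ) ⊗ₘ κ)) : hQ'.IsLaw (lam ⊗ₘ (κ.comap θ hθ)) := by
  rw [IsResponseKernel.isLaw_iff] at h ⊢
  intro t A B hA hB
  have hstep : Measurable fun ω : (ℤ → T) × (ℤ → E) =>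
      ∑ w, ENNReal.ofReal (Q t w (past ω.2 (t - 1)) ω.1) *
          A.indicator (fun _ => (1 : ℝ≥0∞)) (prepend w (past ω.2 (t - 1))) := by
    refine Finset.measurable_fun_sum _ fun w _ => ?_
    have hp : Measurable fun ω : (ℤ → T) × (ℤ → E) => past ω.2 (t - 1) :=
      (measurable_past _).comp measurable_snd
    have h1 : Measurable fun ω : (ℤ → T) × (ℤ → E) => Q t w (past ω.2 (t - 1)) ω.1 :=
      ((hQ.measurable t w).comp (hp.prodMk measurable_fst) :)
    exact h1.ennreal_ofReal.mul
      ((measurable_const.indicator hA).comp ((measurable_prepend w).comp hp))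
  have hpastA : MeasurableSet ((fun y : ℤ → E => past y t) ⁻¹' A) := measurable_past t hA
  -- Since `B` is arbitrary, the recursion holds for the conditional law `κ x` along almost every
  -- `x`; it can then be pulled back along `θ`.
  have hae : ∀ᵐ x ∂(lam.map θ), κ x ((fun y => past y t) ⁻¹' A) =
      ∫⁻ y, ∑ w, ENNReal.ofReal (Q t w (past y (t - 1)) x) *
          A.indicator (fun _ => 1) (prepend w (past y (t - 1))) ∂(κ x) := by
    refine ae_eq_of_forall_setLIntegral_eq_of_sigmaFinite (Kernel.measurable_coe _ hpastA)
      hstep.lintegral_kernel_prod_right' fun B hB _ => ?_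
    have e := h t A B hA hB
    have e2 : hist t ⁻¹' (A ×ˢ B) = B ×ˢ ((fun y : ℤ → E => past y t) ⁻¹' A) := by
      ext ω
      simp [hist, and_comm]
    rw [e2, Measure.compProd_apply_prod hB hpastA] at e
    have e3 : (Prod.fst ⁻¹' B : Set ((ℤ → T) × (ℤ → E))) = B ×ˢ Set.univ := by
      ext ω
      simp
    rw [e, e3, Measure.setLIntegral_compProd hstep hB MeasurableSet.univ]
    simp
  have e2 : hist t ⁻¹' (A ×ˢ B) = B ×ˢ ((fun y : ℤ → E => past y t) ⁻¹' A) := by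
    ext ω
    simp [hist, and_comm]
  have e3 : (Prod.fst ⁻¹' B : Set ((ℤ → T') × (ℤ → E))) = B ×ˢ Set.univ := by
    ext ω
    simp
  have hstep' : Measurable fun ω : (ℤ → T') × (ℤ → E) =>
      ∑ w, ENNReal.ofReal (Q t w (past ω.2 (t - 1)) (θ ω.1)) *
          A.indicator (fun _ => (1 : ℝ≥0∞)) (prepend w (past ω.2 (t - 1))) :=
    (hstep.comp ((hθ.comp measurable_fst).prodMk measurable_snd) :)
  rw [e2, Measure.compProd_apply_prod hB hpastA, e3,
    Measure.setLIntegral_compProd hstep' hB MeasurableSet.univ]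
  refine lintegral_congr_ae (ae_restrict_of_ae ?_)
  filter_upwards [ae_of_ae_map hθ.aemeasurable hae] with s hs
  simpa [Kernel.comap_apply] using hs

lemma map_prodMk_compProd_comap {α β δ : Type*} [MeasurableSpace α] [MeasurableSpace β]
    [MeasurableSpace δ] {lam : Measure α} [IsFiniteMeasure lam] {θ : α → β} (hθ : Measurable θ)
    (κ : Kernel β δ) [IsMarkovKernel κ] :
    (lam ⊗ₘ (κ.comap θ hθ)).map (fun p => (θ p.1, p.2)) = (lam.map θ) ⊗ₘ κ := by
  have hm : Measurable fun p : α × δ => (θ p.1, p.2) :=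
    (hθ.comp measurable_fst).prodMk measurable_snd
  refine Measure.ext_prod fun {A B} hA hB => ?_
  have e : (fun p : α × δ => (θ p.1, p.2)) ⁻¹' (A ×ˢ B) = (θ ⁻¹' A) ×ˢ B := by
    ext p
    simp
  rw [Measure.map_apply hm (hA.prod hB), e, Measure.compProd_apply_prod (hθ hA) hB,
    Measure.compProd_apply_prod hA hB, setLIntegral_map hA (Kernel.measurable_coe _ hB) hθ]
  rfl

variable {G Ω : Type*} [MeasurableSpace G] [MeasurableSpace Ω] {μ : Measure Ω}
  [IsProbabilityMeasure μ] {q : E → (ℕ → E) → (ℕ → G) → ℝ} {D : Set (ℤ → G)}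
  {X : ℤ → Ω → G} {Y : ℤ → Ω → E} {C : ℤ → Ω → T}

lemma IsSolution.measure_inter_eq [MeasurableSingletonClass E] (hq : IsTransition q D)
    (hXD : ∀ᵐ ω ∂μ, path X ω ∈ D) (hY : ∀ t, Measurable (Y t)) (hC : ∀ t, Measurable (C t))
    (h : IsSolution μ q Y X C) (t : ℤ) (w : E) {R : Set ((ℕ → E) × (ℤ → T))}
    (hR : MeasurableSet R) :
    μ ((Y t ⁻¹' {w}) ∩ (fun ω => (past (path Y ω) (t - 1), path C ω)) ⁻¹' R) =
      ∫⁻ ω in (fun ω => (past (path Y ω) (t - 1), path C ω)) ⁻¹' R,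
        ENNReal.ofReal (q w (past (path Y ω) (t - 1)) (past (path X ω) t)) ∂μ := by
  let W : Ω → (ℕ → E) × (ℤ → T) := fun ω => (past (path Y ω) (t - 1), path C ω)
  have hW : Measurable W :=
    ((measurable_past _).comp (measurable_path hY)).prodMk (measurable_path hC)
  have hle : MeasurableSpace.comap W inferInstance ≤ (inferInstance : MeasurableSpace Ω) :=
    hW.comap_le
  have hYw : MeasurableSet (Y t ⁻¹' {w}) := hY t (measurableSet_singleton w)
  have hint : Integrable ((Y t ⁻¹' {w}).indicator fun _ => (1 : ℝ)) μ :=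
    (integrable_const 1).indicator hYw
  -- Integrability is inherited from the conditional expectation, since `q` is constrained on `D`
  -- only.
  have hqint : Integrable (fun ω => q w (past (path Y ω) (t - 1)) (past (path X ω) t)) μ :=
    integrable_condExp.congr (h t w)
  have hq0 : 0 ≤ᵐ[μ] fun ω => q w (past (path Y ω) (t - 1)) (past (path X ω) t) := by
    filter_upwards [hXD] with ω hω
    exact (hq.pos w _ _ hω t).le
  have e1 := setIntegral_condExp hle hint (s := W ⁻¹' R) ⟨R, hR, rfl⟩
  have e2 : ∫ ω in W ⁻¹' R, q w (past (path Y ω) (t - 1)) (past (path X ω) t) ∂μ =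
      μ.real ((Y t ⁻¹' {w}) ∩ W ⁻¹' R) := by
    rw [← setIntegral_congr_ae (hW hR) ((h t w).mono fun ω hω _ => hω), e1,
      integral_indicator_const _ hYw, measureReal_restrict_apply hYw, smul_eq_mul, mul_one]
  rw [← ofReal_integral_eq_lintegral_ofReal hqint.integrableOn (ae_restrict_of_ae hq0), e2,
    ofReal_measureReal]

/-- The joint law of a chain and of responses specified conditionally on it. -/
lemma IsSolution.isLaw [Nonempty E] [MeasurableSingletonClass E] (hq : IsTransition q D)
    (hD : MeasurableSet D) {g : T → G} (hg : Measurable g) (hX : ∀ t ω, X t ω = g (C t ω))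
    (hXD : ∀ᵐ ω ∂μ, path X ω ∈ D) (hY : ∀ t, Measurable (Y t)) (hC : ∀ t, Measurable (C t))
    (h : IsSolution μ q Y X C) :
    (hq.isResponseKernel hD hg).IsLaw (μ.map fun ω => (path C ω, path Y ω)) := by
  classical
  have hCY : Measurable fun ω => (path C ω, path Y ω) :=
    (measurable_path hC).prodMk (measurable_path hY)
  have : IsProbabilityMeasure (μ.map fun ω => (path C ω, path Y ω)) :=
    Measure.isProbabilityMeasure_map hCY.aemeasurable
  rw [IsResponseKernel.isLaw_iff]
  intro t A B hA hB
  let W : Ω → (ℕ → E) × (ℤ → T) := fun ω => (past (path Y ω) (t - 1), path C ω)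
  have hW : Measurable W :=
    ((measurable_past _).comp (measurable_path hY)).prodMk (measurable_path hC)
  have hR : ∀ w : E, MeasurableSet ((prepend w ⁻¹' A) ×ˢ B) := fun w =>
    (measurable_prepend w hA).prod hB
  have hXC : ∀ ω, path X ω = fun u => g (path C ω u) := fun ω => funext fun u => hX u ω
  have e1 : (fun ω => (path C ω, path Y ω)) ⁻¹' (hist t ⁻¹' (A ×ˢ B)) =
      ⋃ w ∈ (Finset.univ : Finset E), (Y t ⁻¹' {w}) ∩ W ⁻¹' ((prepend w ⁻¹' A) ×ˢ B) := by
    ext ω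
    have : past (path Y ω) t = prepend (Y t ω) (past (path Y ω) (t - 1)) := past_eq_prepend _ _
    simp [hist, W, this]
  have e2 : ∀ w, Measurable fun ω : Ω => ENNReal.ofReal (extendTransition q D g t w
      (past (path Y ω) (t - 1)) (path C ω)) * A.indicator (fun _ => (1 : ℝ≥0∞))
        (prepend w (past (path Y ω) (t - 1))) := fun w => by
    have h1 : Measurable fun ω : Ω => extendTransition q D g t w
      (past (path Y ω) (t - 1)) (path C ω) :=
      (((hq.isResponseKernel hD hg).measurable t w).comp hW :)
    have h2 : Measurable fun ω => A.indicator (fun _ => (1 : ℝ≥0∞))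
        (prepend w (past (path Y ω) (t - 1))) :=
      (((measurable_const (a := (1 : ℝ≥0∞))).indicator hA).comp
        ((measurable_prepend w).comp (measurable_fst.comp hW)) :)
    exact h1.ennreal_ofReal.mul h2
  have e3 : Measurable fun ω : (ℤ → T) × (ℤ → E) =>
      ∑ w, ENNReal.ofReal (extendTransition q D g t w (past ω.2 (t - 1)) ω.1) *
          A.indicator (fun _ => (1 : ℝ≥0∞)) (prepend w (past ω.2 (t - 1))) := by
    refine Finset.measurable_fun_sum _ fun w _ => ?_
    have hp : Measurable fun ω : (ℤ → T) × (ℤ → E) => past ω.2 (t - 1) :=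
      (measurable_past _).comp measurable_snd
    have h1 : Measurable fun ω : (ℤ → T) × (ℤ → E) =>
        extendTransition q D g t w (past ω.2 (t - 1)) ω.1 :=
      (((hq.isResponseKernel hD hg).measurable t w).comp (hp.prodMk measurable_fst) :)
    exact h1.ennreal_ofReal.mul
      ((measurable_const.indicator hA).comp ((measurable_prepend w).comp hp))
  rw [Measure.map_apply hCY (measurable_hist t (hA.prod hB)), e1,
    measure_biUnion_finset (fun w _ w' _ hww => ?_) fun w _ =>
      (hY t (measurableSet_singleton w)).inter (hW (hR w)),
    setLIntegral_map (measurable_fst hB) e3 hCY]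
  · have e4 : ((fun ω => (path C ω, path Y ω)) ⁻¹' (Prod.fst ⁻¹' B)) = path C ⁻¹' B := rfl
    rw [e4, lintegral_finsetSum _ fun w _ => e2 w]
    refine Finset.sum_congr rfl fun w _ => ?_
    rw [h.measure_inter_eq hq hXD hY hC t w (hR w), ← lintegral_indicator (hW (hR w)),
      ← lintegral_indicator (measurable_path hC hB)]
    refine lintegral_congr_ae ?_
    filter_upwards [hXD] with ω hω
    rw [hXC] at hω
    have hQe := extendTransition_of_mem (q := q) hω t w (past (path Y ω) (t - 1))
    by_cases h1 : path C ω ∈ B <;>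
      by_cases h2 : prepend w (past (path Y ω) (t - 1)) ∈ A <;>
      simp [Set.indicator_apply, W, h1, h2, hQe, hXC]
  · refine Set.disjoint_left.2 fun ω hω hω' => hww ?_
    rw [← (Set.mem_singleton_iff.1 hω.1), ← (Set.mem_singleton_iff.1 hω'.1)]

end Solution

/-! ### Marginals of the coupled paths and identification of the coupling rate. -/

section Coupling

variable {T : Type*} [MeasurableSpace T] {P : Kernel T (ℕ → T)}
  {P' : Kernel (T × T) ((ℕ → T) × (ℕ → T))}

lemma IsCouplingKernel.isMarkovKernel [IsMarkovKernel P] (h : IsCouplingKernel P P') :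
    IsMarkovKernel P' := by
  refine ⟨fun s => ⟨?_⟩⟩
  have h1 := congrArg (fun ν => ν Set.univ) (h s.1 s.2).1
  simpa [Measure.map_apply measurable_fst MeasurableSet.univ] using h1

variable [IsMarkovKernel P] [IsMarkovKernel P'] {ν : Measure (ℕ → T)} [IsProbabilityMeasure ν]
  {lam : Measure (ℤ → T)}

lemma lintegral_glue_eq
    (hlam : lam.map (fun s => (past s 0, future s 1)) =
      ν ⊗ₘ (P.comap (fun s : ℕ → T => s 0) (measurable_pi_apply 0)))
    {Φ : (ℤ → T) → ℝ≥0∞} (hΦ : Measurable Φ) :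
    ∫⁻ z, ∫⁻ x, Φ (glue z x) ∂(P (z 0)) ∂ν = ∫⁻ s, Φ s ∂lam := by
  have h1 : Measurable fun p : (ℕ → T) × (ℕ → T) => Φ (glue p.1 p.2) := hΦ.comp measurable_glue
  have h2 := Measure.lintegral_compProd (μ := ν)
    (κ := P.comap (fun s : ℕ → T => s 0) (measurable_pi_apply 0)) h1
  rw [← hlam, lintegral_map h1 ((measurable_past 0).prodMk (measurable_future 1))] at h2
  simp only [glue_past_future, Kernel.comap_apply] at h2
  exact h2.symm

/-- Whatever the second past, the first future has law `P` given its own past; gluing restores the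
law of the chain. -/
lemma map_fst_couplingLaw (h : IsCouplingKernel P P')
    (hlam : lam.map (fun s => (past s 0, future s 1)) =
      ν ⊗ₘ (P.comap (fun s : ℕ → T => s 0) (measurable_pi_apply 0))) :
    (couplingLaw ν P').map Prod.fst = lam := by
  refine Measure.ext_of_lintegral _ fun Φ hΦ => ?_
  have hΦ' : Measurable fun p : (ℤ → T) × (ℤ → T) => Φ p.1 := hΦ.comp measurable_fst
  rw [lintegral_map hΦ measurable_fst, lintegral_couplingLaw hΦ',
    ← lintegral_glue_eq hlam hΦ]
  refine lintegral_congr fun z => ?_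
  have h1 : Measurable fun x : ℕ → T => Φ (glue z x) :=
    hΦ.comp (measurable_glue.comp measurable_prodMk_left)
  have h2 : ∀ z' : ℕ → T, ∫⁻ x, Φ (glue z x.1) ∂(P' (z 0, z' 0)) =
      ∫⁻ x, Φ (glue z x) ∂(P (z 0)) := fun z' => by
    rw [← (h (z 0) (z' 0)).1, lintegral_map h1 measurable_fst]
  simp [h2]

lemma map_snd_couplingLaw (h : IsCouplingKernel P P')
    (hlam : lam.map (fun s => (past s 0, future s 1)) =
      ν ⊗ₘ (P.comap (fun s : ℕ → T => s 0) (measurable_pi_apply 0))) :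
    (couplingLaw ν P').map Prod.snd = lam := by
  refine Measure.ext_of_lintegral _ fun Φ hΦ => ?_
  have hΦ' : Measurable fun p : (ℤ → T) × (ℤ → T) => Φ p.2 := hΦ.comp measurable_snd
  rw [lintegral_map hΦ measurable_snd, lintegral_couplingLaw hΦ',
    ← lintegral_glue_eq hlam hΦ]
  have h1 : ∀ z', Measurable fun x : ℕ → T => Φ (glue z' x) := fun z' =>
    hΦ.comp (measurable_glue.comp measurable_prodMk_left)
  have h2 : ∀ z z' : ℕ → T, ∫⁻ x, Φ (glue z' x.2) ∂(P' (z 0, z' 0)) =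
      ∫⁻ x, Φ (glue z' x) ∂(P (z' 0)) := fun z z' => by
    rw [← (h (z 0) (z' 0)).2, lintegral_map (h1 z') measurable_snd]
  simp [h2]

lemma couplingRate_discreteMetric_le_one {G : Type*} (g : T → G) (π : Measure T)
    [IsProbabilityMeasure π] (j : ℕ) : couplingRate discreteMetric g π P' j ≤ 1 := by
  classical
  have h1 : ∀ {α : Type _} [MeasurableSpace α] (ν : Measure α) [IsProbabilityMeasure ν]
      (f : α → ℝ≥0∞), (∀ x, f x ≤ 1) → ∫⁻ x, f x ∂ν ≤ 1 := fun ν _ f hf => by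
    simpa using lintegral_mono (μ := ν) hf
  refine h1 _ _ fun s => h1 _ _ fun s' => h1 _ _ fun z => ?_
  simp only [discreteMetric]
  split_ifs <;> simp

variable {G : Type*} [MeasurableSpace G] {g : T → G}

/-- Positive times involve the futures only, and these depend on the pasts through the two states at
time 0, which are independent. Time `k + 1` is coordinate `k` of a future, whence the `t - 1` in
`couplingRate`. -/
lemma lintegral_couplingLaw_eq_couplingRate (hg : Measurable g) {γ : G → G → ℝ≥0∞}
    (hγ : Measurable fun x : G × G => γ x.1 x.2) {j : ℕ} (hj : 1 ≤ j) :
    ∫⁻ p, γ (g (p.1 j)) (g (p.2 j)) ∂(couplingLaw ν P') =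
      couplingRate γ g (ν.map fun z => z 0) P' j := by
  obtain ⟨k, rfl⟩ : ∃ k, j = k + 1 := ⟨j - 1, by omega⟩
  have m0 : Measurable fun z : ℕ → T => z 0 := measurable_pi_apply 0
  have hgg : Measurable fun x : T × T => γ (g x.1) (g x.2) :=
    (hγ.comp ((hg.comp measurable_fst).prodMk (hg.comp measurable_snd)) :)
  have h1 : Measurable fun p : (ℤ → T) × (ℤ → T) =>
      γ (g (p.1 ((k + 1 : ℕ) : ℤ))) (g (p.2 ((k + 1 : ℕ) : ℤ))) :=
    hgg.comp (f := fun p : (ℤ → T) × (ℤ → T) => (p.1 ((k + 1 : ℕ) : ℤ), p.2 ((k + 1 : ℕ) : ℤ)))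
      (((measurable_pi_apply _).comp measurable_fst).prodMk
        ((measurable_pi_apply _).comp measurable_snd))
  have h2 : Measurable fun x : (ℕ → T) × (ℕ → T) => γ (g (x.1 k)) (g (x.2 k)) :=
    hgg.comp (f := fun x : (ℕ → T) × (ℕ → T) => (x.1 k, x.2 k))
      (((measurable_pi_apply _).comp measurable_fst).prodMk
        ((measurable_pi_apply _).comp measurable_snd))
  have h3 : Measurable fun s : T × T => ∫⁻ x, γ (g (x.1 k)) (g (x.2 k)) ∂(P' s) :=
    h2.lintegral_kernel
  have : IsProbabilityMeasure (ν.map fun z => z 0) := Measure.isProbabilityMeasure_map m0.aemeasurable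
  have h4 : Measurable fun s : T => ∫⁻ s', ∫⁻ x, γ (g (x.1 k)) (g (x.2 k)) ∂(P' (s, s'))
      ∂(ν.map fun z => z 0) := h3.lintegral_prod_right'
  have h5 : ∀ s : T, Measurable fun s' : T => ∫⁻ x, γ (g (x.1 k)) (g (x.2 k)) ∂(P' (s, s')) :=
    fun s => h3.comp measurable_prodMk_left
  rw [lintegral_couplingLaw h1]
  simp only [couplingRate, Nat.add_sub_cancel]
  rw [lintegral_map h4 m0]
  refine lintegral_congr fun z => ?_
  rw [lintegral_map (h5 _) m0]
  refine lintegral_congr fun z' => lintegral_congr fun x => ?_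
  simp only [Nat.cast_add, Nat.cast_one, glue_succ]

end Coupling

/-! ### The coupling of the stationary chain: moments, Hölder's inequality, and the coupled model.
-/

section Model

variable {Ω E G T : Type*} [MeasurableSpace Ω] {μ : Measure Ω} [MeasurableSpace T] {S : ℤ → Ω → T}

lemma map_past_zero (hS : ∀ t, Measurable (S t)) :
    ((μ.map fun ω => past (path S ω) 0).map fun z => z 0) = μ.map (S 0) := by
  have hpast : Measurable fun ω => past (path S ω) 0 :=
    (measurable_past 0).comp (measurable_path hS)
  rw [Measure.map_map (measurable_pi_apply 0) hpast]
  congr 1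

lemma IsStationaryProcess.map_eq (hS : ∀ t, Measurable (S t)) (h : IsStationaryProcess μ S)
    (t : ℤ) : μ.map (S t) = μ.map (S 0) := by
  have h1 := congrArg (fun ν => ν.map fun s : ℤ → T => s 0) (h t)
  have h2 : Measurable fun (ω : Ω) (u : ℤ) => S (u + t) ω := measurable_pi_lambda _ fun u => hS _
  simp only [Measure.map_map (measurable_pi_apply 0) h2,
    Measure.map_map (measurable_pi_apply 0) (measurable_path hS)] at h1
  have h3 : ((fun s : ℤ → T => s 0) ∘ fun (ω : Ω) (u : ℤ) => S (u + t) ω) = S t := by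
    funext ω
    simp
  rw [h3] at h1
  exact h1

variable [IsProbabilityMeasure μ]
  [Fintype E] [Nonempty E] [MeasurableSpace E]
  [NormedAddCommGroup G] [MeasurableSpace G] [BorelSpace G] [SecondCountableTopology G]
  {P : Kernel T (ℕ → T)} [IsMarkovKernel P] {P' : Kernel (T × T) ((ℕ → T) × (ℕ → T))}
  {g : T → G} {X : ℤ → Ω → G} {D : Set (ℤ → G)} {q : E → (ℕ → E) → (ℕ → G) → ℝ}

/-- The marginals of the coupling of two stationary chains. -/
lemma map_couplingLaw_eval (hS : ∀ t, Measurable (S t)) (hstat : IsStationaryProcess μ S)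
    (hM : IsMarkovChain μ S) (hP : IsPathKernel μ S P) (hP' : IsCouplingKernel P P') (t : ℤ) :
    (couplingLaw (μ.map fun ω => past (path S ω) 0) P').map (fun p => p.1 t) = μ.map (S 0) ∧
    (couplingLaw (μ.map fun ω => past (path S ω) 0) P').map (fun p => p.2 t) = μ.map (S 0) := by
  have hpast : Measurable fun ω => past (path S ω) 0 :=
    (measurable_past 0).comp (measurable_path hS)
  have : IsProbabilityMeasure (μ.map fun ω => past (path S ω) 0) :=
    Measure.isProbabilityMeasure_map hpast.aemeasurable
  have : IsMarkovKernel P' := hP'.isMarkovKernel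
  have hlam : (μ.map (path S)).map (fun s => (past s 0, future s 1)) =
      (μ.map fun ω => past (path S ω) 0) ⊗ₘ
        (P.comap (fun s : ℕ → T => s 0) (measurable_pi_apply 0)) := by
    rw [← hM.map_past_future hS hP,
      Measure.map_map ((measurable_past 0).prodMk (measurable_future 1)) (measurable_path hS)]
    rfl
  have hev : (μ.map (path S)).map (fun s : ℤ → T => s t) = μ.map (S 0) := by
    rw [Measure.map_map (measurable_pi_apply t) (measurable_path hS), ← hstat.map_eq hS t]
    rfl
  constructor
  · rw [← hev, ← map_fst_couplingLaw hP' hlam, Measure.map_map (measurable_pi_apply t) measurable_fst]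
    rfl
  · rw [← hev, ← map_snd_couplingLaw hP' hlam, Measure.map_map (measurable_pi_apply t) measurable_snd]
    rfl

/-- Minkowski's inequality, each coordinate having the stationary law at every time. The exponent 1
gives the moment bound of `kappa`; the exponent `p` enters Hölder's inequality. -/
lemma eLpNorm_couplingLaw_sub_le (hS : ∀ t, Measurable (S t)) (hstat : IsStationaryProcess μ S)
    (hM : IsMarkovChain μ S) (hP : IsPathKernel μ S P) (hP' : IsCouplingKernel P P')
    (hg : Measurable g) (hX : ∀ t ω, X t ω = g (S t ω)) {p : ℝ≥0∞} (hp : 1 ≤ p) (t : ℤ) :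
    eLpNorm (fun z : (ℤ → T) × (ℤ → T) => g (z.1 t) - g (z.2 t)) p
      (couplingLaw (μ.map fun ω => past (path S ω) 0) P') ≤ 2 * eLpNorm (X 0) p μ := by
  have hX0 : X 0 = g ∘ S 0 := funext fun ω => hX 0 ω
  have m₁ : Measurable fun z : (ℤ → T) × (ℤ → T) => z.1 t :=
    (measurable_pi_apply t).comp measurable_fst
  have m₂ : Measurable fun z : (ℤ → T) × (ℤ → T) => z.2 t :=
    (measurable_pi_apply t).comp measurable_snd
  obtain ⟨h₁, h₂⟩ := map_couplingLaw_eval hS hstat hM hP hP' t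
  have e₁ : eLpNorm (fun z : (ℤ → T) × (ℤ → T) => g (z.1 t)) p
      (couplingLaw (μ.map fun ω => past (path S ω) 0) P') = eLpNorm (X 0) p μ := by
    rw [hX0, ← eLpNorm_map_measure hg.aestronglyMeasurable (hS 0).aemeasurable, ← h₁,
      eLpNorm_map_measure hg.aestronglyMeasurable m₁.aemeasurable]
    rfl
  have e₂ : eLpNorm (fun z : (ℤ → T) × (ℤ → T) => g (z.2 t)) p
      (couplingLaw (μ.map fun ω => past (path S ω) 0) P') = eLpNorm (X 0) p μ := by
    rw [hX0, ← eLpNorm_map_measure hg.aestronglyMeasurable (hS 0).aemeasurable, ← h₂,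
      eLpNorm_map_measure hg.aestronglyMeasurable m₂.aemeasurable]
    rfl
  calc _ ≤ _ := eLpNorm_sub_le (hg.comp m₁).aestronglyMeasurable (hg.comp m₂).aestronglyMeasurable hp
    _ = 2 * eLpNorm (X 0) p μ := by
      rw [two_mul]
      exact congrArg₂ _ e₁ e₂

lemma IsTransition.isCoupledModel (hS : ∀ t, Measurable (S t)) (hstat : IsStationaryProcess μ S)
    (hM : IsMarkovChain μ S) (hP : IsPathKernel μ S P) (hP' : IsCouplingKernel P P')
    (hg : Measurable g) (hX : ∀ t ω, X t ω = g (S t ω)) (hD : MeasurableSet D)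
    (hXD : ∀ᵐ ω ∂μ, path X ω ∈ D) (hq : IsTransition q D)
    (hb : contCoef q D 0 < 1) (hbs : Summable (contCoef q D)) {e : ℕ → ℝ≥0}
    (he : ∀ (y : ℕ → E), ∀ x ∈ D, ∀ x' ∈ D, ∀ t t' : ℤ,
      ENNReal.ofReal (dTV (fun w => q w y (past x t)) (fun w => q w y (past x' t'))) ≤
        ∑' i : ℕ, e i * ‖past x t i - past x' t' i‖ₑ)
    {m : Measure ((ℤ → T) × (ℤ → E))} (hm : (hq.isResponseKernel hD hg).IsLaw m)
    (hmS : m.map Prod.fst = μ.map (path S)) {γ : G → G → ℝ} (hγ : ∀ x x', 0 ≤ γ x x')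
    (hγm : Measurable fun x : G × G => γ x.1 x.2) {c : ℕ → ℝ≥0∞}
    (hγc : ∀ j : ℕ, 1 ≤ j → couplingRate (fun x x' => ENNReal.ofReal (γ x x')) g (μ.map (S 0)) P' j
      ≤ c j)
    (hc : ∀ j : ℕ, 1 ≤ j → ∫⁻ p, ‖g (p.1 j) - g (p.2 j)‖ₑ
      ∂(couplingLaw (μ.map fun ω => past (path S ω) 0) P') ≤ c j) :
    IsCoupledModel (extendTransition q D g) {s | (fun u => g (s u)) ∈ D} (contCoef q D) e g γ P P' m
      c (∫⁻ ω, ‖X 0 ω‖ₑ ∂μ) := by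
  have hne : D.Nonempty := by
    obtain ⟨ω, hω⟩ := hXD.exists
    exact ⟨_, hω⟩
  have hanti := hq.antitone_contCoef hne
  have hpath := measurable_path hS
  have hpast : Measurable fun ω => past (path S ω) 0 := (measurable_past 0).comp hpath
  have : IsProbabilityMeasure (μ.map fun ω => past (path S ω) 0) :=
    Measure.isProbabilityMeasure_map hpast.aemeasurable
  have : IsMarkovKernel P' := hP'.isMarkovKernel
  have hgs : Measurable fun s : ℤ → T => (fun u => g (s u) : ℤ → G) :=
    measurable_pi_lambda _ fun u => hg.comp (measurable_pi_apply u)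
  have h𝒟 : MeasurableSet {s : ℤ → T | (fun u => g (s u)) ∈ D} := hgs hD
  have hmp : (m.map fun ω => past ω.1 0) = μ.map fun ω => past (path S ω) 0 := by
    have := congrArg (fun ν => ν.map fun s => past s 0) hmS
    simp only [Measure.map_map (measurable_past 0) measurable_fst,
      Measure.map_map (measurable_past 0) hpath] at this
    exact this
  have hπ := map_past_zero (μ := μ) hS
  refine ⟨hq.isResponseKernel hD hg, hm, contCoef_nonneg q D,
    fun i => (hanti (Nat.zero_le i)).trans_lt hb, hanti, hbs, ?_, h𝒟, ?_, ?_, hγ, hg, hγm, hP',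
    ?_, ?_, ?_⟩
  · refine ae_of_ae_map (f := Prod.fst) (p := fun s => s ∈ {s : ℤ → T | (fun u => g (s u)) ∈ D})
      measurable_fst.aemeasurable ?_
    rw [hmS]
    refine (ae_map_iff hpath.aemeasurable h𝒟).2 ?_
    filter_upwards [hXD] with ω hω
    have : path X ω = fun u => g (path S ω u) := funext fun u => hX u ω
    rw [this] at hω
    exact hω
  · rw [hmp, ← hM.map_past_future hS hP]
    have hpf : Measurable fun s : ℤ → T => (past s 0, future s 1) :=
      (measurable_past 0).prodMk (measurable_future 1)
    have := congrArg (fun ν => ν.map fun s => (past s 0, future s 1)) hmS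
    simp only [Measure.map_map hpf measurable_fst, Measure.map_map hpf hpath] at this
    exact this
  · intro s hs s' hs' t y
    simp only [extendTransition_of_mem (show (fun u => g (s u)) ∈ D from hs),
      extendTransition_of_mem (show (fun u => g (s' u)) ∈ D from hs')]
    exact he y _ hs _ hs' t t
  · intro j hj
    rw [hmp]
    refine le_trans (le_of_eq ?_) (hγc j hj)
    rw [← hπ]
    exact lintegral_couplingLaw_eq_couplingRate (γ := fun x x' => ENNReal.ofReal (γ x x')) hg
      hγm.ennreal_ofReal hj
  · rw [hmp]
    exact hc
  · intro t
    rw [hmp]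
    have := eLpNorm_couplingLaw_sub_le hS hstat hM hP hP' hg hX le_rfl t
    simpa only [eLpNorm_one_eq_lintegral_enorm] using this

lemma couplingRate_normMetric_eq (hS : ∀ t, Measurable (S t)) [IsMarkovKernel P']
    (hg : Measurable g) {j : ℕ} (hj : 1 ≤ j) :
    ∫⁻ p, ‖g (p.1 j) - g (p.2 j)‖ₑ ∂(couplingLaw (μ.map fun ω => past (path S ω) 0) P') =
      couplingRate normMetric g (μ.map (S 0)) P' j := by
  have hpast : Measurable fun ω => past (path S ω) 0 :=
    (measurable_past 0).comp (measurable_path hS)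
  have : IsProbabilityMeasure (μ.map fun ω => past (path S ω) 0) :=
    Measure.isProbabilityMeasure_map hpast.aemeasurable
  have hπ := map_past_zero (μ := μ) hS
  have hγ : Measurable fun x : G × G => normMetric x.1 x.2 :=
    (measurable_snd.sub measurable_fst).enorm
  rw [← hπ, ← lintegral_couplingLaw_eq_couplingRate hg hγ hj]
  refine lintegral_congr fun p => ?_
  rw [normMetric, enorm_sub_rev]

lemma measurable_discreteMetric : Measurable fun x : G × G => discreteMetric x.1 x.2 := by
  classical
  refine Measurable.ite ?_ measurable_const measurable_const
  exact measurableSet_eq_fun measurable_fst measurable_snd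

lemma couplingRate_discreteMetric_eq (hS : ∀ t, Measurable (S t)) [IsMarkovKernel P']
    (hg : Measurable g) {j : ℕ} (hj : 1 ≤ j) :
    couplingLaw (μ.map fun ω => past (path S ω) 0) P' {p | g (p.1 j) ≠ g (p.2 j)} =
      couplingRate discreteMetric g (μ.map (S 0)) P' j := by
  classical
  have hpast : Measurable fun ω => past (path S ω) 0 :=
    (measurable_past 0).comp (measurable_path hS)
  have : IsProbabilityMeasure (μ.map fun ω => past (path S ω) 0) :=
    Measure.isProbabilityMeasure_map hpast.aemeasurable
  have hπ := map_past_zero (μ := μ) hS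
  have hset : MeasurableSet {p : (ℤ → T) × (ℤ → T) | g (p.1 j) ≠ g (p.2 j)} :=
    (measurableSet_eq_fun (hg.comp ((measurable_pi_apply _).comp measurable_fst))
      (hg.comp ((measurable_pi_apply _).comp measurable_snd))).compl
  rw [← hπ, ← lintegral_couplingLaw_eq_couplingRate hg measurable_discreteMetric hj,
    ← lintegral_indicator_one hset]
  refine lintegral_congr fun p => ?_
  by_cases hp : g (p.1 j) = g (p.2 j) <;> simp [discreteMetric, hp]

/-- Hölder's inequality: the mean distance of the coupled covariates through the probability that
they differ. -/
lemma lintegral_couplingLaw_le_rpow [NormedSpace ℝ G] (hS : ∀ t, Measurable (S t)) (hstat : IsStationaryProcess μ S)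
    (hM : IsMarkovChain μ S) (hP : IsPathKernel μ S P) (hP' : IsCouplingKernel P P')
    (hg : Measurable g) (hX : ∀ t ω, X t ω = g (S t ω)) {p r : ℝ≥0∞} (hpr : p.HolderConjugate r)
    {j : ℕ} (hj : 1 ≤ j) :
    ∫⁻ z, ‖g (z.1 j) - g (z.2 j)‖ₑ ∂(couplingLaw (μ.map fun ω => past (path S ω) 0) P') ≤
      2 * eLpNorm (X 0) p μ *
        couplingRate discreteMetric g (μ.map (S 0)) P' j ^ (r⁻¹).toReal := by
  have : IsMarkovKernel P' := hP'.isMarkovKernel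
  have hp : 1 ≤ p := ENNReal.HolderConjugate.one_le p r
  have : r.HolderTriple p 1 := hpr.symm
  let A : Set ((ℤ → T) × (ℤ → T)) := {p | g (p.1 j) ≠ g (p.2 j)}
  have m₁ : Measurable fun z : (ℤ → T) × (ℤ → T) => g (z.1 j) :=
    hg.comp ((measurable_pi_apply _).comp measurable_fst)
  have m₂ : Measurable fun z : (ℤ → T) × (ℤ → T) => g (z.2 j) :=
    hg.comp ((measurable_pi_apply _).comp measurable_snd)
  have hA : MeasurableSet A := (measurableSet_eq_fun m₁ m₂).compl
  -- The difference of the covariates vanishes off `A`, so multiplication by `φ` does not change it,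
  -- and the L^r norm of `φ` produces the power 1/r of the rate.
  let φ : (ℤ → T) × (ℤ → T) → ℝ := A.indicator fun _ => 1
  have hφ : Measurable φ := measurable_const.indicator hA
  let f : (ℤ → T) × (ℤ → T) → G := fun z => g (z.1 j) - g (z.2 j)
  have hf : Measurable f := m₁.sub m₂
  have hφf : φ • f = f := by
    funext z
    by_cases hz : z ∈ A
    · simp [φ, hz]
    · have : f z = 0 := sub_eq_zero.2 (not_not.1 hz)
      simp [φ, this]
  have h1 := eLpNorm_smul_le_mul_eLpNorm (p := r) (q := p) (r := 1)
    (μ := couplingLaw (μ.map fun ω => past (path S ω) 0) P') hf.aestronglyMeasurable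
    hφ.aestronglyMeasurable
  rw [hφf, eLpNorm_one_eq_lintegral_enorm] at h1
  refine h1.trans ?_
  rw [mul_comm]
  refine mul_le_mul' (eLpNorm_couplingLaw_sub_le hS hstat hM hP hP' hg hX hp j) ?_
  refine (eLpNorm_indicator_const_le (1 : ℝ) r).trans_eq ?_
  rw [couplingRate_discreteMetric_eq hS hg hj, ENNReal.toReal_inv, one_div]
  simp

end Model

/-! ### A version of the responses specified conditionally on the chain. -/

section Realization

variable {Ω E G T : Type*} [MeasurableSpace Ω] {μ : Measure Ω} [IsProbabilityMeasure μ]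
  [Fintype E] [Nonempty E] [MeasurableSpace E] [MeasurableSingletonClass E]
  [MeasurableSpace G] [MeasurableSpace T] {S : ℤ → Ω → T} {g : T → G} {X : ℤ → Ω → G}
  {Y : ℤ → Ω → E} {D : Set (ℤ → G)} {q : E → (ℕ → E) → (ℕ → G) → ℝ}

/-- Responses specified conditionally on the covariates have a version, with the same joint law of
covariates and responses, that is specified conditionally on the chain. -/
lemma IsSolution.exists_isLaw (hS : ∀ t, Measurable (S t)) (hg : Measurable g)
    (hX : ∀ t ω, X t ω = g (S t ω)) (hD : MeasurableSet D) (hXD : ∀ᵐ ω ∂μ, path X ω ∈ D)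
    (hq : IsTransition q D) (hY : ∀ t, Measurable (Y t)) (h : IsSolution μ q Y X X) :
    ∃ m : Measure ((ℤ → T) × (ℤ → E)), IsProbabilityMeasure m ∧
      (hq.isResponseKernel hD hg).IsLaw m ∧ m.map Prod.fst = μ.map (path S) ∧
      m.map (fun ω => ((fun t => g (ω.1 t) : ℤ → G), ω.2)) = μ.map fun ω => (path X ω, path Y ω) := by
  have hXm : ∀ t, Measurable (X t) := fun t => by
    rw [funext (hX t)]
    exact hg.comp (hS t)
  have hpS := measurable_path hS
  have hθ : Measurable fun s : ℤ → T => (fun u => g (s u) : ℤ → G) :=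
    measurable_pi_lambda _ fun u => hg.comp (measurable_pi_apply u)
  have : IsProbabilityMeasure (μ.map (path S)) := Measure.isProbabilityMeasure_map hpS.aemeasurable
  have hlam : (μ.map (path S)).map (fun s => (fun u => g (s u) : ℤ → G)) = μ.map (path X) := by
    rw [Measure.map_map hθ hpS]
    congr 1
    funext ω u
    exact (hX u ω).symm
  -- The responses are redrawn so as to be conditionally independent of the chain given the
  -- covariates.
  let κ := condDistrib (path Y) (path X) μ
  have hκ : ((μ.map (path S)).map fun s => (fun u => g (s u) : ℤ → G)) ⊗ₘ κ =
      μ.map fun ω => (path X ω, path Y ω) := by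
    rw [hlam, compProd_map_condDistrib (measurable_path hY).aemeasurable]
  refine ⟨(μ.map (path S)) ⊗ₘ (κ.comap _ hθ), inferInstance, ?_, ?_, ?_⟩
  · have h1 := h.isLaw hq hD measurable_id (fun _ _ => rfl) hXD hY hXm
    rw [← hκ] at h1
    exact h1.lift hθ (hq.isResponseKernel hD hg)
  · exact Measure.fst_compProd _ _
  · rw [map_prodMk_compProd_comap hθ, hκ]

end Realization

end

/-! ### Assembly of the two bounds. -/

theorem theorem2
    {Ω E G 𝒮 : Type*} [MeasurableSpace Ω] (μ : Measure Ω) [IsProbabilityMeasure μ]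
    [Fintype E] [Nonempty E] [MeasurableSpace E] [MeasurableSingletonClass E]
    [NormedAddCommGroup G] [NormedSpace ℝ G] [FiniteDimensional ℝ G]
    [MeasurableSpace G] [BorelSpace G]
    [TopologicalSpace 𝒮] [PolishSpace 𝒮] [MeasurableSpace 𝒮] [BorelSpace 𝒮]
    -- the stationary Markov chain, its path kernel, and the covariates
    (S : ℤ → Ω → 𝒮) (hSmeas : ∀ t, Measurable (S t))
    (hSstat : IsStationaryProcess μ S) (hSmarkov : IsMarkovChain μ S)
    (P : Kernel 𝒮 (ℕ → 𝒮)) [IsMarkovKernel P] (hP : IsPathKernel μ S P)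
    (g : 𝒮 → G) (hg : Measurable g)
    (X : ℤ → Ω → G) (hX : ∀ t ω, X t ω = g (S t ω))
    -- the covariate process is stationary and ergodic
    (hS1 : Ergodic (fun (x : ℤ → G) (t : ℤ) => x (t + 1)) (μ.map (path X)))
    -- the response process
    (D : Set (ℤ → G)) (hD : MeasurableSet D) (hXD : ∀ᵐ ω ∂μ, path X ω ∈ D)
    (q : E → (ℕ → E) → (ℕ → G) → ℝ) (hq : IsTransition q D)
    (Y : ℤ → Ω → E) (hYmeas : ∀ t, Measurable (Y t)) (hY : IsSolution μ q Y X X)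
    -- contraction in the past responses
    (hS2 : contCoef q D 0 < 1 ∧ Summable (contCoef q D))
    -- Lipschitz condition in the covariates
    (e : ℕ → ℝ≥0) (he : Summable e)
    (hS3 : ∀ (y : ℕ → E), ∀ x ∈ D, ∀ x' ∈ D, ∀ t t' : ℤ,
      ENNReal.ofReal (dTV (fun w => q w y (past x t)) (fun w => q w y (past x' t'))) ≤
        ∑' i : ℕ, e i * ‖past x t i - past x' t' i‖ₑ) :
    -- discrete metric: absolute regularity
    (∀ P' : Kernel (𝒮 × 𝒮) ((ℕ → 𝒮) × (ℕ → 𝒮)), IsCouplingKernel P P' →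
      Tendsto (couplingRate discreteMetric g (μ.map (S 0)) P') atTop (𝓝 0) →
      ∀ p r : ℝ≥0∞, p.HolderConjugate r → MemLp (X 0) p μ →
      ∀ n : ℕ, 1 ≤ n →
        betaCoef μ (fun t ω => (Y t ω, X t ω)) n ≤
          ∑' k : ℕ, rate (contCoef q D) e
            (fun t => max 1 (2 * eLpNorm (X 0) p μ) *
              couplingRate discreteMetric g (μ.map (S 0)) P' t ^ (r⁻¹).toReal)
            (∫⁻ ω, ‖X 0 ω‖ₑ ∂μ) (n + k)) ∧
    -- metric of the norm: τ-dependence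
    (∀ P' : Kernel (𝒮 × 𝒮) ((ℕ → 𝒮) × (ℕ → 𝒮)), IsCouplingKernel P P' →
      Tendsto (couplingRate normMetric g (μ.map (S 0)) P') atTop (𝓝 0) →
      ∀ n : ℕ, 1 ≤ n →
        -- relative to the σ-field generated by `(Y_i, X_i)`, `i ≤ 0`
        tauCoef μ (fun ω => past (path (fun t ω => (Y t ω, X t ω)) ω) 0)
            (fun t ω => (Y t ω, X t ω)) n ≤
          ⨆ (j : ℕ) (_ : n ≤ j), rate (contCoef q D) e
            (couplingRate normMetric g (μ.map (S 0)) P') (∫⁻ ω, ‖X 0 ω‖ₑ ∂μ) j ∧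
        -- relative to the σ-field generated by `(Y_i, S_i)`, `i ≤ 0`, when the responses are
        -- specified conditionally on the chain
        (IsSolution μ q Y X S →
          tauCoef μ (fun ω => past (path (fun t ω => (Y t ω, S t ω)) ω) 0)
              (fun t ω => (Y t ω, X t ω)) n ≤
            ⨆ (j : ℕ) (_ : n ≤ j), rate (contCoef q D) e
              (couplingRate normMetric g (μ.map (S 0)) P') (∫⁻ ω, ‖X 0 ω‖ₑ ∂μ) j)) := by
  classical
  have : Nonempty Ω := nonempty_of_isProbabilityMeasure μ
  have : Nonempty 𝒮 := ‹Nonempty Ω›.map (S 0)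
  have : SecondCountableTopology G := by
    have := FiniteDimensional.proper_real G
    infer_instance
  have hXm : ∀ t, Measurable (X t) := fun t => by
    rw [funext (hX t)]
    exact hg.comp (hSmeas t)
  have hXY : Measurable fun ω => (path X ω, path Y ω) :=
    (measurable_path hXm).prodMk (measurable_path hYmeas)
  -- Coefficients relative to the past of (Y, X) depend on the law of (X, Y) only, so they may be
  -- computed under `m`.
  obtain ⟨m, _, hm, hmS, hmXY⟩ := hY.exists_isLaw hSmeas hg hX hD hXD hq hYmeas
  let ψ : (ℕ → E) × (ℕ → 𝒮) → ℕ → E × G := fun p i => (p.1 i, g (p.2 i))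
  have hψ : Measurable ψ := measurable_pi_lambda _ fun i =>
    ((measurable_pi_apply i).comp measurable_fst).prodMk
      (hg.comp ((measurable_pi_apply i).comp measurable_snd))
  have hgs : Measurable fun ω : (ℤ → 𝒮) × (ℤ → E) => ((fun t => g (ω.1 t) : ℤ → G), ω.2) :=
    (measurable_pi_lambda _ fun t =>
      hg.comp ((measurable_pi_apply t).comp measurable_fst)).prodMk measurable_snd
  have hlaw : μ.map (fun ω => (past (path (fun t ω => (Y t ω, X t ω)) ω) 0, path X ω, path Y ω)) =
      m.map (fun ω => (ψ (pastPair ω), (fun t => g (ω.1 t)), ω.2)) := by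
    let θ : (ℤ → G) × (ℤ → E) → (ℕ → E × G) × (ℤ → G) × (ℤ → E) := fun p =>
      (fun i => (p.2 (0 - i), p.1 (0 - i)), p)
    have hθ : Measurable θ := (measurable_pi_lambda _ fun i =>
      ((measurable_pi_apply _).comp measurable_snd).prodMk
        ((measurable_pi_apply _).comp measurable_fst)).prodMk measurable_id
    have h1 := congrArg (fun ν => ν.map θ) hmXY
    simp only [Measure.map_map hθ hgs, Measure.map_map hθ hXY] at h1
    exact h1.symm
  refine ⟨fun P' hP' _ p r hpr _ n hn => ?_, fun P' hP' _ n hn => ?_⟩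
  · have : IsMarkovKernel P' := hP'.isMarkovKernel
    have : IsProbabilityMeasure (μ.map (S 0)) :=
      Measure.isProbabilityMeasure_map (hSmeas 0).aemeasurable
    -- The rate must dominate both the probability that the covariates differ and their mean
    -- distance. The former uses a ≤ a^(1/r) for a ≤ 1, which is the 1 in the maximum; the latter is
    -- Hölder's inequality.
    have hrate : ∀ j : ℕ, 1 ≤ j → couplingRate discreteMetric g (μ.map (S 0)) P' j ≤
        max 1 (2 * eLpNorm (X 0) p μ) *
          couplingRate discreteMetric g (μ.map (S 0)) P' j ^ (r⁻¹).toReal := by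
      intro j hj
      have hr : 1 ≤ r := by
        have := hpr.symm
        exact ENNReal.HolderConjugate.one_le r p
      have hr' : (r⁻¹).toReal ≤ 1 :=
        ENNReal.toReal_le_of_le_ofReal zero_le_one (by simpa using hr)
      have hle : couplingRate discreteMetric g (μ.map (S 0)) P' j ≤ 1 :=
        couplingRate_discreteMetric_le_one g _ j
      calc _ = 1 * couplingRate discreteMetric g (μ.map (S 0)) P' j ^ (1 : ℝ) := by simp
        _ ≤ _ := mul_le_mul' (le_max_left _ _) (ENNReal.rpow_le_rpow_of_exponent_ge hle hr')
    have hd : (fun x x' : G => ENNReal.ofReal (if x = x' then 0 else 1)) = discreteMetric := by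
      funext x x'
      by_cases h : x = x' <;> simp [discreteMetric, h]
    refine (hq.isCoupledModel (e := e) (γ := fun x x' : G => if x = x' then 0 else 1) hSmeas hSstat
      hSmarkov hP hP' hg hX hD hXD hS2.1 hS2.2 hS3 hm hmS
      (fun x x' => by split_ifs <;> norm_num)
      (Measurable.ite (measurableSet_eq_fun measurable_fst measurable_snd) measurable_const
        measurable_const) (fun j hj => ?_) (fun j hj => ?_)).betaCoef_le hXm hYmeas hψ hlaw hn
    · rw [hd]
      exact hrate j hj
    · exact (lintegral_couplingLaw_le_rpow hSmeas hSstat hSmarkov hP hP' hg hX hpr hj).trans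
        (mul_le_mul' (le_max_right _ _) le_rfl)
  · have : IsMarkovKernel P' := hP'.isMarkovKernel
    have hnm : (fun x x' : G => ENNReal.ofReal ‖x' - x‖) = normMetric := by
      funext x x'
      rw [ofReal_norm]
      rfl
    have hmodel : ∀ {m : Measure ((ℤ → 𝒮) × (ℤ → E))},
        (hq.isResponseKernel hD hg).IsLaw m → m.map Prod.fst = μ.map (path S) →
        IsCoupledModel (extendTransition q D g) {s | (fun u => g (s u)) ∈ D} (contCoef q D) e g
          (fun x x' => ‖x' - x‖) P P' m (couplingRate normMetric g (μ.map (S 0)) P')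
          (∫⁻ ω, ‖X 0 ω‖ₑ ∂μ) := fun hm hmS =>
      hq.isCoupledModel hSmeas hSstat hSmarkov hP hP' hg hX hD hXD hS2.1 hS2.2 hS3 hm hmS
        (fun _ _ => norm_nonneg _) (measurable_snd.sub measurable_fst).norm
        (fun j _ => by rw [hnm]) (fun j hj => (couplingRate_normMetric_eq hSmeas hg hj).le)
    have hZ : Measurable fun ω => past (path (fun t ω => (Y t ω, X t ω)) ω) 0 :=
      measurable_pi_lambda _ fun i => (hYmeas _).prodMk (hXm _)
    refine ⟨(hmodel hm hmS).tauCoef_le hXm hYmeas hZ hψ hlaw hn, fun hYS => ?_⟩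
    have hZS : Measurable fun ω => past (path (fun t ω => (Y t ω, S t ω)) ω) 0 :=
      measurable_pi_lambda _ fun i => (hYmeas _).prodMk (hSmeas _)
    have hSY : Measurable fun ω => (path S ω, path Y ω) :=
      (measurable_path hSmeas).prodMk (measurable_path hYmeas)
    have : IsProbabilityMeasure (μ.map fun ω => (path S ω, path Y ω)) :=
      Measure.isProbabilityMeasure_map hSY.aemeasurable
    let φ : (ℕ → E) × (ℕ → 𝒮) → ℕ → E × 𝒮 := fun p i => (p.1 i, p.2 i)
    have hφ : Measurable φ := measurable_pi_lambda _ fun i =>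
      ((measurable_pi_apply i).comp measurable_fst).prodMk
        ((measurable_pi_apply i).comp measurable_snd)
    -- The σ-field now involves S, so the law of the pair (S, Y) itself is needed; it satisfies the
    -- recursion by the additional hypothesis.
    refine (hmodel (hYS.isLaw hq hD hg hX hXD hYmeas hSmeas) ?_).tauCoef_le hXm hYmeas hZS hφ ?_ hn
    · rw [Measure.map_map measurable_fst hSY]
      rfl
    · have h1 : Measurable fun ω : (ℤ → 𝒮) × (ℤ → E) =>
          (φ (pastPair ω), (fun t => g (ω.1 t) : ℤ → G), ω.2) :=
        (hφ.comp measurable_pastPair).prodMk hgs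
      rw [Measure.map_map h1 hSY]
      congr 1
      funext ω
      have : path X ω = fun t => g (path S ω t) := funext fun t => hX t ω
      simp only [Function.comp_apply, this]
      rfl
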